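/- **Setting.** Let $\mathbb X,\mathbb A$ be finite sets, $H\ge1$ a horizon, $N\ge 1$ a batch size, $\mathbb P_h(x,a)$ ($h\in[1:H-1]$) transition probabilities on $\mathbb X$, and $r_h:\mathbb X\times\mathbb A\to[0,1]$ ($h<H$), $r_H:\mathbb X\to[0,1]$ costs; write $r_H(x,a)=r_H(x)$. A functional $\rho:\mathbb R^{\mathbb X}\to\mathbb R$ is a coherent measure of risk if it is convex, monotone, satisfies $\rho(V+b)=\rho(V)+b$ for constants $b$, and is positively homogeneous. For $h<H$ let $\sigma^{\rm b}_h(x,P,\cdot)$ be, for every $x\in\mathbb X$ and every probability $P$ on $\mathbb X$, a coherent measure of risk that depends only on the values of its argument on the support of $P$, and let $$\sigma_h(x,P,V)=\mathbb E_{Y^{1:N}\sim P^N}\big[\sigma_h^{\rm b}\big(x,\tfrac1N\textstyle\sum_j\delta_{Y^j},V\big)\big]$$ be the mini-batch transition risk mapping. For a Markov policy $\pi$ put $V_H^\pi=V_H^\star=r_H$ and, for $h<H$, $V_h^\pi(x)=r_h(x,\pi_h(x))+\sigma_h(x,\mathbb P_h(x,\pi_h(x)),V^\pi_{h+1})$,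 $V_h^\star(x)=\min_a\{r_h(x,a)+\sigma_h(x,\mathbb P_h(x,a),V^\star_{h+1})\}$. The model is *multipattern* with feature map $\varphi$ from $\mathbb X\times\mathbb A$ to the unit simplex of $\mathbb R^d$: for each $h\le H$ there is $\theta_h\in\mathbb R^d$ with $\|\theta_h\|\le\sqrt d$ and $r_h(x,a)=\varphi(x,a)^\top\theta_h$ for all $(x,a)$, and for each $h<H$ there are coherent measures of risk $\rho_{h1},\dots,\rho_{hd}$ on $\mathbb R^{\mathbb X}$, with $\|\rho_h(1)\|\le\sqrt d$, such that $\sigma_h(x,\mathbb P_h(x,a),V)=\sum_j\varphi_j(x,a)\rho_{hj}(V)$ for all $x,a,V$. **Algorithm** (parameters $\lambda>0$, $\beta$). In episode $k=1,\dots,K$ an initial state $x_1^k$ is received (it may depend on the past). With $Q^k_{H+1}=0$, compute for $h=H,\dots,1$ $$\Lambda_h^k=\sum_{\tau<k}\varphi_h^\tau(\varphi_h^\tau)^\top+\lambda I,\qquad w_h^k=(\Lambda_h^k)^{-1}\sum_{\tau<k}\varphi_h^\tau\big[r_h(x_h^\tau,a_h^\tau)+\widetilde\Psi_{h+1}^\tau(Q_{h+1}^k)\big],$$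 $$Q_h^k(x,a)=\max\big\{(w_h^k)^\top\varphi(x,a)-\beta\,[\varphi(x,a)^\top(\Lambda_h^k)^{-1}\varphi(x,a)]^{1/2},\,0\big\},$$ where $\varphi_h^\tau=\varphi(x_h^\tau,a_h^\tau)$ and the $\widetilde\Psi$-term is absent for $h=H$. Let $\pi_{k,h}(x)\in\arg\min_aQ_h^k(x,a)$ (ties broken arbitrarily, using past information only). Then for $h=1,2,\dots,H$ take $a_h^k=\pi_{k,h}(x_h^k)$ and, if $h<H$, observe a batch $Y_{h+1}^k$ of $N$ states that are, given the past $\mathcal F_h^k$, independent with law $\mathbb P_h(x_h^k,a_h^k)$, and let $x_{h+1}^k$ be a uniformly chosen element of the batch. Here $\mathcal F_h^k$ is the information available when $x_h^k$ is reached; it contains all earlier states, actions and batches. The basic algorithm uses $\widetilde\Psi_{h+1}^\tau(Q)=\sigma^{\rm b}_h\big(x_h^\tau,\frac1N\sum_j\delta_{Y_{h+1}^{\tau,j}},\min_aQ(\cdot,a)\big)$. An *$L$-economical estimator* is any family of random functionals $\widetilde\Psi_{h+1}^\tau$ on $\mathbb R^{\mathbb X\times\mathbb A}$ such that $\widetilde\Psi_{h+1}^\tau(Q)$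 is $\mathcal F_{h+1}^\tau$-measurable, $\widetilde\Psi_{h+1}^\tau(0)=0$, $|\widetilde\Psi_{h+1}^\tau(Q)-\widetilde\Psi_{h+1}^\tau(Q')|\le L\max|Q-Q'|$, and, for every $Q$, $$\mathbb E\big[\widetilde\Psi_{h+1}^\tau(Q)\,\big|\,\mathcal F_h^\tau\big]=\sigma_h\big(x_h^\tau,\mathbb P_h(x_h^\tau,a_h^\tau),\min_aQ(\cdot,a)\big).$$ **Theorem.** For all $B,L\ge1$ there is a constant $c_\beta>0$, depending only on $B$ and $L$, such that the following holds for every model as above and all $K\ge1$ and $p\in(0,1)$. Let $\Gamma=\ln(2dKH/p)$, let $\lambda>0$ satisfy $\lambda\le B$ and $\ln(1/\lambda)\le B\,\Gamma$, and run the algorithm with $\beta=c_\beta dH\sqrt{\Gamma}$, either in its basic form or with $L$-economical estimators. Then with probability at least $1-p$, $$\sum_{k=1}^K\big[V_1^{\pi_k}(x_1^k)-V_1^\star(x_1^k)\big]\le c_\beta H^2N^Hd\sqrt K\sqrt{2d\,\Gamma\ln(1+K/\lambda)} .$$ (In particular $B=L=1$ gives an absolute constant for the basic algorithm and all $\lambda\in[p/(2dKH),1]$;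 for any fixed $\lambda>0$ the constant for the basic algorithm depends on $\lambda$ only.) -/

import Mathlib

noncomputable section

namespace RiskQ

open MeasureTheory

/-- Coherent measures of risk on the space of real functions on `X`
(the four axioms: convexity, monotonicity, translation, positive homogeneity). -/
structure IsCoherent {X : Type*} (ρ : (X → ℝ) → ℝ) : Prop where
  convex : ∀ (V W : X → ℝ) (t : ℝ), 0 ≤ t → t ≤ 1 →
    ρ (fun x => t * V x + (1 - t) * W x) ≤ t * ρ V + (1 - t) * ρ W
  monotone : ∀ V W : X → ℝ, (∀ x, V x ≤ W x) → ρ V ≤ ρ W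
  translation : ∀ (V : X → ℝ) (b : ℝ), ρ (fun x => V x + b) = ρ V + b
  pos_homogeneous : ∀ (V : X → ℝ) (t : ℝ), 0 ≤ t → ρ (fun x => t * V x) = t * ρ V

/-- A coherent transition risk mapping `σ(x, P, V)`: a coherent measure of risk of `V` on the
probability space `(X, P)`, so that only the values of `V` on the support of `P` matter.
(For an empirical measure this says that `σ` is a function of the batch values of `V`.) -/
structure IsTransitionRiskMapping {X : Type*} (σ : X → PMF X → (X → ℝ) → ℝ) : Prop where
  coherent : ∀ x P, IsCoherent (σ x P)
  congr_support : ∀ (x : X) (P : PMF X) (V W : X → ℝ),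
    (∀ y ∈ P.support, V y = W y) → σ x P V = σ x P W

/-- The empirical measure `(1/N) ∑ j, δ_{y j}` of a batch. -/
def empirical {X : Type*} {N : ℕ} [NeZero N] (y : Fin N → X) : PMF X :=
  (PMF.uniformOfFintype (Fin N)).map y

/-- The probability of the batch `y` under `N` independent draws from `P`. -/
def batchProb {X : Type*} {N : ℕ} (P : PMF X) (y : Fin N → X) : ℝ :=
  ∏ j, (P (y j)).toReal

/-- The mini-batch transition risk mapping
`σ^{(N)}(x, P, V) = E_{Y ∼ P^N} [σ^b(x, P^{(N)}, V)]` with base mapping `σ^b`. -/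
def miniBatch {X : Type*} [Fintype X] (N : ℕ) [NeZero N]
    (σb : X → PMF X → (X → ℝ) → ℝ) (x : X) (P : PMF X) (V : X → ℝ) : ℝ :=
  ∑ y : Fin N → X, batchProb P y * σb x (empirical y) V

/-- The data of a finite-horizon risk-averse MDP with stages `1, …, H`: controlled kernels, stage
costs, terminal cost, and the base risk mappings from which the mini-batch mappings are built. -/
structure RiskMDP (X A : Type*) (H : ℕ) where
  kernel : ℕ → X → A → PMF X
  cost : ℕ → X → A → ℝ
  termCost : X → ℝ
  baseRisk : ℕ → X → PMF X → (X → ℝ) → ℝ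
  cost_mem : ∀ h, 1 ≤ h → h < H → ∀ x a, cost h x a ∈ Set.Icc (0 : ℝ) 1
  termCost_mem : ∀ x, termCost x ∈ Set.Icc (0 : ℝ) 1
  baseRisk_coherent : ∀ h, 1 ≤ h → h < H → IsTransitionRiskMapping (baseRisk h)

namespace RiskMDP

variable {X A : Type*} {H : ℕ}

/-- `r_h(x, a)` for `h ∈ [1:H]`, with `r_H(x, a) = r_H(x)`. -/
def stageCost (M : RiskMDP X A H) (h : ℕ) (x : X) (a : A) : ℝ :=
  if h = H then M.termCost x else M.cost h x a

/-- `σ^{(N)}_h(x, P_h(x, a), V)`. -/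
def risk [Fintype X] (M : RiskMDP X A H) (N : ℕ) [NeZero N] (h : ℕ) (x : X) (a : A)
    (V : X → ℝ) : ℝ :=
  miniBatch N (M.baseRisk h) x (M.kernel h x a) V

/-- The value of a Markov policy with `n` transitions to go, i.e. at stage `H - n`. -/
def policyValueAux [Fintype X] (M : RiskMDP X A H) (N : ℕ) [NeZero N] (π : ℕ → X → A) :
    ℕ → X → ℝ
  | 0 => fun x => M.termCost x
  | n + 1 => fun x =>
      M.cost (H - (n + 1)) x (π (H - (n + 1)) x) +
        M.risk N (H - (n + 1)) x (π (H - (n + 1)) x) (policyValueAux M N π n)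

/-- `V_h^π`, `h ∈ [1:H]`. -/
def policyValue [Fintype X] (M : RiskMDP X A H) (N : ℕ) [NeZero N] (π : ℕ → X → A)
    (h : ℕ) : X → ℝ :=
  M.policyValueAux N π (H - h)

/-- The optimal value with `n` transitions to go, by risk-averse dynamic programming. -/
def optValueAux [Fintype X] (M : RiskMDP X A H) (N : ℕ) [NeZero N] : ℕ → X → ℝ
  | 0 => fun x => M.termCost x
  | n + 1 => fun x =>
      ⨅ a : A, (M.cost (H - (n + 1)) x a + M.risk N (H - (n + 1)) x a (optValueAux M N n))

/-- `V_h^⋆`, `h ∈ [1:H]`. -/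
def optValue [Fintype X] (M : RiskMDP X A H) (N : ℕ) [NeZero N] (h : ℕ) : X → ℝ :=
  M.optValueAux N (H - h)

/-- The multipattern property with respect to the feature map `φ` into the unit simplex. -/
structure IsMultipattern [Fintype X] (M : RiskMDP X A H) (N : ℕ) [NeZero N] {d : ℕ}
    (φ : X → A → Fin d → ℝ) : Prop where
  simplex : ∀ x a, φ x a ∈ stdSimplex ℝ (Fin d)
  cost_linear : ∀ h, 1 ≤ h → h ≤ H → ∃ θ : Fin d → ℝ, ‖WithLp.toLp 2 θ‖ ≤ √(d : ℝ) ∧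
    ∀ x a, M.stageCost h x a = ∑ j, φ x a j * θ j
  risk_patterns : ∀ h, 1 ≤ h → h < H → ∃ ρ : Fin d → (X → ℝ) → ℝ,
    (∀ j, IsCoherent (ρ j)) ∧
    ‖WithLp.toLp 2 (fun j => ρ j (fun _ => 1))‖ ≤ √(d : ℝ) ∧
    ∀ x a (V : X → ℝ), M.risk N h x a V = ∑ j, φ x a j * ρ j V

end RiskMDP

section Algorithm

variable {X A : Type*} {H d : ℕ}

/-- `Λ_h^k = ∑_{τ<k} φ(x^τ,a^τ) φ(x^τ,a^τ)ᵀ + λ I` for the states `xs τ` and actions `as τ` visited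
at a given stage in the episodes `τ = 1, …, k - 1`. -/
def gram (φ : X → A → Fin d → ℝ) (lam : ℝ) (xs : ℕ → X) (as : ℕ → A) (k : ℕ) :
    Matrix (Fin d) (Fin d) ℝ :=
  ∑ τ ∈ Finset.Ico 1 k, Matrix.vecMulVec (φ (xs τ) (as τ)) (φ (xs τ) (as τ)) + lam • 1

/-- The regression weights `w_h = (Λ_h^k)⁻¹ ∑_{τ<k} target_τ φ(x^τ, a^τ)`. -/
def weights (φ : X → A → Fin d → ℝ) (lam : ℝ) (xs : ℕ → X) (as : ℕ → A) (k : ℕ)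
    (target : ℕ → ℝ) : Fin d → ℝ :=
  (gram φ lam xs as k)⁻¹.mulVec (∑ τ ∈ Finset.Ico 1 k, target τ • φ (xs τ) (as τ))

/-- The backward pass of episode `k`: `qHatAux … n` is `Q_{H+1-n}^k`, starting from `Q_{H+1}^k = 0`.
Here `xs h τ`, `as h τ` are the states and actions of stage `h` in episode `τ`, and `est h τ Q` is
the estimate of the transition risk at stage `h` in episode `τ` of the function
`min_a Q(·, a)` of the next state. At the last stage there is no transition and no such term. -/
def qHatAux (M : RiskMDP X A H) (φ : X → A → Fin d → ℝ) (lam β : ℝ)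
    (xs : ℕ → ℕ → X) (as : ℕ → ℕ → A) (est : ℕ → ℕ → (X → A → ℝ) → ℝ) (k : ℕ) :
    ℕ → X → A → ℝ
  | 0 => fun _ _ => 0
  | n + 1 => fun x a =>
      max
        (dotProduct
            (weights φ lam (xs (H - n)) (as (H - n)) k (fun τ =>
              M.stageCost (H - n) (xs (H - n) τ) (as (H - n) τ) +
                if H - n < H then
                  est (H - n) τ (qHatAux M φ lam β xs as est k n)
                else 0))
            (φ x a)
          - β * √(dotProduct (φ x a)
              ((gram φ lam (xs (H - n)) (as (H - n)) k)⁻¹.mulVec (φ x a))))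
        0

/-- `Q_h^k`, `h ∈ [1:H]`. -/
def qHat (M : RiskMDP X A H) (φ : X → A → Fin d → ℝ) (lam β : ℝ)
    (xs : ℕ → ℕ → X) (as : ℕ → ℕ → A) (est : ℕ → ℕ → (X → A → ℝ) → ℝ) (k h : ℕ) :
    X → A → ℝ :=
  qHatAux M φ lam β xs as est k (H + 1 - h)

/-- A realization, on a probability space `(Ω, μ)`, of `K` episodes of feature-based risk-averse
`Q`-learning. `history k h` is the information available in episode `k` when the state `x_h^k` has
been reached; `est h τ` is the estimator of the transition risk at stage `h` of episode `τ`
(constrained by `UsesAggregator` or `UsesUnbiasedEstimator` below). The initial states may be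
chosen in any way that depends on the past, and ties in the minimization are broken in any way. -/
structure QLearningRun {X A : Type*} {H d : ℕ} (M : RiskMDP X A H) (N : ℕ) [NeZero N]
    (φ : X → A → Fin d → ℝ) (K : ℕ) (lam β : ℝ)
    {Ω : Type*} [mΩ : MeasurableSpace Ω] (μ : Measure Ω) where
  history : ℕ → ℕ → MeasurableSpace Ω
  /-- `state h k` is `x_h^k`. -/
  state : ℕ → ℕ → Ω → X
  /-- `policy k ω h` is the decision rule of stage `h` in episode `k`. -/
  policy : ℕ → Ω → ℕ → X → A
  /-- `batch h k` is the batch `Y_h^k`, observed at stage `h - 1`. -/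
  batch : ℕ → ℕ → Ω → Fin N → X
  /-- `pick h k` is the random index of the batch element that becomes `x_h^k`. -/
  pick : ℕ → ℕ → Ω → Fin N
  est : ℕ → ℕ → Ω → (X → A → ℝ) → ℝ
  history_le : ∀ k h, history k h ≤ mΩ
  history_stage : ∀ k h, 1 ≤ k → k ≤ K → 1 ≤ h → h < H → history k h ≤ history k (h + 1)
  history_episode : ∀ k, 1 ≤ k → k < K → history k H ≤ history (k + 1) 1
  state_one_measurable : ∀ k, 1 ≤ k → k ≤ K → Measurable[history k 1, ⊤] (state 1 k)
  policy_measurable : ∀ k h, 1 ≤ k → k ≤ K → 1 ≤ h → h ≤ H → ∀ x,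
    Measurable[history k 1, ⊤] (fun ω => policy k ω h x)
  batch_measurable : ∀ k h, 1 ≤ k → k ≤ K → 1 ≤ h → h < H →
    Measurable[history k (h + 1), ⊤] (batch (h + 1) k)
  pick_measurable : ∀ k h, 1 ≤ k → k ≤ K → 1 ≤ h → h < H →
    Measurable[history k (h + 1), ⊤] (pick (h + 1) k)
  /-- Given the past, the batch consists of `N` independent draws from `P_h(x_h^k, a_h^k)`, and the
  index of the next state is uniform and independent of the batch. -/
  sampling : ∀ k h, 1 ≤ k → k ≤ K → 1 ≤ h → h < H → ∀ (y : Fin N → X) (j : Fin N),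
    μ[Set.indicator {ω | batch (h + 1) k ω = y ∧ pick (h + 1) k ω = j} (fun _ => (1 : ℝ))
        | history k h]
      =ᵐ[μ] fun ω =>
        batchProb (M.kernel h (state h k ω) (policy k ω h (state h k ω))) y * (1 / (N : ℝ))
  state_next : ∀ k h, 1 ≤ k → k ≤ K → 1 ≤ h → h < H → ∀ ω,
    state (h + 1) k ω = batch (h + 1) k ω (pick (h + 1) k ω)
  /-- The policy of episode `k` minimizes `Q_h^k(x, ·)`. -/
  greedy : ∀ k h, 1 ≤ k → k ≤ K → 1 ≤ h → h ≤ H → ∀ ω x a,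
    qHat M φ lam β (fun h τ => state h τ ω) (fun h τ => policy τ ω h (state h τ ω))
        (fun h τ => est h τ ω) k h x (policy k ω h x)
      ≤ qHat M φ lam β (fun h τ => state h τ ω) (fun h τ => policy τ ω h (state h τ ω))
        (fun h τ => est h τ ω) k h x a

namespace QLearningRun

variable {X A : Type*} {H d N : ℕ} [NeZero N] {M : RiskMDP X A H}
  {φ : X → A → Fin d → ℝ} {K : ℕ} {lam β : ℝ} {Ω : Type*} [MeasurableSpace Ω] {μ : Measure Ω}

/-- `a_h^k`. -/
def action (R : QLearningRun M N φ K lam β μ) (h k : ℕ) (ω : Ω) : A :=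
  R.policy k ω h (R.state h k ω)

/-- The basic method: the transition risk is estimated by the risk aggregator
`Ψ_h({min_a Q(Y_{h+1}^{τ,j}, a)}_j) = σ^b_h(x_h^τ, P^{(N)}, min_a Q(·, a))`, with the empirical
measure `P^{(N)}` of the batch `Y_{h+1}^τ`. -/
def UsesAggregator (R : QLearningRun M N φ K lam β μ) : Prop :=
  ∀ h τ, 1 ≤ τ → τ ≤ K → 1 ≤ h → h < H → ∀ ω (Q : X → A → ℝ),
    R.est h τ ω Q =
      M.baseRisk h (R.state h τ ω) (empirical (R.batch (h + 1) τ ω)) (fun y => ⨅ a, Q y a)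

/-- Economical estimators: random functionals that are determined by the end of the transition,
Lipschitz in `Q` with constant `L` for the maximum norm, zero at `Q = 0`, and conditionally
unbiased for the mini-batch transition risk of `min_a Q(·, a)`. -/
structure UsesUnbiasedEstimator [Fintype X] [Fintype A] (R : QLearningRun M N φ K lam β μ)
    (L : ℝ) : Prop where
  measurable : ∀ h τ, 1 ≤ τ → τ ≤ K → 1 ≤ h → h < H → ∀ Q : X → A → ℝ,
    Measurable[R.history τ (h + 1)] (fun ω => R.est h τ ω Q)
  lipschitz : ∀ h τ, 1 ≤ τ → τ ≤ K → 1 ≤ h → h < H → ∀ ω (Q Q' : X → A → ℝ),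
    |R.est h τ ω Q - R.est h τ ω Q'| ≤ L * ‖Q - Q'‖
  zero : ∀ h τ, 1 ≤ τ → τ ≤ K → 1 ≤ h → h < H → ∀ ω, R.est h τ ω 0 = 0
  unbiased : ∀ h τ, 1 ≤ τ → τ ≤ K → 1 ≤ h → h < H → ∀ Q : X → A → ℝ,
    μ[fun ω => R.est h τ ω Q | R.history τ h]
      =ᵐ[μ] fun ω => M.risk N h (R.state h τ ω) (R.action h τ ω) (fun y => ⨅ a, Q y a)

/-- `∑_{k=1}^K [V_1^{π_k}(x_1^k) - V_1^⋆(x_1^k)]`. -/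
def regret [Fintype X] (R : QLearningRun M N φ K lam β μ) (ω : Ω) : ℝ :=
  ∑ k ∈ Finset.Icc 1 K,
    (M.policyValue N (R.policy k ω) 1 (R.state 1 k ω) - M.optValue N 1 (R.state 1 k ω))

end QLearningRun

end Algorithm

end RiskQ

end

/-! The proof is optimism for least-squares value iteration, adapted to a nonlinear transition
operator. The risk is nonlinear in the value function, but the multipattern property makes the
one-step cost-to-go linear in `φ(x,a)` for every fixed next-stage function
(`IsMultipattern.exists_linear`). Ridge regression therefore estimates it with an error equal to a
self-normalized noise norm plus a regularization term, times the bonus.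

For a fixed function the estimation noise is a martingale difference sequence over episodes, and
`measure_selfNormalized_gt_le` controls it. That bound comes from an explicit supermartingale:
`exp(½ Sᵀ Λ⁻¹ S)` divided by the square root of the determinant ratio. The estimate `Q_h^k` depends
on the same data, so the bound must be uniform. All estimates have the form `qForm w G` with `d +
d²` real parameters, and a union bound over a grid of mesh `1/K` suffices. The logarithm of the grid
size contributes order `d² Γ`, whence the width `d H √Γ`.

On the good event, `backward_pass` shows that each estimate lies below its Bellman backup, and
within `(β + b)` times the bonus of it. Optimism gives the chain estimate ≤ optimal value ≤ policy
value. The difference of policy value and estimate is thus nonnegative. Subadditivity of a coherent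
risk bounds the difference of two risks by the risk of the difference, and the risk of a nonnegative
function at a batch is at most the sum of its batch values, which is `N` times its mean at a
uniformly picked element. That element is the actual next state. This yields the recursion
`gapBound`, with one factor `N` per transition.

Replacing conditional means by realized next states costs bounded martingale differences
(`measure_sum_gapNoise_gt_le`), and the bonuses along the trajectory sum to order `√(K d ln(1 +
K/λ))` by the elliptical potential bound. The remaining issue is a circularity: the grid must
contain parameters of size `β²/λ`, so the width depends on `cβ`. The dependence is only through a
logarithm under a square root, and `exists_const_dominating_width` finds a consistent constant. -/

section

open Matrix

/-! ### Positive semidefinite forms and rank-one updates. -/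

section Matrices

variable {n : Type*} [Fintype n]

theorem posSemidef_dotProduct_comm {P : Matrix n n ℝ} (hP : P.PosSemidef) (v w : n → ℝ) :
    v ⬝ᵥ P *ᵥ w = w ⬝ᵥ P *ᵥ v := by
  have h : Pᵀ = P := by simpa using hP.isHermitian.eq
  rw [dotProduct_mulVec, ← mulVec_transpose, h, dotProduct_comm]

theorem posSemidef_form_nonneg {P : Matrix n n ℝ} (hP : P.PosSemidef) (v : n → ℝ) :
    0 ≤ v ⬝ᵥ P *ᵥ v := by
  simpa using hP.dotProduct_mulVec_nonneg v

theorem posSemidef_form_add {P : Matrix n n ℝ} (hP : P.PosSemidef) (v w : n → ℝ) :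
    (v + w) ⬝ᵥ P *ᵥ (v + w) = v ⬝ᵥ P *ᵥ v + 2 * (v ⬝ᵥ P *ᵥ w) + w ⬝ᵥ P *ᵥ w := by
  rw [mulVec_add, dotProduct_add, add_dotProduct, add_dotProduct,
    posSemidef_dotProduct_comm hP w v]
  ring

/-- Cauchy–Schwarz for a positive semidefinite form. -/
theorem posSemidef_dotProduct_sq_le {P : Matrix n n ℝ} (hP : P.PosSemidef) (v w : n → ℝ) :
    (v ⬝ᵥ P *ᵥ w) ^ 2 ≤ (v ⬝ᵥ P *ᵥ v) * (w ⬝ᵥ P *ᵥ w) := by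
  have h : ∀ t : ℝ, 0 ≤ (w ⬝ᵥ P *ᵥ w) * (t * t) + (2 * (v ⬝ᵥ P *ᵥ w)) * t + v ⬝ᵥ P *ᵥ v := by
    intro t
    have h1 := posSemidef_form_nonneg hP (v + t • w)
    rw [posSemidef_form_add hP] at h1
    simp only [mulVec_smul, dotProduct_smul, smul_dotProduct, smul_eq_mul] at h1
    linarith
  have := discrim_le_zero h
  unfold discrim at this
  nlinarith

theorem posSemidef_abs_dotProduct_le {P : Matrix n n ℝ} (hP : P.PosSemidef) (v w : n → ℝ) :
    |v ⬝ᵥ P *ᵥ w| ≤ √(v ⬝ᵥ P *ᵥ v) * √(w ⬝ᵥ P *ᵥ w) := by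
  rw [← Real.sqrt_mul (posSemidef_form_nonneg hP v)]
  exact Real.abs_le_sqrt (posSemidef_dotProduct_sq_le hP v w)

theorem posSemidef_sqrt_form_add_le {P : Matrix n n ℝ} (hP : P.PosSemidef) (v w : n → ℝ) :
    √((v + w) ⬝ᵥ P *ᵥ (v + w)) ≤ √(v ⬝ᵥ P *ᵥ v) + √(w ⬝ᵥ P *ᵥ w) := by
  apply Real.sqrt_le_iff.mpr
  refine ⟨by positivity, ?_⟩
  rw [posSemidef_form_add hP, add_sq, Real.sq_sqrt (posSemidef_form_nonneg hP v),
    Real.sq_sqrt (posSemidef_form_nonneg hP w)]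
  have := (le_abs_self _).trans (posSemidef_abs_dotProduct_le hP v w)
  linarith

variable [DecidableEq n]

theorem posDef_mul_inv {P : Matrix n n ℝ} (hP : P.PosDef) : P * P⁻¹ = 1 :=
  Matrix.mul_nonsing_inv _ ((Matrix.isUnit_iff_isUnit_det _).mp hP.isUnit)

theorem posDef_inv_mul {P : Matrix n n ℝ} (hP : P.PosDef) : P⁻¹ * P = 1 :=
  Matrix.nonsing_inv_mul _ ((Matrix.isUnit_iff_isUnit_det _).mp hP.isUnit)

/-- Sherman–Morrison for a positive definite matrix. -/
theorem posDef_inv_add_vecMulVec {P : Matrix n n ℝ} (hP : P.PosDef) (f : n → ℝ) :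
    (P + vecMulVec f f)⁻¹ =
      P⁻¹ - (1 + f ⬝ᵥ P⁻¹ *ᵥ f)⁻¹ • vecMulVec (P⁻¹ *ᵥ f) (P⁻¹ *ᵥ f) := by
  have hu := posSemidef_form_nonneg hP.inv.posSemidef f
  set u := f ⬝ᵥ P⁻¹ *ᵥ f with hudef
  have hsymm : (P⁻¹)ᵀ = P⁻¹ := by simpa using hP.inv.isHermitian.eq
  apply Matrix.inv_eq_right_inv
  have h1 : vecMulVec f f * P⁻¹ = vecMulVec f (P⁻¹ *ᵥ f) := by
    rw [vecMulVec_mul, ← mulVec_transpose, hsymm]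
  rw [mul_sub, add_mul, posDef_mul_inv hP, h1, Matrix.mul_smul, add_mul, mul_vecMulVec,
    mulVec_mulVec, posDef_mul_inv hP, one_mulVec, vecMulVec_mul_vecMulVec, ← hudef]
  have h2 : (1 + u)⁻¹ • (vecMulVec f (P⁻¹ *ᵥ f) + vecMulVec f (u • P⁻¹ *ᵥ f)) =
      vecMulVec f (P⁻¹ *ᵥ f) := by
    rw [vecMulVec_smul, ← one_smul ℝ (vecMulVec f (P⁻¹ *ᵥ f)), smul_smul, ← add_smul, smul_smul]
    congr 1
    field_simp
  rw [h2, add_sub_cancel_right]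

/-- By Sherman–Morrison, one new observation `η f` changes the self-normalized form only through the
scalars `fᵀ P⁻¹ S` and `fᵀ P⁻¹ f`. This reduces the supermartingale property to a one-variable
inequality. -/
theorem posDef_form_inv_add_vecMulVec {P : Matrix n n ℝ} (hP : P.PosDef) (f S : n → ℝ) (η : ℝ) :
    (S + η • f) ⬝ᵥ (P + vecMulVec f f)⁻¹ *ᵥ (S + η • f) =
      S ⬝ᵥ P⁻¹ *ᵥ S +
        (2 * η * (f ⬝ᵥ P⁻¹ *ᵥ S) + η ^ 2 * (f ⬝ᵥ P⁻¹ *ᵥ f) - (f ⬝ᵥ P⁻¹ *ᵥ S) ^ 2) /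
          (1 + f ⬝ᵥ P⁻¹ *ᵥ f) := by
  have hu := posSemidef_form_nonneg hP.inv.posSemidef f
  have hs := posSemidef_dotProduct_comm hP.inv.posSemidef S f
  rw [posDef_inv_add_vecMulVec hP, sub_mulVec, dotProduct_sub,
    posSemidef_form_add hP.inv.posSemidef, smul_mulVec, vecMulVec_mulVec]
  have h3 : ∀ v : n → ℝ, (P⁻¹ *ᵥ f) ⬝ᵥ v = f ⬝ᵥ P⁻¹ *ᵥ v := by
    intro v
    rw [dotProduct_comm, posSemidef_dotProduct_comm hP.inv.posSemidef]
  simp only [mulVec_smul, dotProduct_smul, smul_dotProduct, smul_eq_mul, h3, mulVec_add,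
    dotProduct_add, add_dotProduct, op_smul_eq_smul, hs]
  field_simp
  ring

theorem posDef_det_add_vecMulVec {P : Matrix n n ℝ} (hP : P.PosDef) (f : n → ℝ) :
    (P + vecMulVec f f).det = P.det * (1 + f ⬝ᵥ P⁻¹ *ᵥ f) := by
  rw [vecMulVec_eq Unit, det_add_replicateCol_mul_replicateRow
    ((Matrix.isUnit_iff_isUnit_det _).mp hP.isUnit)]
  congr 1
  rw [det_unique]
  rw [Matrix.mul_assoc, ← replicateCol_mulVec]
  simp [Matrix.mul_apply, dotProduct]

end Matrices

/-! ### Regularized Gram matrices: form bounds, determinants, elliptical potential. -/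

section Ridge

variable {d : ℕ}

/-- The regularized Gram matrix of `f 1, …, f (k - 1)`. -/
def ridge (lam : ℝ) (f : ℕ → Fin d → ℝ) (k : ℕ) : Matrix (Fin d) (Fin d) ℝ :=
  ∑ τ ∈ Finset.Ico 1 k, vecMulVec (f τ) (f τ) + lam • 1

theorem ridge_posDef {lam : ℝ} (hlam : 0 < lam) (f : ℕ → Fin d → ℝ) (k : ℕ) :
    (ridge lam f k).PosDef := by
  apply PosDef.posSemidef_add
  · apply posSemidef_sum
    intro τ _
    simpa using posSemidef_vecMulVec_self_star (f τ)
  · exact PosDef.one.smul hlam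

theorem ridge_inv_posSemidef {lam : ℝ} (hlam : 0 < lam) (f : ℕ → Fin d → ℝ) (k : ℕ) :
    (ridge lam f k)⁻¹.PosSemidef := (ridge_posDef hlam f k).inv.posSemidef

theorem ridge_one (lam : ℝ) (f : ℕ → Fin d → ℝ) : ridge lam f 1 = lam • 1 := by
  simp [ridge]

theorem ridge_succ (lam : ℝ) (f : ℕ → Fin d → ℝ) {k : ℕ} (hk : 1 ≤ k) :
    ridge lam f (k + 1) = ridge lam f k + vecMulVec (f k) (f k) := by
  unfold ridge
  rw [Finset.sum_Ico_succ_top hk]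
  abel

theorem ridge_mulVec (lam : ℝ) (f : ℕ → Fin d → ℝ) (k : ℕ) (v : Fin d → ℝ) :
    ridge lam f k *ᵥ v = ∑ τ ∈ Finset.Ico 1 k, (f τ ⬝ᵥ v) • f τ + lam • v := by
  unfold ridge
  rw [add_mulVec, Matrix.sum_mulVec, smul_mulVec, one_mulVec]
  simp [vecMulVec_mulVec, op_smul_eq_smul]

theorem ridge_form (lam : ℝ) (f : ℕ → Fin d → ℝ) (k : ℕ) (v : Fin d → ℝ) :
    v ⬝ᵥ ridge lam f k *ᵥ v = ∑ τ ∈ Finset.Ico 1 k, (f τ ⬝ᵥ v) ^ 2 + lam * (v ⬝ᵥ v) := by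
  rw [ridge_mulVec, dotProduct_add, dotProduct_sum, dotProduct_smul, smul_eq_mul]
  congr 1
  apply Finset.sum_congr rfl
  intro τ _
  rw [dotProduct_smul, smul_eq_mul, dotProduct_comm v, sq]

theorem dotProduct_sq_le_mul (v w : Fin d → ℝ) : (v ⬝ᵥ w) ^ 2 ≤ (v ⬝ᵥ v) * (w ⬝ᵥ w) := by
  simpa using posSemidef_dotProduct_sq_le (P := (1 : Matrix (Fin d) (Fin d) ℝ)) PosSemidef.one v w

theorem dotProduct_self_nonneg' (v : Fin d → ℝ) : 0 ≤ v ⬝ᵥ v :=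
  Finset.sum_nonneg fun i _ => mul_self_nonneg (v i)

/-- The form of `Λ` evaluated at `z = Λ⁻¹ v`. The next two bounds drop one of the two nonnegative
terms, apply Cauchy–Schwarz, and cancel a factor of the form itself. -/
theorem ridge_inv_form_eq {lam : ℝ} (hlam : 0 < lam) (f : ℕ → Fin d → ℝ) (k : ℕ)
    (v : Fin d → ℝ) :
    v ⬝ᵥ (ridge lam f k)⁻¹ *ᵥ v =
      ∑ τ ∈ Finset.Ico 1 k, (f τ ⬝ᵥ (ridge lam f k)⁻¹ *ᵥ v) ^ 2 +
        lam * ((ridge lam f k)⁻¹ *ᵥ v ⬝ᵥ (ridge lam f k)⁻¹ *ᵥ v) := by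
  rw [← ridge_form, mulVec_mulVec, posDef_mul_inv (ridge_posDef hlam f k), one_mulVec,
    dotProduct_comm]

theorem ridge_inv_form_le {lam : ℝ} (hlam : 0 < lam) (f : ℕ → Fin d → ℝ) (k : ℕ)
    (v : Fin d → ℝ) : v ⬝ᵥ (ridge lam f k)⁻¹ *ᵥ v ≤ v ⬝ᵥ v / lam := by
  have h1 := ridge_inv_form_eq hlam f k v
  have h2 := dotProduct_sq_le_mul v ((ridge lam f k)⁻¹ *ᵥ v)
  have h3 : 0 ≤ ∑ τ ∈ Finset.Ico 1 k, (f τ ⬝ᵥ (ridge lam f k)⁻¹ *ᵥ v) ^ 2 := by positivity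
  have h4 := posSemidef_form_nonneg (ridge_inv_posSemidef hlam f k) v
  set q := v ⬝ᵥ (ridge lam f k)⁻¹ *ᵥ v
  set z := (ridge lam f k)⁻¹ *ᵥ v ⬝ᵥ (ridge lam f k)⁻¹ *ᵥ v
  have h5 := dotProduct_self_nonneg' v
  rw [le_div_iff₀ hlam]
  rcases h4.eq_or_lt with h | h
  · rw [← h]; simpa using h5
  · have : q * (q * lam) ≤ q * (v ⬝ᵥ v) := by
      calc q * (q * lam) = q ^ 2 * lam := by ring
        _ ≤ (v ⬝ᵥ v * z) * lam := by gcongr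
        _ = v ⬝ᵥ v * (lam * z) := by ring
        _ ≤ v ⬝ᵥ v * q := by gcongr; linarith
        _ = q * (v ⬝ᵥ v) := by ring
    exact le_of_mul_le_mul_left this h

/-- Perturbing the noise by `Δ` moves the self-normalized norm by at most the Euclidean norm of `Δ`,
independently of `d` and `λ`. This pays for the passage from the grid to arbitrary parameters. -/
theorem ridge_inv_form_sum_le {lam : ℝ} (hlam : 0 < lam) (f : ℕ → Fin d → ℝ) (k : ℕ)
    (Δ : ℕ → ℝ) :
    (∑ τ ∈ Finset.Ico 1 k, Δ τ • f τ) ⬝ᵥ (ridge lam f k)⁻¹ *ᵥ (∑ τ ∈ Finset.Ico 1 k, Δ τ • f τ) ≤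
      ∑ τ ∈ Finset.Ico 1 k, Δ τ ^ 2 := by
  set v := ∑ τ ∈ Finset.Ico 1 k, Δ τ • f τ with hv
  have h1 := ridge_inv_form_eq hlam f k v
  have h4 := posSemidef_form_nonneg (ridge_inv_posSemidef hlam f k) v
  have h5 := dotProduct_self_nonneg' ((ridge lam f k)⁻¹ *ᵥ v)
  have h6 : v ⬝ᵥ (ridge lam f k)⁻¹ *ᵥ v =
      ∑ τ ∈ Finset.Ico 1 k, Δ τ * (f τ ⬝ᵥ (ridge lam f k)⁻¹ *ᵥ v) := by
    conv_lhs => rw [hv, sum_dotProduct, ← hv]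
    simp
  have h7 := Finset.sum_mul_sq_le_sq_mul_sq (Finset.Ico 1 k) Δ
    (fun τ => f τ ⬝ᵥ (ridge lam f k)⁻¹ *ᵥ v)
  rw [← h6] at h7
  set q := v ⬝ᵥ (ridge lam f k)⁻¹ *ᵥ v
  set F := ∑ τ ∈ Finset.Ico 1 k, (f τ ⬝ᵥ (ridge lam f k)⁻¹ *ᵥ v) ^ 2
  have h8 : 0 ≤ ∑ τ ∈ Finset.Ico 1 k, Δ τ ^ 2 := by positivity
  have h9 : F ≤ q := by nlinarith
  rcases h4.eq_or_lt with h | h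
  · rw [← h]; exact h8
  · have : q * q ≤ q * ∑ τ ∈ Finset.Ico 1 k, Δ τ ^ 2 := by nlinarith
    exact le_of_mul_le_mul_left this h

/-- Each eigenvalue is the value of the form at a unit eigenvector, and each of the `k - 1` features
contributes at most 1 to it. -/
theorem ridge_det_le {lam : ℝ} (hlam : 0 < lam) (f : ℕ → Fin d → ℝ)
    (hf : ∀ τ, f τ ⬝ᵥ f τ ≤ 1) {k : ℕ} (hk : 1 ≤ k) :
    (ridge lam f k).det ≤ (lam + (k - 1)) ^ d := by
  have hP := ridge_posDef hlam f k
  rw [hP.isHermitian.det_eq_prod_eigenvalues]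
  have hcard : (lam + ((k : ℝ) - 1)) ^ d = ∏ _i : Fin d, (lam + ((k : ℝ) - 1)) := by simp
  rw [hcard]
  apply Finset.prod_le_prod
  · intro i _
    exact (hP.eigenvalues_pos i).le
  intro i _
  have h := hP.isHermitian.eigenvalues_eq i
  have hn : hP.isHermitian.eigenvectorBasis i ⬝ᵥ hP.isHermitian.eigenvectorBasis i = (1 : ℝ) := by
    have := (hP.isHermitian.eigenvectorBasis).orthonormal.1 i
    have h2 := EuclideanSpace.norm_sq_eq (hP.isHermitian.eigenvectorBasis i)
    rw [this] at h2
    simp only [Real.norm_eq_abs, sq_abs] at h2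
    simp only [dotProduct, ← sq]
    linarith
  have h' : hP.isHermitian.eigenvalues i = hP.isHermitian.eigenvectorBasis i ⬝ᵥ
      ridge lam f k *ᵥ hP.isHermitian.eigenvectorBasis i := by
    rw [h]; simp
  simp only [RCLike.ofReal_real_eq_id, id]
  rw [h', ridge_form, hn, mul_one, add_comm]
  gcongr
  have h10 : ((k : ℝ) - 1) = ∑ τ ∈ Finset.Ico 1 k, (1 : ℝ) := by
    simp [Nat.cast_sub hk]
  rw [h10]
  apply Finset.sum_le_sum
  intro τ _
  have := dotProduct_sq_le_mul (f τ) (hP.isHermitian.eigenvectorBasis i)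
  rw [hn, mul_one] at this
  exact this.trans (hf τ)

theorem ridge_det_succ {lam : ℝ} (hlam : 0 < lam) (f : ℕ → Fin d → ℝ) {k : ℕ} (hk : 1 ≤ k) :
    (ridge lam f (k + 1)).det =
      (ridge lam f k).det * (1 + f k ⬝ᵥ (ridge lam f k)⁻¹ *ᵥ f k) := by
  rw [ridge_succ lam f hk, posDef_det_add_vecMulVec (ridge_posDef hlam f k)]

theorem ridge_det_one (lam : ℝ) (f : ℕ → Fin d → ℝ) : (ridge lam f 1).det = lam ^ d := by
  rw [ridge_one, det_smul]; simp

theorem log_ridge_det_ratio_le {lam : ℝ} (hlam : 0 < lam) (f : ℕ → Fin d → ℝ)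
    (hf : ∀ τ, f τ ⬝ᵥ f τ ≤ 1) {k K : ℕ} (hk : 1 ≤ k) (hkK : k ≤ K + 1) :
    Real.log ((ridge lam f k).det / lam ^ d) ≤ d * Real.log (1 + K / lam) := by
  have hdet := (ridge_posDef hlam f k).det_pos
  have h1 : (ridge lam f k).det / lam ^ d ≤ (1 + K / lam) ^ d := by
    rw [div_le_iff₀ (by positivity), ← mul_pow]
    refine (ridge_det_le hlam f hf hk).trans ?_
    have : (1 + (K : ℝ) / lam) * lam = lam + K := by field_simp
    rw [this]
    have hk' : (1 : ℝ) ≤ k := by exact_mod_cast hk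
    have hkK' : (k : ℝ) ≤ K + 1 := by exact_mod_cast hkK
    apply pow_le_pow_left₀ (by linarith)
    linarith
  rw [← Real.log_pow]
  exact Real.log_le_log (by positivity) h1

/-- Telescoping of the matrix determinant lemma. -/
theorem sum_log_one_add_ridge_inv_form {lam : ℝ} (hlam : 0 < lam) (f : ℕ → Fin d → ℝ)
    {k : ℕ} (hk : 1 ≤ k) :
    ∑ τ ∈ Finset.Ico 1 k, Real.log (1 + f τ ⬝ᵥ (ridge lam f τ)⁻¹ *ᵥ f τ) =
      Real.log ((ridge lam f k).det / lam ^ d) := by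
  induction k, hk using Nat.le_induction with
  | base => rw [ridge_det_one]; simp [div_self (pow_pos hlam d).ne']
  | succ k hk ih =>
    have hu := posSemidef_form_nonneg (ridge_inv_posSemidef hlam f k) (f k)
    have hdet := (ridge_posDef hlam f k).det_pos
    rw [Finset.sum_Ico_succ_top hk, ih, ridge_det_succ hlam f hk, ← Real.log_mul (by positivity)
      (by positivity)]
    congr 1
    ring

/-- `x ln 2 ≤ ln (1 + x)` on `[0, 1]`. -/
theorem mul_log_two_le_log_one_add {x : ℝ} (h0 : 0 ≤ x) (h1 : x ≤ 1) :
    x * Real.log 2 ≤ Real.log (1 + x) := by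
  have h := strictConcaveOn_log_Ioi.concaveOn.2 (show (1 : ℝ) ∈ Set.Ioi 0 by simp)
    (show (2 : ℝ) ∈ Set.Ioi 0 by simp) (show (0 : ℝ) ≤ 1 - x by linarith) h0 (by ring)
  simp only [smul_eq_mul, Real.log_one, mul_zero, zero_add] at h
  refine h.trans_eq ?_
  congr 1; ring

/-- The elliptical potential bound. -/
theorem sum_min_one_sqrt_ridge_inv_form_le {lam : ℝ} (hlam : 0 < lam) (f : ℕ → Fin d → ℝ)
    (hf : ∀ τ, f τ ⬝ᵥ f τ ≤ 1) (K : ℕ) :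
    ∑ k ∈ Finset.Icc 1 K, min 1 (√(f k ⬝ᵥ (ridge lam f k)⁻¹ *ᵥ f k)) ≤
      √(K * (d * Real.log (1 + K / lam) / Real.log 2)) := by
  have hIcc : Finset.Icc 1 K = Finset.Ico 1 (K + 1) := by ext; simp
  rw [hIcc]
  apply Real.le_sqrt_of_sq_le
  refine (sq_sum_le_card_mul_sum_sq).trans ?_
  simp only [Nat.card_Ico, Nat.add_sub_cancel]
  gcongr
  rw [le_div_iff₀ (Real.log_pos one_lt_two), Finset.sum_mul]
  refine le_trans ?_ (log_ridge_det_ratio_le hlam f hf (by omega : 1 ≤ K + 1) le_rfl)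
  rw [← sum_log_one_add_ridge_inv_form hlam f (by omega)]
  apply Finset.sum_le_sum
  intro τ _
  have hu := posSemidef_form_nonneg (ridge_inv_posSemidef hlam f τ) (f τ)
  set u := f τ ⬝ᵥ (ridge lam f τ)⁻¹ *ᵥ f τ
  -- The truncation at 1 puts the squared bonus in the range where `x ln 2 ≤ ln(1 + x)`. Without it
  -- a lower bound on `lam` would be needed.
  have h1 : (min 1 (√u)) ^ 2 ≤ 1 := by
    rw [sq_le_one_iff₀ (by positivity)]; exact min_le_left _ _
  have h2 : (min 1 (√u)) ^ 2 ≤ u := by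
    calc (min 1 (√u)) ^ 2 ≤ (√u) ^ 2 := by gcongr; exact min_le_right _ _
      _ = u := Real.sq_sqrt hu
  refine (mul_log_two_le_log_one_add (by positivity) h1).trans ?_
  exact Real.log_le_log (by positivity) (by linarith)

end Ridge

end

section

open Matrix MeasureTheory

/-! ### Measurability of determinants, inverses and forms. -/

section Measurability

variable {Ω n : Type*} {m : MeasurableSpace Ω} [Fintype n]

theorem measurable_matrix_det [DecidableEq n] {A : Ω → Matrix n n ℝ}
    (hA : ∀ i j, Measurable fun ω => A ω i j) : Measurable fun ω => (A ω).det := by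
  simp only [det_apply]
  refine Finset.measurable_sum _ fun σ _ => ?_
  refine Measurable.const_smul ?_ _
  exact Finset.measurable_prod _ fun i _ => hA _ _

theorem measurable_matrix_inv [DecidableEq n] {A : Ω → Matrix n n ℝ}
    (hA : ∀ i j, Measurable fun ω => A ω i j) (i j : n) :
    Measurable fun ω => (A ω)⁻¹ i j := by
  simp only [inv_def, Matrix.smul_apply, smul_eq_mul, Ring.inverse_eq_inv', adjugate_apply]
  refine (measurable_matrix_det hA).inv.mul (measurable_matrix_det fun a b => ?_)
  by_cases h : a = j
  · subst h; simp
  · simpa [updateRow_ne h] using hA a b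

theorem measurable_dotProduct {v w : Ω → n → ℝ} (hv : ∀ i, Measurable fun ω => v ω i)
    (hw : ∀ i, Measurable fun ω => w ω i) : Measurable fun ω => v ω ⬝ᵥ w ω := by
  simp only [dotProduct]
  exact Finset.measurable_sum _ fun i _ => (hv i).mul (hw i)

theorem measurable_mulVec {A : Ω → Matrix n n ℝ} {v : Ω → n → ℝ}
    (hA : ∀ i j, Measurable fun ω => A ω i j) (hv : ∀ i, Measurable fun ω => v ω i) (i : n) :
    Measurable fun ω => (A ω *ᵥ v ω) i :=
  measurable_dotProduct (hA i) hv

theorem measurable_ridge {d : ℕ} (lam : ℝ) {f : ℕ → Ω → Fin d → ℝ} {k : ℕ}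
    (hf : ∀ τ, 1 ≤ τ → τ < k → ∀ i, Measurable fun ω => f τ ω i) (i j : Fin d) :
    Measurable fun ω => ridge lam (fun τ => f τ ω) k i j := by
  simp only [ridge, Matrix.add_apply, Matrix.sum_apply, vecMulVec_apply]
  refine Measurable.add_const (Finset.measurable_sum _ fun τ hτ => ?_) _
  rw [Finset.mem_Ico] at hτ
  exact (hf τ hτ.1 hτ.2 i).mul (hf τ hτ.1 hτ.2 j)

theorem measurable_ridge_inv_form {d : ℕ} (lam : ℝ) {f : ℕ → Ω → Fin d → ℝ} {k : ℕ}
    {v w : Ω → Fin d → ℝ} (hf : ∀ τ, 1 ≤ τ → τ < k → ∀ i, Measurable fun ω => f τ ω i)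
    (hv : ∀ i, Measurable fun ω => v ω i) (hw : ∀ i, Measurable fun ω => w ω i) :
    Measurable fun ω => v ω ⬝ᵥ (ridge lam (fun τ => f τ ω) k)⁻¹ *ᵥ w ω :=
  measurable_dotProduct hv
    (measurable_mulVec (measurable_matrix_inv (measurable_ridge lam hf)) hw)

end Measurability

/-! ### The self-normalized supermartingale. -/

section SelfNormalized

/-- Half the increment of `Sᵀ Λ⁻¹ S` when an observation with noise `η` is added, where
`s = φᵀ Λ⁻¹ S` and `u = φᵀ Λ⁻¹ φ`. -/
noncomputable def normIncr (s u η : ℝ) : ℝ := (2 * η * s + η ^ 2 * u - s ^ 2) / (2 * (1 + u))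

/-- Completing the square, `2ηs - s² ≤ η²`. The bound keeps the exponential process bounded at each
time, which settles all integrability questions. -/
theorem normIncr_le_half {s u η : ℝ} (hu : 0 ≤ u) (hη : |η| ≤ 1) : normIncr s u η ≤ 1 / 2 := by
  unfold normIncr
  rw [div_le_div_iff₀ (by positivity) two_pos]
  have := (sq_le_one_iff_abs_le_one η).mpr hη
  nlinarith [sq_nonneg (s - η), mul_le_mul_of_nonneg_right this hu]

/-- The increment is a convex quadratic in `η` because `u ≥ 0`, so its exponential lies below the
chord through `η = ±1`. The part of the chord linear in `η` has zero conditional mean. -/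
theorem exp_normIncr_le_chord {s u η : ℝ} (hu : 0 ≤ u) (hη : |η| ≤ 1) :
    Real.exp (normIncr s u η) ≤ (Real.exp (normIncr s u 1) + Real.exp (normIncr s u (-1))) / 2 +
      η * ((Real.exp (normIncr s u 1) - Real.exp (normIncr s u (-1))) / 2) := by
  have habs := abs_le.mp hη
  have h1 : normIncr s u η ≤ (1 + η) / 2 * normIncr s u 1 + (1 - η) / 2 * normIncr s u (-1) := by
    have : (1 + η) / 2 * normIncr s u 1 + (1 - η) / 2 * normIncr s u (-1) - normIncr s u η =
        (1 - η ^ 2) * u / (2 * (1 + u)) := by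
      unfold normIncr; field_simp; ring
    have h2 : 0 ≤ (1 - η ^ 2) * u / (2 * (1 + u)) := by
      have := (sq_le_one_iff_abs_le_one η).mpr hη
      have h3 : 0 ≤ 1 - η ^ 2 := by linarith
      positivity
    linarith
  have h2 := convexOn_exp.2 (Set.mem_univ (normIncr s u 1)) (Set.mem_univ (normIncr s u (-1)))
    (show 0 ≤ (1 + η) / 2 by linarith) (show 0 ≤ (1 - η) / 2 by linarith) (by ring)
  simp only [smul_eq_mul] at h2
  have h3 := Real.exp_le_exp.mpr h1
  linarith

/-- The constant part of the chord is at most `√(1 + u)`, exactly the growth of the square root of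
the determinant. The proof uses `cosh x ≤ exp(x²/2)` and then `1 - 1/(1+u) ≤ ln(1+u)`; the leftover
term in `s²` has a favourable sign. -/
theorem exp_normIncr_average_le {s u : ℝ} (hu : 0 ≤ u) :
    (Real.exp (normIncr s u 1) + Real.exp (normIncr s u (-1))) / 2 ≤
      Real.exp (Real.log (1 + u) / 2) := by
  have h1 : (Real.exp (normIncr s u 1) + Real.exp (normIncr s u (-1))) / 2 =
      Real.exp ((u - s ^ 2) / (2 * (1 + u))) * Real.cosh (s / (1 + u)) := by
    have e1 : normIncr s u 1 = (u - s ^ 2) / (2 * (1 + u)) + s / (1 + u) := by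
      unfold normIncr; field_simp; ring
    have e2 : normIncr s u (-1) = (u - s ^ 2) / (2 * (1 + u)) + -(s / (1 + u)) := by
      unfold normIncr; field_simp; ring
    rw [e1, e2, Real.exp_add, Real.exp_add, Real.cosh_eq]
    ring
  rw [h1]
  calc _ ≤ Real.exp ((u - s ^ 2) / (2 * (1 + u))) * Real.exp ((s / (1 + u)) ^ 2 / 2) := by
        gcongr; exact Real.cosh_le_exp_half_sq _
    _ = Real.exp ((u - s ^ 2) / (2 * (1 + u)) + (s / (1 + u)) ^ 2 / 2) := by rw [Real.exp_add]
    _ ≤ _ := by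
        rw [Real.exp_le_exp]
        have h2 := Real.one_sub_inv_le_log_of_pos (show 0 < 1 + u by linarith)
        have h3 : (u - s ^ 2) / (2 * (1 + u)) + (s / (1 + u)) ^ 2 / 2 =
            (1 - (1 + u)⁻¹) / 2 - s ^ 2 * u / (2 * (1 + u) ^ 2) := by
          field_simp; ring
        have h4 : 0 ≤ s ^ 2 * u / (2 * (1 + u) ^ 2) := by positivity
        linarith

variable {Ω : Type*} {mΩ : MeasurableSpace Ω} {μ : Measure Ω} [IsProbabilityMeasure μ] {d : ℕ}

theorem integral_mul_eq_zero_of_condExp {m : MeasurableSpace Ω} (hm : m ≤ mΩ) {c η : Ω → ℝ}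
    (hc : Measurable[m] c) {C : ℝ} (hcb : ∀ ω, |c ω| ≤ C) (hη : Measurable[mΩ] η)
    (hηb : ∀ ω, |η ω| ≤ 1) (hz : μ[η | m] =ᵐ[μ] 0) : ∫ ω, c ω * η ω ∂μ = 0 := by
  have hηi : Integrable η μ :=
    Integrable.of_bound hη.aestronglyMeasurable 1 (Filter.Eventually.of_forall hηb)
  have hci : Integrable (c * η) μ := by
    refine Integrable.of_bound ((hc.mono hm le_rfl).mul hη).aestronglyMeasurable C
      (Filter.Eventually.of_forall fun ω => ?_)
    simp only [Pi.mul_apply, norm_mul, Real.norm_eq_abs]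
    nlinarith [hcb ω, hηb ω, abs_nonneg (c ω), abs_nonneg (η ω)]
  have h := condExp_mul_of_stronglyMeasurable_left hc.stronglyMeasurable hci hηi
  have h2 : μ[c * η | m] =ᵐ[μ] 0 := by
    filter_upwards [h, hz] with ω h1 h2
    rw [h1]; simp [h2]
  have h3 := integral_condExp (μ := μ) (f := c * η) hm
  rw [integral_congr_ae h2] at h3
  simpa using h3.symm

/-- The logarithm of the self-normalized supermartingale. -/
noncomputable def selfNormLog (lam : ℝ) (f : ℕ → Ω → Fin d → ℝ) (η : ℕ → Ω → ℝ) (k : ℕ) (ω : Ω) : ℝ :=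
  (∑ τ ∈ Finset.Ico 1 k, η τ ω • f τ ω) ⬝ᵥ
      (ridge lam (fun τ => f τ ω) k)⁻¹ *ᵥ (∑ τ ∈ Finset.Ico 1 k, η τ ω • f τ ω) / 2 -
    Real.log ((ridge lam (fun τ => f τ ω) k).det / lam ^ d) / 2

theorem selfNormLog_succ {lam : ℝ} (hlam : 0 < lam) (f : ℕ → Ω → Fin d → ℝ) (η : ℕ → Ω → ℝ)
    {k : ℕ} (hk : 1 ≤ k) (ω : Ω) :
    selfNormLog lam f η (k + 1) ω = selfNormLog lam f η k ω +
      normIncr (f k ω ⬝ᵥ (ridge lam (fun τ => f τ ω) k)⁻¹ *ᵥ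
        (∑ τ ∈ Finset.Ico 1 k, η τ ω • f τ ω))
        (f k ω ⬝ᵥ (ridge lam (fun τ => f τ ω) k)⁻¹ *ᵥ f k ω) (η k ω) -
      Real.log (1 + f k ω ⬝ᵥ (ridge lam (fun τ => f τ ω) k)⁻¹ *ᵥ f k ω) / 2 := by
  have hP := ridge_posDef hlam (fun τ => f τ ω) k
  have hu := posSemidef_form_nonneg hP.inv.posSemidef (f k ω)
  have hdet := hP.det_pos
  unfold selfNormLog normIncr
  rw [Finset.sum_Ico_succ_top hk, ridge_det_succ hlam _ hk, ridge_succ _ _ hk,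
    posDef_form_inv_add_vecMulVec hP, mul_div_right_comm, Real.log_mul (by positivity)
      (by positivity)]
  field_simp
  ring

/-- Self-normalized deviation bound for martingale differences with values in `[-1, 1]`. -/
theorem measure_selfNormalized_gt_le (m : ℕ → MeasurableSpace Ω) {n : ℕ} (hn : 1 ≤ n)
    (hm : ∀ τ, m τ ≤ mΩ) (hmono : ∀ τ, 1 ≤ τ → τ < n → m τ ≤ m (τ + 1))
    (f : ℕ → Ω → Fin d → ℝ) (η : ℕ → Ω → ℝ)
    (hf : ∀ τ, 1 ≤ τ → τ < n → ∀ i, Measurable[m τ] fun ω => f τ ω i)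
    (hη : ∀ τ, 1 ≤ τ → τ < n → Measurable[m (τ + 1)] (η τ))
    (hb : ∀ τ, 1 ≤ τ → τ < n → ∀ ω, |η τ ω| ≤ 1)
    (hz : ∀ τ, 1 ≤ τ → τ < n → μ[η τ | m τ] =ᵐ[μ] 0)
    {lam δ : ℝ} (hlam : 0 < lam) (hδ : 0 < δ) :
    μ {ω | Real.log ((ridge lam (fun τ => f τ ω) n).det / lam ^ d) + 2 * Real.log (1 / δ) <
        (∑ τ ∈ Finset.Ico 1 n, η τ ω • f τ ω) ⬝ᵥ
          (ridge lam (fun τ => f τ ω) n)⁻¹ *ᵥ (∑ τ ∈ Finset.Ico 1 n, η τ ω • f τ ω)} ≤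
      ENNReal.ofReal δ := by
  have hchain : ∀ τ k, 1 ≤ τ → τ ≤ k → k ≤ n → m τ ≤ m k := by
    intro τ k h1 h2
    induction k, h2 using Nat.le_induction with
    | base => intro _; exact le_rfl
    | succ k hk ih => intro h; exact (ih (by omega)).trans (hmono k (by omega) (by omega))
  have hfm : ∀ k, k ≤ n → ∀ τ, 1 ≤ τ → τ < k → ∀ i, Measurable[m k] fun ω => f τ ω i :=
    fun k hk τ h1 h2 i => (hf τ h1 (by omega) i).mono (hchain τ k h1 h2.le hk) le_rfl
  have hSm : ∀ k, k ≤ n → ∀ i,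
      Measurable[m k] fun ω => (∑ τ ∈ Finset.Ico 1 k, η τ ω • f τ ω) i := by
    intro k hk i
    simp only [Finset.sum_apply, Pi.smul_apply, smul_eq_mul]
    refine Finset.measurable_sum _ fun τ hτ => ?_
    rw [Finset.mem_Ico] at hτ
    exact ((hη τ hτ.1 (by omega)).mono (hchain (τ + 1) k (by omega) (by omega) hk) le_rfl).mul
      (hfm k hk τ hτ.1 hτ.2 i)
  have hMm : ∀ k, k ≤ n → Measurable[m k] fun ω => Real.exp (selfNormLog lam f η k ω) := by
    intro k hk
    refine Real.measurable_exp.comp ?_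
    refine Measurable.sub (Measurable.div_const ?_ _) (Measurable.div_const ?_ _)
    · exact measurable_ridge_inv_form lam (hfm k hk) (hSm k hk) (hSm k hk)
    · exact Real.measurable_log.comp
        ((measurable_matrix_det (measurable_ridge lam (hfm k hk))).div_const _)
  -- The pointwise bound is carried along with the bound on the mean so that every integral in the
  -- induction is of a bounded function.
  have key : ∀ k, 1 ≤ k → k ≤ n → (∀ ω, Real.exp (selfNormLog lam f η k ω) ≤ Real.exp k) ∧
      ∫ ω, Real.exp (selfNormLog lam f η k ω) ∂μ ≤ 1 := by
    intro k hk
    induction k, hk using Nat.le_induction with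
    | base =>
      intro _
      have h0 : ∀ ω, selfNormLog lam f η 1 ω = 0 := by
        intro ω
        simp [selfNormLog, ridge_det_one, div_self (pow_pos hlam d).ne']
      simp [h0]
    | succ k hk ih =>
      intro hkn
      obtain ⟨ihb, ihi⟩ := ih (by omega)
      set s : Ω → ℝ := fun ω => f k ω ⬝ᵥ (ridge lam (fun τ => f τ ω) k)⁻¹ *ᵥ
        (∑ τ ∈ Finset.Ico 1 k, η τ ω • f τ ω) with hs
      set u : Ω → ℝ := fun ω => f k ω ⬝ᵥ (ridge lam (fun τ => f τ ω) k)⁻¹ *ᵥ f k ω with hudef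
      have hu : ∀ ω, 0 ≤ u ω := fun ω =>
        posSemidef_form_nonneg (ridge_inv_posSemidef hlam _ k) (f k ω)
      have hsucc : ∀ ω, Real.exp (selfNormLog lam f η (k + 1) ω) =
          Real.exp (selfNormLog lam f η k ω) * Real.exp (normIncr (s ω) (u ω) (η k ω)) *
            Real.exp (-(Real.log (1 + u ω) / 2)) := by
        intro ω
        rw [selfNormLog_succ hlam f η hk, sub_eq_add_neg, Real.exp_add, Real.exp_add]
      have hbk := hb k hk (by omega)
      have hlog : ∀ ω, Real.exp (-(Real.log (1 + u ω) / 2)) ≤ 1 := by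
        intro ω
        rw [Real.exp_le_one_iff]
        have := Real.log_nonneg (show 1 ≤ 1 + u ω by linarith [hu ω])
        linarith
      have hbound : ∀ ω, Real.exp (selfNormLog lam f η (k + 1) ω) ≤ Real.exp ((k + 1 : ℕ) : ℝ) := by
        intro ω
        have h1 : Real.exp (normIncr (s ω) (u ω) (η k ω)) ≤ Real.exp 1 :=
          Real.exp_le_exp.mpr ((normIncr_le_half (hu ω) (hbk ω)).trans (by norm_num))
        rw [hsucc]
        push_cast
        rw [Real.exp_add]
        calc _ ≤ Real.exp k * Real.exp 1 * 1 := by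
              gcongr
              · exact Real.exp_le_exp.mp (ihb ω)
              · exact hlog ω
          _ = _ := mul_one _
      refine ⟨hbound, ?_⟩
      -- The coefficient of `η k` in the chord bound: bounded and known before `η k`, so `c * η k`
      -- integrates to zero.
      set c : Ω → ℝ := fun ω => Real.exp (selfNormLog lam f η k ω) *
        ((Real.exp (normIncr (s ω) (u ω) 1) - Real.exp (normIncr (s ω) (u ω) (-1))) / 2) *
            Real.exp (-(Real.log (1 + u ω) / 2)) with hcdef
      have hum : Measurable[m k] u :=
        measurable_ridge_inv_form lam (hfm k (by omega)) (hf k hk (by omega)) (hf k hk (by omega))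
      have hsm : Measurable[m k] s :=
        measurable_ridge_inv_form lam (hfm k (by omega)) (hf k hk (by omega)) (hSm k (by omega))
      have hnm : ∀ t : ℝ, Measurable[m k] fun ω => Real.exp (normIncr (s ω) (u ω) t) := by
        intro t
        refine Real.measurable_exp.comp ?_
        unfold normIncr
        exact (((hsm.const_mul _).add (hum.const_mul _)).sub (hsm.pow_const 2)).div
          ((hum.const_add 1).const_mul 2)
      have hcm : Measurable[m k] c := by
        refine ((hMm k (by omega)).mul (((hnm 1).sub (hnm (-1))).div_const 2)).mul ?_
        exact Real.measurable_exp.comp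
          ((Real.measurable_log.comp (hum.const_add 1)).div_const 2).neg
      have hcb : ∀ ω, |c ω| ≤ Real.exp k * Real.exp 1 := by
        intro ω
        have e1 : Real.exp (normIncr (s ω) (u ω) 1) ≤ Real.exp 1 :=
          Real.exp_le_exp.mpr ((normIncr_le_half (hu ω) (by simp)).trans (by norm_num))
        have e2 : Real.exp (normIncr (s ω) (u ω) (-1)) ≤ Real.exp 1 :=
          Real.exp_le_exp.mpr ((normIncr_le_half (hu ω) (by simp)).trans (by norm_num))
        have p1 := Real.exp_pos (normIncr (s ω) (u ω) 1)
        have p2 := Real.exp_pos (normIncr (s ω) (u ω) (-1))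
        have e3 : |(Real.exp (normIncr (s ω) (u ω) 1) - Real.exp (normIncr (s ω) (u ω) (-1))) / 2|
            ≤ Real.exp 1 := by
          rw [abs_le]; constructor <;> linarith
        rw [hcdef]
        simp only [abs_mul, Real.abs_exp]
        calc _ ≤ Real.exp k * Real.exp 1 * 1 := by
              gcongr
              · exact Real.exp_le_exp.mp (ihb ω)
              · exact hlog ω
          _ = _ := mul_one _
      have hηk : Measurable (η k) := (hη k hk (by omega)).mono (hm _) le_rfl
      have hzero := integral_mul_eq_zero_of_condExp (hm k) hcm hcb hηk hbk (hz k hk (by omega))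
      have hMi : Integrable (fun ω => Real.exp (selfNormLog lam f η k ω)) μ :=
        Integrable.of_bound ((hMm k (by omega)).mono (hm k) le_rfl).aestronglyMeasurable
          (Real.exp k) (Filter.Eventually.of_forall fun ω => by simpa using ihb ω)
      have hMi' : Integrable (fun ω => Real.exp (selfNormLog lam f η (k + 1) ω)) μ :=
        Integrable.of_bound ((hMm (k + 1) hkn).mono (hm _) le_rfl).aestronglyMeasurable
          (Real.exp (k + 1 : ℕ)) (Filter.Eventually.of_forall fun ω => by simpa using hbound ω)
      have hci : Integrable (fun ω => c ω * η k ω) μ := by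
        refine Integrable.of_bound ((hcm.mono (hm k) le_rfl).mul hηk).aestronglyMeasurable
          (Real.exp k * Real.exp 1) (Filter.Eventually.of_forall fun ω => ?_)
        rw [norm_mul, Real.norm_eq_abs, Real.norm_eq_abs]
        nlinarith [hcb ω, hbk ω, abs_nonneg (c ω), abs_nonneg (η k ω)]
      calc ∫ ω, Real.exp (selfNormLog lam f η (k + 1) ω) ∂μ
          ≤ ∫ ω, (Real.exp (selfNormLog lam f η k ω) + c ω * η k ω) ∂μ := by
            refine integral_mono hMi' (hMi.add hci) fun ω => ?_
            simp only
            rw [hsucc]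
            have h1 := exp_normIncr_le_chord (s := s ω) (hu ω) (hbk ω)
            have h2 := exp_normIncr_average_le (s := s ω) (hu ω)
            have h3 : Real.exp (Real.log (1 + u ω) / 2) * Real.exp (-(Real.log (1 + u ω) / 2)) = 1 := by
              rw [← Real.exp_add, add_neg_cancel, Real.exp_zero]
            calc _ ≤ Real.exp (selfNormLog lam f η k ω) * (Real.exp (Real.log (1 + u ω) / 2) +
                    η k ω * ((Real.exp (normIncr (s ω) (u ω) 1) -
                      Real.exp (normIncr (s ω) (u ω) (-1))) / 2)) *
                    Real.exp (-(Real.log (1 + u ω) / 2)) := by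
                  gcongr; linarith
              _ = Real.exp (selfNormLog lam f η k ω) * (Real.exp (Real.log (1 + u ω) / 2) *
                    Real.exp (-(Real.log (1 + u ω) / 2))) + c ω * η k ω := by
                  rw [hcdef]; ring
              _ = _ := by rw [h3, mul_one]
        _ = ∫ ω, Real.exp (selfNormLog lam f η k ω) ∂μ := by
            rw [integral_add hMi hci, hzero, add_zero]
        _ ≤ 1 := ihi
  obtain ⟨hbn, hin⟩ := key n hn le_rfl
  have hMi : Integrable (fun ω => Real.exp (selfNormLog lam f η n ω)) μ :=
    Integrable.of_bound ((hMm n le_rfl).mono (hm n) le_rfl).aestronglyMeasurable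
      (Real.exp n) (Filter.Eventually.of_forall fun ω => by simpa using hbn ω)
  -- Markov's inequality at level `1 / δ`. No maximal inequality is needed, since episodes are later
  -- handled by a union bound.
  have hmarkov := mul_meas_ge_le_integral_of_nonneg
    (Filter.Eventually.of_forall fun ω => (Real.exp_pos (selfNormLog lam f η n ω)).le) hMi (1 / δ)
  have hreal : μ.real {ω | 1 / δ ≤ Real.exp (selfNormLog lam f η n ω)} ≤ δ := by
    have := hmarkov.trans hin
    rw [one_div, inv_mul_le_iff₀ hδ, mul_one] at this
    simpa using this
  refine le_trans (measure_mono fun ω hω => ?_) (ENNReal.le_ofReal_iff_toReal_le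
    (measure_ne_top μ _) hδ.le |>.mpr hreal)
  simp only [Set.mem_ofPred_eq] at hω ⊢
  rw [← Real.log_le_iff_le_exp (by positivity)]
  unfold selfNormLog
  linarith

end SelfNormalized

end

section

namespace RiskQ

open MeasureTheory

/-! ### Coherent risk measures and mini-batch risk. -/

section Coherent

variable {X : Type*} {ρ : (X → ℝ) → ℝ}

theorem IsCoherent.const (h : IsCoherent ρ) (b : ℝ) : ρ (fun _ => b) = b := by
  have h0 : ρ (fun _ => 0) = 0 := by
    simpa using h.pos_homogeneous (fun _ => 0) 0 le_rfl
  simpa [h0] using h.translation (fun _ => 0) b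

theorem IsCoherent.mem_Icc (h : IsCoherent ρ) {V : X → ℝ} {a b : ℝ}
    (hV : ∀ x, V x ∈ Set.Icc a b) : ρ V ∈ Set.Icc a b := by
  constructor
  · rw [← h.const a]; exact h.monotone _ _ fun x => (hV x).1
  · rw [← h.const b]; exact h.monotone _ _ fun x => (hV x).2

theorem IsCoherent.add_le (h : IsCoherent ρ) (V W : X → ℝ) :
    ρ (fun x => V x + W x) ≤ ρ V + ρ W := by
  have h1 := h.convex (fun x => 2 * V x) (fun x => 2 * W x) (1 / 2) (by norm_num) (by norm_num)
  rw [h.pos_homogeneous V 2 (by norm_num), h.pos_homogeneous W 2 (by norm_num)] at h1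
  have h2 : (fun x => 1 / 2 * (2 * V x) + (1 - 1 / 2) * (2 * W x)) = fun x => V x + W x := by
    funext x; ring
  rw [h2] at h1
  linarith

theorem IsCoherent.sub_le (h : IsCoherent ρ) (V W : X → ℝ) :
    ρ V - ρ W ≤ ρ (fun x => V x - W x) := by
  have := h.add_le (fun x => V x - W x) W
  simp only [sub_add_cancel] at this
  linarith

theorem IsCoherent.abs_sub_le (h : IsCoherent ρ) {V W : X → ℝ} {ε : ℝ}
    (hVW : ∀ x, |V x - W x| ≤ ε) : |ρ V - ρ W| ≤ ε := by
  have h1 : ρ V ≤ ρ W + ε := by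
    rw [← h.translation]
    exact h.monotone _ _ fun x => by linarith [(abs_le.mp (hVW x)).2]
  have h2 : ρ W ≤ ρ V + ε := by
    rw [← h.translation]
    exact h.monotone _ _ fun x => by linarith [(abs_le.mp (hVW x)).1]
  rw [abs_le]; constructor <;> linarith

end Coherent

section MiniBatch

variable {X : Type*} {N : ℕ}

theorem batchProb_nonneg (P : PMF X) (y : Fin N → X) : 0 ≤ batchProb P y :=
  Finset.prod_nonneg fun _ _ => ENNReal.toReal_nonneg

theorem sum_batchProb [Fintype X] (P : PMF X) : ∑ y : Fin N → X, batchProb P y = 1 := by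
  classical
  have h1 : ∑ x, (P x).toReal = 1 := by
    rw [← ENNReal.toReal_sum fun x _ => P.apply_ne_top x, ← tsum_fintype (L := .unconditional X),
      P.tsum_coe, ENNReal.toReal_one]
  have h2 := Finset.prod_univ_sum (fun _ : Fin N => (Finset.univ : Finset X))
    (fun _ x => (P x).toReal)
  simp only [h1, Finset.prod_const_one, Fintype.piFinset_univ] at h2
  exact h2.symm

/-- The expectation of `W` at a uniformly chosen element of a batch drawn from `P`. -/
noncomputable def pickMean [Fintype X] (N : ℕ) (P : PMF X) (W : X → ℝ) : ℝ :=
  ∑ y : Fin N → X, ∑ j, batchProb P y * (1 / (N : ℝ)) * W (y j)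

theorem pickMean_mono [Fintype X] (P : PMF X) {V W : X → ℝ} (h : ∀ x, V x ≤ W x) :
    pickMean N P V ≤ pickMean N P W :=
  Finset.sum_le_sum fun y _ => Finset.sum_le_sum fun j _ =>
    mul_le_mul_of_nonneg_left (h _) (mul_nonneg (batchProb_nonneg P y) (by positivity))

variable [NeZero N]

theorem IsTransitionRiskMapping.miniBatch_coherent [Fintype X] {σb : X → PMF X → (X → ℝ) → ℝ}
    (h : IsTransitionRiskMapping σb) (x : X) (P : PMF X) : IsCoherent (miniBatch N σb x P) where
  convex V W t h0 h1 := by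
    simp only [miniBatch, Finset.mul_sum, ← Finset.sum_add_distrib]
    refine Finset.sum_le_sum fun y _ => ?_
    have := mul_le_mul_of_nonneg_left ((h.coherent x (empirical y)).convex V W t h0 h1)
      (batchProb_nonneg P y)
    linarith
  monotone V W hVW := Finset.sum_le_sum fun y _ =>
    mul_le_mul_of_nonneg_left ((h.coherent x (empirical y)).monotone V W hVW) (batchProb_nonneg P y)
  translation V b := by
    simp only [miniBatch, (h.coherent x _).translation, mul_add, Finset.sum_add_distrib,
      ← Finset.sum_mul, sum_batchProb, one_mul]
  pos_homogeneous V t ht := by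
    simp only [miniBatch, (h.coherent x _).pos_homogeneous V t ht, Finset.mul_sum]
    exact Finset.sum_congr rfl fun y _ => by ring

theorem mem_support_empirical {y : Fin N → X} {z : X} (hz : z ∈ (empirical y).support) :
    ∃ j, y j = z := by
  unfold empirical at hz
  rw [PMF.mem_support_map_iff] at hz
  obtain ⟨j, -, hj⟩ := hz
  exact ⟨j, hj⟩

/-- The risk of a nonnegative function at a batch is at most the sum of its batch values. -/
theorem IsTransitionRiskMapping.empirical_le_sum {σb : X → PMF X → (X → ℝ) → ℝ}
    (h : IsTransitionRiskMapping σb) (x : X) (y : Fin N → X) {D : X → ℝ} (hD : ∀ z, 0 ≤ D z) :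
    σb x (empirical y) D ≤ ∑ j, D (y j) := by
  classical
  have hc := h.coherent x (empirical y)
  -- Only batch values matter, so `D` may be set to zero off the batch; it is then dominated
  -- everywhere by the constant `∑ j, D (y j)`.
  rw [h.congr_support x (empirical y) D (fun z => if ∃ j, y j = z then D z else 0)
    fun z hz => by rw [if_pos (mem_support_empirical hz)]]
  rw [← hc.const (∑ j, D (y j))]
  refine hc.monotone _ _ fun z => ?_
  split_ifs with hz
  · obtain ⟨j, rfl⟩ := hz
    exact Finset.single_le_sum (f := fun j => D (y j)) (fun j _ => hD _) (Finset.mem_univ j)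
  · exact Finset.sum_nonneg fun j _ => hD _

theorem pickMean_const [Fintype X] (P : PMF X) (b : ℝ) : pickMean N P (fun _ => b) = b := by
  have hN : (N : ℝ) ≠ 0 := Nat.cast_ne_zero.mpr (NeZero.ne N)
  simp only [pickMean, Finset.sum_const, Finset.card_univ, Fintype.card_fin, nsmul_eq_mul]
  calc _ = ∑ y : Fin N → X, batchProb P y * b := by
        refine Finset.sum_congr rfl fun y _ => by field_simp
    _ = b := by rw [← Finset.sum_mul, sum_batchProb, one_mul]

theorem pickMean_mem_Icc [Fintype X] (P : PMF X) {V : X → ℝ} {a b : ℝ}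
    (hV : ∀ x, V x ∈ Set.Icc a b) : pickMean N P V ∈ Set.Icc a b := by
  constructor
  · rw [← pickMean_const (N := N) P a]; exact pickMean_mono P fun x => (hV x).1
  · rw [← pickMean_const (N := N) P b]; exact pickMean_mono P fun x => (hV x).2

/-- The source of `N^H` in the regret: a risk is compared with a mean under the law of the actual
next state, at the price of one factor `N`. -/
theorem IsTransitionRiskMapping.miniBatch_le_pickMean [Fintype X]
    {σb : X → PMF X → (X → ℝ) → ℝ} (h : IsTransitionRiskMapping σb) (x : X) (P : PMF X)
    {D : X → ℝ} (hD : ∀ z, 0 ≤ D z) : miniBatch N σb x P D ≤ N * pickMean N P D := by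
  have hN : (N : ℝ) ≠ 0 := Nat.cast_ne_zero.mpr (NeZero.ne N)
  unfold pickMean miniBatch
  rw [Finset.mul_sum]
  refine Finset.sum_le_sum fun y _ => ?_
  calc _ ≤ batchProb P y * ∑ j, D (y j) :=
        mul_le_mul_of_nonneg_left (h.empirical_le_sum x y hD) (batchProb_nonneg P y)
    _ = _ := by
        rw [← Finset.mul_sum]
        field_simp

end MiniBatch

/-! ### Ranges and ordering of policy and optimal values. -/

section Values

namespace RiskMDP

variable {X A : Type*} {H N : ℕ} (M : RiskMDP X A H)

theorem stageCost_of_lt {h : ℕ} (hH : h < H) (x : X) (a : A) :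
    M.stageCost h x a = M.cost h x a := if_neg hH.ne

theorem stageCost_mem {h : ℕ} (h1 : 1 ≤ h) (hH : h ≤ H) (x : X) (a : A) :
    M.stageCost h x a ∈ Set.Icc (0 : ℝ) 1 := by
  unfold stageCost
  split_ifs with hh
  · exact M.termCost_mem x
  · exact M.cost_mem h h1 (lt_of_le_of_ne hH hh) x a

variable [NeZero N] [Fintype X]

theorem risk_coherent {h : ℕ} (h1 : 1 ≤ h) (hH : h < H) (x : X) (a : A) :
    IsCoherent (M.risk N h x a) :=
  (M.baseRisk_coherent h h1 hH).miniBatch_coherent x _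

theorem policyValueAux_mem (π : ℕ → X → A) {n : ℕ} (hn : n < H) (x : X) :
    M.policyValueAux N π n x ∈ Set.Icc (0 : ℝ) (n + 1) := by
  induction n generalizing x with
  | zero => simpa [policyValueAux] using M.termCost_mem x
  | succ n ih =>
    have h1 : 1 ≤ H - (n + 1) := by omega
    have h2 : H - (n + 1) < H := by omega
    have hr := (M.risk_coherent (N := N) h1 h2 x (π (H - (n + 1)) x)).mem_Icc
      (ih (by omega))
    have hc := M.cost_mem _ h1 h2 x (π (H - (n + 1)) x)
    simp only [policyValueAux, Set.mem_Icc] at *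
    push_cast
    constructor <;> linarith [hr.1, hr.2, hc.1, hc.2]

theorem optValueAux_mem_and_le [Finite A] [Nonempty A] (π : ℕ → X → A) {n : ℕ} (hn : n < H) (x : X) :
    0 ≤ M.optValueAux N n x ∧ M.optValueAux N n x ≤ M.policyValueAux N π n x := by
  induction n generalizing x with
  | zero => simpa [policyValueAux, optValueAux] using (M.termCost_mem x).1
  | succ n ih =>
    have h1 : 1 ≤ H - (n + 1) := by omega
    have h2 : H - (n + 1) < H := by omega
    have ih' := ih (by omega)
    constructor
    · refine le_ciInf fun a => ?_
      have hr := (M.risk_coherent (N := N) h1 h2 x a).monotone (fun _ => 0) _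
        fun x => (ih' x).1
      rw [(M.risk_coherent (N := N) h1 h2 x a).const] at hr
      have hc := M.cost_mem _ h1 h2 x a
      linarith [hc.1]
    · refine (ciInf_le (Set.finite_range _).bddBelow (π (H - (n + 1)) x)).trans ?_
      simp only [policyValueAux]
      gcongr
      exact (M.risk_coherent (N := N) h1 h2 x _).monotone _ _ fun x => (ih' x).2

end RiskMDP

end Values

/-! ### Filtration of a run and conditional expectations given the past. -/

section Measurability

variable {Ω : Type*}

/-- Substitution of a measurable finite-valued random variable for a parameter. -/
theorem measurable_substitute {S T : Type*} [Finite S] {m : MeasurableSpace Ω}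
    [mT : MeasurableSpace T] {s : Ω → S} (hs : Measurable[m, ⊤] s) {F : S → Ω → T}
    (hF : ∀ a, Measurable[m] (F a)) : Measurable[m] fun ω => F (s ω) ω := by
  intro t ht
  have : (fun ω => F (s ω) ω) ⁻¹' t = ⋃ a, s ⁻¹' {a} ∩ F a ⁻¹' t := by
    ext ω; simp
  rw [this]
  exact MeasurableSet.iUnion fun a => (hs trivial).inter (hF a ht)

namespace QLearningRun

variable {X A : Type*} {H d N : ℕ} [NeZero N] {M : RiskMDP X A H}
  {φ : X → A → Fin d → ℝ} {K : ℕ} {lam β : ℝ} [mΩ : MeasurableSpace Ω] {μ : Measure Ω}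
  (R : QLearningRun M N φ K lam β μ)

theorem history_stage_mono {k h h' : ℕ} (hk : 1 ≤ k) (hkK : k ≤ K) (h1 : 1 ≤ h) (hh : h ≤ h')
    (hH : h' ≤ H) : R.history k h ≤ R.history k h' := by
  induction h', hh using Nat.le_induction with
  | base => exact le_rfl
  | succ j hj ih => exact (ih (by omega)).trans (R.history_stage k j hk hkK (by omega) (by omega))

theorem history_succ_episode {k h h' : ℕ} (hk : 1 ≤ k) (hkK : k < K) (h1 : 1 ≤ h) (hH : h ≤ H)
    (h1' : 1 ≤ h') (hH' : h' ≤ H) : R.history k h ≤ R.history (k + 1) h' :=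
  ((R.history_stage_mono hk hkK.le h1 hH le_rfl).trans (R.history_episode k hk hkK)).trans
    (R.history_stage_mono (by omega) (by omega) le_rfl h1' hH')

theorem history_episode_mono {k k' h : ℕ} (hk : 1 ≤ k) (hkk : k ≤ k') (hkK : k' ≤ K)
    (h1 : 1 ≤ h) (hH : h ≤ H) : R.history k h ≤ R.history k' h := by
  induction k', hkk using Nat.le_induction with
  | base => exact le_rfl
  | succ j hj ih =>
    exact (ih (by omega)).trans (R.history_succ_episode (by omega) (by omega) h1 hH h1 hH)

theorem state_measurable [Finite X] {k h : ℕ} (hk : 1 ≤ k) (hkK : k ≤ K) (h1 : 1 ≤ h)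
    (hH : h ≤ H) : Measurable[R.history k h, ⊤] (R.state h k) := by
  rcases h1.eq_or_lt with rfl | h2
  · exact R.state_one_measurable k hk hkK
  obtain ⟨j, rfl⟩ : ∃ j, h = j + 1 := ⟨h - 1, by omega⟩
  have hst : R.state (j + 1) k = fun ω => R.batch (j + 1) k ω (R.pick (j + 1) k ω) :=
    funext fun ω => R.state_next k j hk hkK (by omega) (by omega) ω
  rw [hst]
  refine measurable_substitute (mT := ⊤) (R.pick_measurable k j hk hkK (by omega) (by omega))
    (F := fun i ω => R.batch (j + 1) k ω i) fun i => ?_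
  exact (@measurable_from_top _ _ ⊤ fun y : Fin N → X => y i).comp
    (R.batch_measurable k j hk hkK (by omega) (by omega))

theorem action_measurable [Finite X] {k h : ℕ} (hk : 1 ≤ k) (hkK : k ≤ K) (h1 : 1 ≤ h)
    (hH : h ≤ H) : Measurable[R.history k h, ⊤] (R.action h k) :=
  measurable_substitute (mT := ⊤) (R.state_measurable hk hkK h1 hH)
    (F := fun x ω => R.policy k ω h x) fun x =>
      (R.policy_measurable k h hk hkK h1 hH x).mono
        (R.history_stage_mono hk hkK le_rfl h1 hH) le_rfl

theorem measurable_feature [Finite X] [Finite A] {k h : ℕ} (hk : 1 ≤ k) (hkK : k ≤ K)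
    (h1 : 1 ≤ h) (hH : h ≤ H) (i : Fin d) :
    Measurable[R.history k h] fun ω => φ (R.state h k ω) (R.action h k ω) i :=
  measurable_substitute (R.state_measurable hk hkK h1 hH)
    (F := fun x ω => φ x (R.action h k ω) i) fun x =>
      measurable_substitute (R.action_measurable hk hkK h1 hH)
        (F := fun a _ => φ x a i) fun _ => measurable_const

/-- Conditional expectation of a function of the batch, the index and the past. -/
theorem condExp_batch [Fintype X] [IsProbabilityMeasure μ] {k h : ℕ} (hk : 1 ≤ k) (hkK : k ≤ K)
    (h1 : 1 ≤ h) (hH : h < H) {c : (Fin N → X) → Fin N → Ω → ℝ}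
    (hc : ∀ y j, Measurable[R.history k h] (c y j)) {C : ℝ} (hC : ∀ y j ω, |c y j ω| ≤ C) :
    μ[fun ω => c (R.batch (h + 1) k ω) (R.pick (h + 1) k ω) ω | R.history k h] =ᵐ[μ] fun ω =>
      ∑ y : Fin N → X, ∑ j, batchProb (M.kernel h (R.state h k ω) (R.action h k ω)) y *
        (1 / (N : ℝ)) * c y j ω := by
  classical
  -- The pair (batch, index) takes finitely many values. On each atom the integrand is determined by
  -- the past and can be pulled out of the conditional expectation.
  set E : (Fin N → X) × Fin N → Set Ω := fun q =>
    {ω | R.batch (h + 1) k ω = q.1 ∧ R.pick (h + 1) k ω = q.2} with hE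
  have hEm : ∀ q, MeasurableSet (E q) := by
    intro q
    have e1 := (R.batch_measurable k h hk hkK h1 hH).mono (R.history_le k (h + 1)) le_rfl
      (t := {q.1}) trivial
    have e2 := (R.pick_measurable k h hk hkK h1 hH).mono (R.history_le k (h + 1)) le_rfl
      (t := {q.2}) trivial
    exact e1.inter e2
  have hind : ∀ q, Integrable ((E q).indicator fun _ => (1 : ℝ)) μ := fun q =>
    (integrable_const 1).indicator (hEm q)
  have hprod : ∀ q : (Fin N → X) × Fin N,
      Integrable (c q.1 q.2 * (E q).indicator fun _ => (1 : ℝ)) μ := by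
    intro q
    refine Integrable.of_bound (((hc q.1 q.2).mono (R.history_le k h) le_rfl).mul
      (measurable_const.indicator (hEm q))).aestronglyMeasurable C
      (Filter.Eventually.of_forall fun ω => ?_)
    have := hC q.1 q.2 ω
    simp only [Pi.mul_apply, Set.indicator_apply]
    split_ifs
    · simpa using this
    · simpa using (abs_nonneg _).trans this
  have hsum : (fun ω => c (R.batch (h + 1) k ω) (R.pick (h + 1) k ω) ω) =
      ∑ q : (Fin N → X) × Fin N, c q.1 q.2 * (E q).indicator fun _ => (1 : ℝ) := by
    funext ω
    rw [Finset.sum_apply, Finset.sum_eq_single (R.batch (h + 1) k ω, R.pick (h + 1) k ω)]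
    · simp [hE]
    · intro q _ hq
      have : ω ∉ E q := fun hω => hq (Prod.ext hω.1.symm hω.2.symm)
      simp [this]
    · simp
  rw [hsum]
  refine (condExp_finsetSum (fun q _ => hprod q) (R.history k h)).trans ?_
  have hall : ∀ᵐ ω ∂μ, ∀ q : (Fin N → X) × Fin N,
      (μ[c q.1 q.2 * (E q).indicator fun _ => (1 : ℝ) | R.history k h]) ω =
        c q.1 q.2 ω * (batchProb (M.kernel h (R.state h k ω) (R.action h k ω)) q.1 *
          (1 / (N : ℝ))) := by
    rw [ae_all_iff]
    intro q
    filter_upwards [condExp_mul_of_stronglyMeasurable_left (hc q.1 q.2).stronglyMeasurable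
      (hprod q) (hind q), R.sampling k h hk hkK h1 hH q.1 q.2] with ω e1 e2
    rw [e1, Pi.mul_apply, e2]
    rfl
  filter_upwards [hall] with ω hω
  rw [Finset.sum_apply, Fintype.sum_prod_type]
  refine Finset.sum_congr rfl fun y _ => Finset.sum_congr rfl fun j _ => ?_
  rw [hω (y, j)]
  ring

/-- `W` may be random as long as it is known when the transition starts; it will be the gap bound of
the current episode. -/
theorem condExp_state_next [Fintype X] [IsProbabilityMeasure μ] {k h : ℕ} (hk : 1 ≤ k)
    (hkK : k ≤ K) (h1 : 1 ≤ h) (hH : h < H) {W : Ω → X → ℝ}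
    (hW : ∀ x, Measurable[R.history k h] fun ω => W ω x) {C : ℝ} (hC : ∀ ω x, |W ω x| ≤ C) :
    μ[fun ω => W ω (R.state (h + 1) k ω) | R.history k h] =ᵐ[μ] fun ω =>
      pickMean N (M.kernel h (R.state h k ω) (R.action h k ω)) (W ω) := by
  have := R.condExp_batch hk hkK h1 hH (c := fun y j ω => W ω (y j)) (fun y j => hW _)
    (fun y j ω => hC ω _)
  simpa only [R.state_next k h hk hkK h1 hH, pickMean] using this

theorem abs_ciInf_sub_ciInf_le [Finite A] [Nonempty A] {f g : A → ℝ} {ε : ℝ}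
    (h : ∀ a, |f a - g a| ≤ ε) : |(⨅ a, f a) - ⨅ a, g a| ≤ ε := by
  have e1 : (⨅ a, f a) - ε ≤ ⨅ a, g a := le_ciInf fun a => by
    linarith [ciInf_le (Set.finite_range f).bddBelow a, (abs_le.mp (h a)).2]
  have e2 : (⨅ a, g a) - ε ≤ ⨅ a, f a := le_ciInf fun a => by
    linarith [ciInf_le (Set.finite_range g).bddBelow a, (abs_le.mp (h a)).1]
  rw [abs_le]; constructor <;> linarith

theorem abs_apply_sub_le_norm [Fintype X] [Fintype A] (Q Q' : X → A → ℝ) (x : X) (a : A) :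
    |Q x a - Q' x a| ≤ ‖Q - Q'‖ := by
  have h1 := norm_le_pi_norm (Q - Q') x
  have h2 := norm_le_pi_norm ((Q - Q') x) a
  exact h2.trans h1

/-- The risk aggregator is an economical estimator. -/
theorem UsesAggregator.usesUnbiasedEstimator [Fintype X] [Fintype A] [Nonempty A]
    [IsProbabilityMeasure μ] {R : QLearningRun M N φ K lam β μ} (hR : R.UsesAggregator)
    {L : ℝ} (hL : 1 ≤ L) : R.UsesUnbiasedEstimator L where
  measurable h τ hτ hτK h1 hH Q := by
    simp only [hR h τ hτ hτK h1 hH]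
    refine measurable_substitute ((R.state_measurable hτ hτK h1 hH.le).mono
      (R.history_stage τ h hτ hτK h1 hH) le_rfl)
      (F := fun x ω => M.baseRisk h x (empirical (R.batch (h + 1) τ ω)) fun y => ⨅ a, Q y a)
      fun x => ?_
    exact measurable_substitute (R.batch_measurable τ h hτ hτK h1 hH)
      (F := fun y _ => M.baseRisk h x (empirical y) fun y => ⨅ a, Q y a) fun _ => measurable_const
  lipschitz h τ hτ hτK h1 hH ω Q Q' := by
    rw [hR h τ hτ hτK h1 hH, hR h τ hτ hτK h1 hH]
    refine (((M.baseRisk_coherent h h1 hH).coherent _ _).abs_sub_le fun x =>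
      abs_ciInf_sub_ciInf_le fun a => abs_apply_sub_le_norm Q Q' x a).trans ?_
    exact le_mul_of_one_le_left (norm_nonneg _) hL
  zero h τ hτ hτK h1 hH ω := by
    rw [hR h τ hτ hτK h1 hH]
    simpa using ((M.baseRisk_coherent h h1 hH).coherent (R.state h τ ω)
      (empirical (R.batch (h + 1) τ ω))).const 0
  unbiased h τ hτ hτK h1 hH Q := by
    simp only [hR h τ hτ hτK h1 hH]
    set V : X → ℝ := fun y => ⨅ a, Q y a with hV
    obtain ⟨C, hC⟩ : ∃ C, ∀ y, |V y| ≤ C := by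
      obtain ⟨C, hC⟩ := (Set.finite_range fun y => |V y|).bddAbove
      exact ⟨C, fun y => hC ⟨y, rfl⟩⟩
    have hN : (N : ℝ) ≠ 0 := Nat.cast_ne_zero.mpr (NeZero.ne N)
    refine (R.condExp_batch hτ hτK h1 hH
      (c := fun y _ ω => M.baseRisk h (R.state h τ ω) (empirical y) V) (fun y j => ?_)
      (C := C) fun y j ω => ?_).trans ?_
    · exact measurable_substitute (R.state_measurable hτ hτK h1 hH.le)
        (F := fun x _ => M.baseRisk h x (empirical y) V) fun _ => measurable_const
    · exact abs_le.mpr (((M.baseRisk_coherent h h1 hH).coherent _ _).mem_Icc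
        fun x => abs_le.mp (hC x))
    · refine Filter.Eventually.of_forall fun ω => ?_
      simp only [RiskMDP.risk, miniBatch, Finset.sum_const, Finset.card_univ, Fintype.card_fin,
        nsmul_eq_mul]
      refine Finset.sum_congr rfl fun y _ => ?_
      field_simp

end QLearningRun

end Measurability

end RiskQ

end

section

open Matrix

/-! ### Ridge regression error and crude parameter bounds. -/

section RidgeRegression

variable {d : ℕ}

theorem abs_ridge_inv_dotProduct_le {lam : ℝ} (hlam : 0 < lam) (f : ℕ → Fin d → ℝ) (k : ℕ)
    {v w : Fin d → ℝ} (hv : v ⬝ᵥ v ≤ 1) (hw : w ⬝ᵥ w ≤ 1) :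
    |v ⬝ᵥ (ridge lam f k)⁻¹ *ᵥ w| ≤ 1 / lam := by
  have hb : ∀ u : Fin d → ℝ, u ⬝ᵥ u ≤ 1 → u ⬝ᵥ (ridge lam f k)⁻¹ *ᵥ u ≤ 1 / lam :=
    fun u hu => (ridge_inv_form_le hlam f k u).trans (by gcongr)
  calc _ ≤ √(v ⬝ᵥ (ridge lam f k)⁻¹ *ᵥ v) * √(w ⬝ᵥ (ridge lam f k)⁻¹ *ᵥ w) :=
        posSemidef_abs_dotProduct_le (ridge_inv_posSemidef hlam f k) v w
    _ ≤ √(1 / lam) * √(1 / lam) := by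
        gcongr
        · exact hb v hv
        · exact hb w hw
    _ = 1 / lam := Real.mul_self_sqrt (by positivity)

theorem single_dotProduct_self (i : Fin d) :
    (Pi.single i 1 : Fin d → ℝ) ⬝ᵥ Pi.single i 1 = 1 := by simp

theorem abs_ridge_inv_apply_le {lam : ℝ} (hlam : 0 < lam) (f : ℕ → Fin d → ℝ) (k : ℕ)
    (i j : Fin d) : |(ridge lam f k)⁻¹ i j| ≤ 1 / lam := by
  have := abs_ridge_inv_dotProduct_le hlam f k (single_dotProduct_self i).le
    (single_dotProduct_self j).le
  simpa using this

/-- A crude bound is enough: it only fixes the size of the grid, which enters the width through its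
logarithm. -/
theorem abs_ridge_weights_le {lam : ℝ} (hlam : 0 < lam) (f : ℕ → Fin d → ℝ)
    (hf : ∀ τ, f τ ⬝ᵥ f τ ≤ 1) {k K : ℕ} (hkK : k ≤ K) {y : ℕ → ℝ} {Y : ℝ}
    (hY : 0 ≤ Y) (hy : ∀ τ, 1 ≤ τ → τ < k → |y τ| ≤ Y) (i : Fin d) :
    |((ridge lam f k)⁻¹ *ᵥ ∑ τ ∈ Finset.Ico 1 k, y τ • f τ) i| ≤ K * Y / lam := by
  have h1 : ((ridge lam f k)⁻¹ *ᵥ ∑ τ ∈ Finset.Ico 1 k, y τ • f τ) i =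
      ∑ τ ∈ Finset.Ico 1 k, y τ * (Pi.single i 1 ⬝ᵥ (ridge lam f k)⁻¹ *ᵥ f τ) := by
    rw [mulVec_sum, Finset.sum_apply]
    refine Finset.sum_congr rfl fun τ _ => ?_
    simp [mulVec_smul]
  rw [h1]
  refine (Finset.abs_sum_le_sum_abs _ _).trans ?_
  calc _ ≤ ∑ τ ∈ Finset.Ico 1 k, Y * (1 / lam) := by
        refine Finset.sum_le_sum fun τ hτ => ?_
        rw [Finset.mem_Ico] at hτ
        rw [abs_mul]
        gcongr
        · exact hy τ hτ.1 hτ.2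
        · exact abs_ridge_inv_dotProduct_le hlam f k (single_dotProduct_self i).le (hf τ)
    _ = ((k - 1 : ℕ) : ℝ) * Y / lam := by simp; ring
    _ ≤ K * Y / lam := by
        gcongr
        omega

/-- The error of ridge regression for a linear target with noise `ν`. -/
theorem abs_ridge_regression_error_le {lam : ℝ} (hlam : 0 < lam) (f : ℕ → Fin d → ℝ) (k : ℕ)
    (w : Fin d → ℝ) {y ν : ℕ → ℝ} (hy : ∀ τ, 1 ≤ τ → τ < k → y τ = f τ ⬝ᵥ w + ν τ)
    (v : Fin d → ℝ) :
    |((ridge lam f k)⁻¹ *ᵥ ∑ τ ∈ Finset.Ico 1 k, y τ • f τ) ⬝ᵥ v - v ⬝ᵥ w| ≤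
      (√((∑ τ ∈ Finset.Ico 1 k, ν τ • f τ) ⬝ᵥ (ridge lam f k)⁻¹ *ᵥ
        ∑ τ ∈ Finset.Ico 1 k, ν τ • f τ) + √(lam * (w ⬝ᵥ w))) *
        √(v ⬝ᵥ (ridge lam f k)⁻¹ *ᵥ v) := by
  have hP := ridge_posDef hlam f k
  have hI := ridge_inv_posSemidef hlam f k
  set S := ∑ τ ∈ Finset.Ico 1 k, ν τ • f τ with hS
  -- The exact part of the target reproduces `w` up to the shrinkage `lam • w`, leaving the noise
  -- `S` and a bias.
  have h1 : ∑ τ ∈ Finset.Ico 1 k, y τ • f τ = ridge lam f k *ᵥ w + (S - lam • w) := by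
    rw [ridge_mulVec, hS]
    have : ∑ τ ∈ Finset.Ico 1 k, y τ • f τ =
        ∑ τ ∈ Finset.Ico 1 k, ((f τ ⬝ᵥ w) • f τ + ν τ • f τ) := by
      refine Finset.sum_congr rfl fun τ hτ => ?_
      rw [Finset.mem_Ico] at hτ
      rw [hy τ hτ.1 hτ.2, add_smul]
    rw [this, Finset.sum_add_distrib]
    abel
  have h2 : ((ridge lam f k)⁻¹ *ᵥ ∑ τ ∈ Finset.Ico 1 k, y τ • f τ) ⬝ᵥ v - v ⬝ᵥ w =
      v ⬝ᵥ (ridge lam f k)⁻¹ *ᵥ S - lam * (v ⬝ᵥ (ridge lam f k)⁻¹ *ᵥ w) := by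
    rw [h1, mulVec_add, mulVec_mulVec, posDef_inv_mul hP, one_mulVec, mulVec_sub, mulVec_smul,
      add_dotProduct, sub_dotProduct, smul_dotProduct, smul_eq_mul, dotProduct_comm w,
      dotProduct_comm _ v, dotProduct_comm _ v]
    ring
  have h3 := posSemidef_abs_dotProduct_le hI v S
  have h4 := posSemidef_abs_dotProduct_le hI v w
  have h5 : lam * √(w ⬝ᵥ (ridge lam f k)⁻¹ *ᵥ w) ≤ √(lam * (w ⬝ᵥ w)) := by
    apply Real.le_sqrt_of_sq_le
    rw [mul_pow, Real.sq_sqrt (posSemidef_form_nonneg hI w)]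
    have := ridge_inv_form_le hlam f k w
    rw [le_div_iff₀ hlam] at this
    nlinarith
  rw [h2]
  calc _ ≤ |v ⬝ᵥ (ridge lam f k)⁻¹ *ᵥ S| + |lam * (v ⬝ᵥ (ridge lam f k)⁻¹ *ᵥ w)| := abs_sub _ _
    _ = |v ⬝ᵥ (ridge lam f k)⁻¹ *ᵥ S| + lam * |v ⬝ᵥ (ridge lam f k)⁻¹ *ᵥ w| := by
        rw [abs_mul, abs_of_pos hlam]
    _ ≤ √(v ⬝ᵥ (ridge lam f k)⁻¹ *ᵥ v) * √(S ⬝ᵥ (ridge lam f k)⁻¹ *ᵥ S) +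
        lam * (√(v ⬝ᵥ (ridge lam f k)⁻¹ *ᵥ v) * √(w ⬝ᵥ (ridge lam f k)⁻¹ *ᵥ w)) := by gcongr
    _ = (√(S ⬝ᵥ (ridge lam f k)⁻¹ *ᵥ S) + lam * √(w ⬝ᵥ (ridge lam f k)⁻¹ *ᵥ w)) *
        √(v ⬝ᵥ (ridge lam f k)⁻¹ *ᵥ v) := by ring
    _ ≤ _ := by gcongr

end RidgeRegression

namespace RiskQ

open MeasureTheory

/-! ### Covering the class of estimated functions. -/

section Simplex

variable {d : ℕ}

theorem abs_dotProduct_simplex_le {v w : Fin d → ℝ} (hv : v ∈ stdSimplex ℝ (Fin d)) {ε : ℝ}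
    (hw : ∀ i, |w i| ≤ ε) : |v ⬝ᵥ w| ≤ ε := by
  refine (Finset.abs_sum_le_sum_abs _ _).trans ?_
  calc _ ≤ ∑ i, v i * ε := by
        refine Finset.sum_le_sum fun i _ => ?_
        rw [abs_mul, abs_of_nonneg (hv.1 i)]
        exact mul_le_mul_of_nonneg_left (hw i) (hv.1 i)
    _ = ε := by rw [← Finset.sum_mul, hv.2, one_mul]

theorem dotProduct_self_simplex_le {v : Fin d → ℝ} (hv : v ∈ stdSimplex ℝ (Fin d)) :
    v ⬝ᵥ v ≤ 1 := by
  refine (le_abs_self _).trans (abs_dotProduct_simplex_le hv fun i => ?_)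
  rw [abs_of_nonneg (hv.1 i), ← hv.2]
  exact Finset.single_le_sum (fun j _ => hv.1 j) (Finset.mem_univ i)

/-- No sign condition is imposed (`√` is 0 on negative numbers), because a grid matrix need not be
positive semidefinite. -/
theorem abs_sqrt_sub_sqrt_le (a b : ℝ) : |√a - √b| ≤ √|a - b| := by
  have key : ∀ a b : ℝ, √a ≤ √b + √|a - b| := by
    intro a b
    apply Real.sqrt_le_iff.mpr
    refine ⟨by positivity, ?_⟩
    have h1 : b ≤ √b ^ 2 := by
      rcases le_total 0 b with h | h
      · rw [Real.sq_sqrt h]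
      · exact h.trans (sq_nonneg _)
    have h2 : √|a - b| ^ 2 = |a - b| := Real.sq_sqrt (abs_nonneg _)
    nlinarith [le_abs_self (a - b), mul_nonneg (Real.sqrt_nonneg b) (Real.sqrt_nonneg |a - b|)]
  have h1 := key a b
  have h2 := key b a
  rw [abs_sub_comm b a] at h2
  rw [abs_le]; constructor <;> linarith

end Simplex

section Cover

variable {X A : Type*} {d : ℕ}

/-- The parametric form of the functions produced by the backward pass. -/
noncomputable def qForm (φ : X → A → Fin d → ℝ) (w : Fin d → ℝ) (G : Matrix (Fin d) (Fin d) ℝ)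
    (x : X) (a : A) : ℝ :=
  max (w ⬝ᵥ φ x a - √(φ x a ⬝ᵥ G *ᵥ φ x a)) 0

/-- Pairing with a simplex vector averages coordinates, so entrywise errors carry over with no
factor of `d`; the square root turns the error `ε` in `G` into `√ε`. -/
theorem abs_qForm_sub_le {φ : X → A → Fin d → ℝ} (hφ : ∀ x a, φ x a ∈ stdSimplex ℝ (Fin d))
    {w w' : Fin d → ℝ} {G G' : Matrix (Fin d) (Fin d) ℝ} {ε : ℝ}
    (hw : ∀ i, |w i - w' i| ≤ ε) (hG : ∀ i j, |G i j - G' i j| ≤ ε) (x : X) (a : A) :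
    |qForm φ w G x a - qForm φ w' G' x a| ≤ ε + √ε := by
  refine (abs_max_sub_max_le_abs _ _ _).trans ?_
  have h1 : |w ⬝ᵥ φ x a - w' ⬝ᵥ φ x a| ≤ ε := by
    rw [← sub_dotProduct, dotProduct_comm]
    exact abs_dotProduct_simplex_le (hφ x a) hw
  have h2 : |φ x a ⬝ᵥ G *ᵥ φ x a - φ x a ⬝ᵥ G' *ᵥ φ x a| ≤ ε := by
    rw [← dotProduct_sub, ← sub_mulVec]
    refine abs_dotProduct_simplex_le (hφ x a) fun i => ?_
    simp only [mulVec]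
    rw [dotProduct_comm]
    exact abs_dotProduct_simplex_le (hφ x a) fun j => hG i j
  have h3 := (abs_sqrt_sub_sqrt_le (φ x a ⬝ᵥ G *ᵥ φ x a) (φ x a ⬝ᵥ G' *ᵥ φ x a)).trans
    (Real.sqrt_le_sqrt h2)
  rw [abs_le] at *
  constructor <;> linarith [h1.1, h1.2, h3.1, h3.2]

/-- Grid of parameters: `d + d²` coordinates with `2 m + 1` values each. -/
abbrev GridIndex (d m : ℕ) : Type := (Fin d ⊕ Fin d × Fin d) → Fin (2 * m + 1)

/-- The function with parameters on the grid `{-m/K, …, m/K}`, truncated at `H`. -/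
noncomputable def gridQ (φ : X → A → Fin d → ℝ) (H K : ℕ) {m : ℕ} (q : GridIndex d m)
    (x : X) (a : A) : ℝ :=
  min (qForm φ (fun i => ((q (.inl i) : ℝ) - m) / K)
    (Matrix.of fun i j => ((q (.inr (i, j)) : ℝ) - m) / K) x a) H

theorem gridQ_mem (φ : X → A → Fin d → ℝ) (H K : ℕ) {m : ℕ} (q : GridIndex d m) (x : X) (a : A) :
    gridQ φ H K q x a ∈ Set.Icc (0 : ℝ) H :=
  ⟨le_min (le_max_right _ _) (Nat.cast_nonneg H), min_le_right _ _⟩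

theorem exists_grid_point {K m : ℕ} (hK : 1 ≤ K) {t : ℝ} (ht : |t| * K ≤ m) :
    ∃ i : Fin (2 * m + 1), |t - ((i : ℝ) - m) / K| ≤ 1 / K := by
  have hK' : (0 : ℝ) < K := by exact_mod_cast hK
  have h1 : -(m : ℤ) ≤ ⌊t * K⌋ := by
    rw [Int.le_floor]
    push_cast
    nlinarith [neg_abs_le t]
  have h2 : ⌊t * K⌋ ≤ (m : ℤ) := by
    have h3 : (⌊t * K⌋ : ℝ) ≤ m := (Int.floor_le _).trans (by nlinarith [le_abs_self t])
    exact_mod_cast h3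
  refine ⟨⟨(⌊t * K⌋ + m).toNat, by omega⟩, ?_⟩
  have h3 : (((⌊t * K⌋ + m).toNat : ℕ) : ℝ) = (⌊t * K⌋ : ℝ) + m := by
    have : (((⌊t * K⌋ + m).toNat : ℕ) : ℤ) = ⌊t * K⌋ + m := Int.toNat_of_nonneg (by omega)
    exact_mod_cast this
  simp only [h3, add_sub_cancel_right]
  have h4 : t - (⌊t * K⌋ : ℝ) / K = (t * K - ⌊t * K⌋) / K := by field_simp
  rw [h4, abs_div, abs_of_pos hK']
  gcongr
  rw [abs_le]
  constructor <;> linarith [Int.floor_le (t * K), Int.lt_floor_add_one (t * K)]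

/-- Mesh `1/K` gives error `1/K + 1/√K`. The order `1/√K` is what is needed: squared and summed over
fewer than `K` episodes it stays bounded. Truncating the grid function at `H` is harmless because
the target is already at most `H`. -/
theorem exists_gridQ_close {φ : X → A → Fin d → ℝ} (hφ : ∀ x a, φ x a ∈ stdSimplex ℝ (Fin d))
    {H K m : ℕ} (hK : 1 ≤ K) {w : Fin d → ℝ} {G : Matrix (Fin d) (Fin d) ℝ}
    (hw : ∀ i, |w i| * K ≤ m) (hG : ∀ i j, |G i j| * K ≤ m)
    (hQ : ∀ x a, qForm φ w G x a ≤ H) :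
    ∃ q : GridIndex d m, ∀ x a, |qForm φ w G x a - gridQ φ H K q x a| ≤ 2 / √K := by
  choose qw hqw using fun i => exists_grid_point hK (hw i)
  choose qG hqG using fun i j => exists_grid_point hK (hG i j)
  refine ⟨Sum.elim qw fun ij => qG ij.1 ij.2, fun x a => ?_⟩
  have hK' : (1 : ℝ) ≤ K := by exact_mod_cast hK
  have h1 := abs_qForm_sub_le hφ (w := w) (G := G) (ε := 1 / K)
    (w' := fun i => ((qw i : ℝ) - m) / K)
    (G' := Matrix.of fun i j => ((qG i j : ℝ) - m) / K) hqw hqG x a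
  have h2 : 1 / (K : ℝ) + √(1 / K) ≤ 2 / √K := by
    rw [Real.sqrt_div zero_le_one, Real.sqrt_one]
    have hs : 1 ≤ √(K : ℝ) := Real.one_le_sqrt.mpr hK'
    have : 1 / (K : ℝ) ≤ 1 / √K := by
      apply one_div_le_one_div_of_le (by linarith)
      rw [Real.sqrt_le_left (by linarith)]
      nlinarith
    calc _ ≤ 1 / √(K : ℝ) + 1 / √K := by linarith
      _ = _ := by ring
  refine le_trans ?_ (h1.trans h2)
  conv_lhs => rw [← min_eq_left (hQ x a)]
  refine (abs_min_sub_min_le_max _ _ _ _).trans (max_le le_rfl ?_)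
  simp

end Cover

/-! ### Estimation noise: bounds for a fixed function and uniformly over the class. -/

section Noise

namespace QLearningRun

variable {X A : Type*} {H d N : ℕ} [NeZero N]
  {M : RiskMDP X A H} {φ : X → A → Fin d → ℝ} {K : ℕ} {lam β : ℝ} {Ω : Type*}
  [mΩ : MeasurableSpace Ω] {μ : Measure Ω} (R : QLearningRun M N φ K lam β μ)

/-- `φ(x_h^τ, a_h^τ)`. -/
def feature (h τ : ℕ) (ω : Ω) : Fin d → ℝ := φ (R.state h τ ω) (R.action h τ ω)

/-- The error of the estimate of the transition risk at stage `h` of episode `τ`. -/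
noncomputable def noise [Fintype X] (h τ : ℕ) (ω : Ω) (Q : X → A → ℝ) : ℝ :=
  R.est h τ ω Q - M.risk N h (R.state h τ ω) (R.action h τ ω) fun y => ⨅ a, Q y a

variable [Fintype X] [Fintype A] {R} {L : ℝ}

theorem UsesUnbiasedEstimator.abs_est_le (hR : R.UsesUnbiasedEstimator L) (hL : 1 ≤ L)
    {h τ : ℕ} (hτ : 1 ≤ τ) (hτK : τ ≤ K) (h1 : 1 ≤ h) (hH : h < H) (ω : Ω) {Q : X → A → ℝ}
    (hQ : ∀ x a, Q x a ∈ Set.Icc (0 : ℝ) H) : |R.est h τ ω Q| ≤ L * H := by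
  have h2 := hR.lipschitz h τ hτ hτK h1 hH ω Q 0
  rw [hR.zero h τ hτ hτK h1 hH, sub_zero, sub_zero] at h2
  refine h2.trans ?_
  gcongr
  rw [pi_norm_le_iff_of_nonneg (Nat.cast_nonneg H)]
  intro x
  rw [pi_norm_le_iff_of_nonneg (Nat.cast_nonneg H)]
  intro a
  rw [Real.norm_of_nonneg (hQ x a).1]
  exact (hQ x a).2

theorem measurable_risk (R : QLearningRun M N φ K lam β μ) {h τ : ℕ} (hτ : 1 ≤ τ) (hτK : τ ≤ K)
    (h1 : 1 ≤ h) (hH : h < H) (V : X → ℝ) :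
    Measurable[R.history τ h] fun ω => M.risk N h (R.state h τ ω) (R.action h τ ω) V :=
  measurable_substitute (R.state_measurable hτ hτK h1 hH.le)
    (F := fun x ω => M.risk N h x (R.action h τ ω) V) fun x =>
      measurable_substitute (R.action_measurable hτ hτK h1 hH.le)
        (F := fun a _ => M.risk N h x a V) fun _ => measurable_const

theorem UsesUnbiasedEstimator.measurable_noise (hR : R.UsesUnbiasedEstimator L)
    {h τ : ℕ} (hτ : 1 ≤ τ) (hτK : τ ≤ K) (h1 : 1 ≤ h) (hH : h < H) (Q : X → A → ℝ) :
    Measurable[R.history τ (h + 1)] fun ω => R.noise h τ ω Q :=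
  (hR.measurable h τ hτ hτK h1 hH Q).sub ((R.measurable_risk hτ hτK h1 hH _).mono
    (R.history_stage τ h hτ hτK h1 hH) le_rfl)

variable [Nonempty A]

theorem ciInf_mem_Icc {q : A → ℝ} {a b : ℝ} (hq : ∀ i, q i ∈ Set.Icc a b) :
    (⨅ i, q i) ∈ Set.Icc a b :=
  ⟨le_ciInf fun i => (hq i).1, (ciInf_le (Set.finite_range q).bddBelow
    (Classical.arbitrary A)).trans (hq _).2⟩

theorem UsesUnbiasedEstimator.abs_noise_le (hR : R.UsesUnbiasedEstimator L) (hL : 1 ≤ L)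
    {h τ : ℕ} (hτ : 1 ≤ τ) (hτK : τ ≤ K) (h1 : 1 ≤ h) (hH : h < H) (ω : Ω) {Q : X → A → ℝ}
    (hQ : ∀ x a, Q x a ∈ Set.Icc (0 : ℝ) H) : |R.noise h τ ω Q| ≤ 2 * L * H := by
  have e1 := abs_le.mp (hR.abs_est_le hL hτ hτK h1 hH ω hQ)
  have e2 := (M.risk_coherent (N := N) h1 hH (R.state h τ ω) (R.action h τ ω)).mem_Icc
    fun y => ciInf_mem_Icc (hQ y)
  have e3 : (H : ℝ) ≤ L * H := le_mul_of_one_le_left (Nat.cast_nonneg H) hL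
  unfold noise
  rw [abs_le]
  constructor <;> linarith [e1.1, e1.2, e2.1, e2.2]

theorem UsesUnbiasedEstimator.abs_noise_sub_le (hR : R.UsesUnbiasedEstimator L) (hL : 1 ≤ L)
    {h τ : ℕ} (hτ : 1 ≤ τ) (hτK : τ ≤ K) (h1 : 1 ≤ h) (hH : h < H) (ω : Ω) {Q Q' : X → A → ℝ}
    {ε : ℝ} (hε : 0 ≤ ε) (hQ : ∀ x a, |Q x a - Q' x a| ≤ ε) :
    |R.noise h τ ω Q - R.noise h τ ω Q'| ≤ 2 * L * ε := by
  have hn : ‖Q - Q'‖ ≤ ε := by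
    rw [pi_norm_le_iff_of_nonneg hε]
    intro x
    rw [pi_norm_le_iff_of_nonneg hε]
    exact fun a => hQ x a
  have e1 := (hR.lipschitz h τ hτ hτK h1 hH ω Q Q').trans
    (mul_le_mul_of_nonneg_left hn (by linarith))
  have e2 := (M.risk_coherent (N := N) h1 hH (R.state h τ ω) (R.action h τ ω)).abs_sub_le
    fun y => abs_ciInf_sub_ciInf_le (hQ y)
  have e3 : ε ≤ L * ε := le_mul_of_one_le_left hε hL
  unfold noise
  rw [abs_le] at *
  constructor <;> linarith [e1.1, e1.2, e2.1, e2.2]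

/-- Uniform control of the estimation noise from its control on the grid. -/
theorem UsesUnbiasedEstimator.sqrt_noise_form_le (hR : R.UsesUnbiasedEstimator L) (hL : 1 ≤ L)
    (hφ : ∀ x a, φ x a ∈ stdSimplex ℝ (Fin d)) {h k m : ℕ} (hk : 1 ≤ k) (hkK : k ≤ K)
    (h1 : 1 ≤ h) (hH : h < H) (hlam : 0 < lam) {c : ℝ} {ω : Ω}
    (hgrid : ∀ q : GridIndex d m, (∑ τ ∈ Finset.Ico 1 k,
        R.noise h τ ω (gridQ φ H K q) • R.feature h τ ω) ⬝ᵥ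
          (ridge lam (fun τ => R.feature h τ ω) k)⁻¹ *ᵥ
            ∑ τ ∈ Finset.Ico 1 k, R.noise h τ ω (gridQ φ H K q) • R.feature h τ ω ≤ c)
    {w : Fin d → ℝ} {G : Matrix (Fin d) (Fin d) ℝ}
    (hw : ∀ i, |w i| * K ≤ m) (hG : ∀ i j, |G i j| * K ≤ m)
    (hQ : ∀ x a, qForm φ w G x a ≤ H) :
    √((∑ τ ∈ Finset.Ico 1 k, R.noise h τ ω (qForm φ w G) • R.feature h τ ω) ⬝ᵥ
        (ridge lam (fun τ => R.feature h τ ω) k)⁻¹ *ᵥ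
          ∑ τ ∈ Finset.Ico 1 k, R.noise h τ ω (qForm φ w G) • R.feature h τ ω) ≤
      √c + 4 * L := by
  have hK : (0 : ℝ) < K := by exact_mod_cast (by omega : 0 < K)
  obtain ⟨q, hq⟩ := exists_gridQ_close hφ (by omega : 1 ≤ K) hw hG hQ
  set S' := ∑ τ ∈ Finset.Ico 1 k, R.noise h τ ω (gridQ φ H K q) • R.feature h τ ω with hS'
  set Δ : ℕ → ℝ := fun τ => R.noise h τ ω (qForm φ w G) - R.noise h τ ω (gridQ φ H K q) with hΔ
  have hsplit : ∑ τ ∈ Finset.Ico 1 k, R.noise h τ ω (qForm φ w G) • R.feature h τ ω =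
      S' + ∑ τ ∈ Finset.Ico 1 k, Δ τ • R.feature h τ ω := by
    rw [hS', ← Finset.sum_add_distrib]
    exact Finset.sum_congr rfl fun τ _ => by rw [hΔ, ← add_smul, add_sub_cancel]
  rw [hsplit]
  refine (posSemidef_sqrt_form_add_le (ridge_inv_posSemidef hlam _ k) _ _).trans ?_
  refine add_le_add (Real.sqrt_le_sqrt (hgrid q)) ?_
  apply Real.sqrt_le_iff.mpr
  refine ⟨by linarith, (ridge_inv_form_sum_le hlam _ k Δ).trans ?_⟩
  calc ∑ τ ∈ Finset.Ico 1 k, Δ τ ^ 2 ≤ ∑ τ ∈ Finset.Ico 1 k, (2 * L * (2 / √(K : ℝ))) ^ 2 := by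
        refine Finset.sum_le_sum fun τ hτ => ?_
        rw [Finset.mem_Ico] at hτ
        have := hR.abs_noise_sub_le hL hτ.1 (by omega) h1 hH ω (by positivity) hq
        rw [← sq_abs]
        gcongr
    _ = ((k - 1 : ℕ) : ℝ) * ((4 * L) ^ 2 / K) := by
        rw [Finset.sum_const, Nat.card_Ico, nsmul_eq_mul]
        congr 1
        rw [show 2 * L * (2 / √(K : ℝ)) = 4 * L / √K by ring, div_pow, Real.sq_sqrt hK.le]
    _ ≤ (K : ℝ) * ((4 * L) ^ 2 / K) := by
        gcongr; omega
    _ = (4 * L) ^ 2 := by field_simp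

variable [IsProbabilityMeasure μ]

theorem UsesUnbiasedEstimator.condExp_noise (hR : R.UsesUnbiasedEstimator L) (hL : 1 ≤ L)
    {h τ : ℕ} (hτ : 1 ≤ τ) (hτK : τ ≤ K) (h1 : 1 ≤ h) (hH : h < H) {Q : X → A → ℝ}
    (hQ : ∀ x a, Q x a ∈ Set.Icc (0 : ℝ) H) :
    μ[fun ω => R.noise h τ ω Q | R.history τ h] =ᵐ[μ] 0 := by
  have hle := R.history_le τ h
  have hm := R.measurable_risk hτ hτK h1 hH fun y => ⨅ a, Q y a
  have hi1 : Integrable (fun ω => R.est h τ ω Q) μ :=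
    Integrable.of_bound ((hR.measurable h τ hτ hτK h1 hH Q).mono
      (R.history_le τ (h + 1)) le_rfl).aestronglyMeasurable (L * H)
      (Filter.Eventually.of_forall fun ω => hR.abs_est_le hL hτ hτK h1 hH ω hQ)
  have hi2 : Integrable (fun ω => M.risk N h (R.state h τ ω) (R.action h τ ω)
      fun y => ⨅ a, Q y a) μ := by
    refine Integrable.of_bound (hm.mono hle le_rfl).aestronglyMeasurable H
      (Filter.Eventually.of_forall fun ω => ?_)
    have e2 := (M.risk_coherent (N := N) h1 hH (R.state h τ ω) (R.action h τ ω)).mem_Icc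
      fun y => ciInf_mem_Icc (hQ y)
    rw [Real.norm_of_nonneg e2.1]
    exact e2.2
  have h3 := condExp_of_stronglyMeasurable (μ := μ) hle hm.stronglyMeasurable hi2
  filter_upwards [condExp_sub hi1 hi2 (R.history τ h), hR.unbiased h τ hτ hτK h1 hH Q] with ω e1 e2
  have e0 : (fun ω => R.noise h τ ω Q) = (fun ω => R.est h τ ω Q) - fun ω =>
    M.risk N h (R.state h τ ω) (R.action h τ ω) fun y => ⨅ a, Q y a := rfl
  rw [e0, e1, Pi.sub_apply, e2, h3]
  simp

/-- For a fixed function, the estimation noise is small with high probability. -/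
theorem UsesUnbiasedEstimator.measure_noise_gt_le (hR : R.UsesUnbiasedEstimator L) (hL : 1 ≤ L)
    {h k : ℕ} (hk : 1 ≤ k) (hkK : k ≤ K) (h1 : 1 ≤ h) (hH : h < H) (hlam : 0 < lam)
    {δ : ℝ} (hδ : 0 < δ) {Q : X → A → ℝ} (hQ : ∀ x a, Q x a ∈ Set.Icc (0 : ℝ) H) :
    μ {ω | (2 * L * H) ^ 2 * (Real.log ((ridge lam (fun τ => R.feature h τ ω) k).det / lam ^ d) +
          2 * Real.log (1 / δ)) <
        (∑ τ ∈ Finset.Ico 1 k, R.noise h τ ω Q • R.feature h τ ω) ⬝ᵥ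
          (ridge lam (fun τ => R.feature h τ ω) k)⁻¹ *ᵥ
            ∑ τ ∈ Finset.Ico 1 k, R.noise h τ ω Q • R.feature h τ ω} ≤ ENNReal.ofReal δ := by
  have hLH : 0 < 2 * L * H := by
    have : (0 : ℝ) < H := by exact_mod_cast (by omega : 0 < H)
    positivity
  -- At fixed stage `h` time runs over episodes: the feature is known at `history τ h`, and the
  -- noise at `history τ (h + 1)`, which is contained in `history (τ + 1) h`. Division by `2LH`
  -- brings the noise into `[-1, 1]`.
  have hmain := measure_selfNormalized_gt_le (μ := μ) (fun τ => R.history τ h) hk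
    (fun τ => R.history_le τ h)
    (fun τ e1 e2 => R.history_succ_episode e1 (by omega) h1 hH.le h1 hH.le)
    (fun τ ω => R.feature h τ ω) (fun τ ω => (2 * L * H)⁻¹ * R.noise h τ ω Q)
    (fun τ e1 e2 i => R.measurable_feature e1 (by omega) h1 hH.le i)
    (fun τ e1 e2 => ((hR.measurable_noise e1 (by omega) h1 hH Q).mono
      (R.history_succ_episode e1 (by omega) (by omega) (by omega) h1 hH.le) le_rfl).const_mul _)
    (fun τ e1 e2 ω => by
      rw [abs_mul, abs_of_pos (inv_pos.mpr hLH), inv_mul_le_iff₀ hLH, mul_one]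
      exact hR.abs_noise_le hL e1 (by omega) h1 hH ω hQ)
    (fun τ e1 e2 => by
      have h0 := hR.condExp_noise hL e1 (by omega : τ ≤ K) h1 hH hQ
      have hs := condExp_smul (μ := μ) (2 * L * H)⁻¹ (fun ω => R.noise h τ ω Q) (R.history τ h)
      filter_upwards [h0, hs] with ω e3 e4
      have e5 : (fun ω => (2 * L * H)⁻¹ * R.noise h τ ω Q) =
        (2 * L * H)⁻¹ • fun ω => R.noise h τ ω Q := rfl
      rw [e5, e4, Pi.smul_apply, e3]
      simp)
    hlam hδ
  refine le_trans (measure_mono fun ω hω => ?_) hmain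
  simp only [Set.mem_ofPred_eq] at hω ⊢
  have hS : ∑ τ ∈ Finset.Ico 1 k, ((2 * L * H)⁻¹ * R.noise h τ ω Q) • R.feature h τ ω =
      (2 * L * H)⁻¹ • ∑ τ ∈ Finset.Ico 1 k, R.noise h τ ω Q • R.feature h τ ω := by
    rw [Finset.smul_sum]
    exact Finset.sum_congr rfl fun τ _ => by rw [mul_smul]
  rw [hS, mulVec_smul, dotProduct_smul, smul_dotProduct, smul_eq_mul, smul_eq_mul, ← mul_assoc,
    ← mul_inv, ← sq, lt_inv_mul_iff₀ (by positivity)]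
  exact hω

end QLearningRun

end Noise

end RiskQ

end

section

open Matrix

namespace RiskQ

open MeasureTheory

/-! ### Linearity of backups, optimism, and the gap recursion. -/

section LinearModel

variable {X A : Type*} [Fintype X] {H N d : ℕ} [NeZero N] {M : RiskMDP X A H}
  {φ : X → A → Fin d → ℝ}

theorem dotProduct_self_eq_norm_sq (v : Fin d → ℝ) : v ⬝ᵥ v = ‖WithLp.toLp 2 v‖ ^ 2 := by
  rw [EuclideanSpace.norm_sq_eq]
  simp [dotProduct, sq]

/-- In a multipattern model the one-step cost-to-go is linear in the features. -/
theorem RiskMDP.IsMultipattern.exists_linear (hM : M.IsMultipattern N φ) {h : ℕ} (h1 : 1 ≤ h)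
    (hH : h ≤ H) {V : X → ℝ} (hV : ∀ x, V x ∈ Set.Icc (0 : ℝ) H) :
    ∃ w : Fin d → ℝ, w ⬝ᵥ w ≤ (2 * H * √(d : ℝ)) ^ 2 ∧ ∀ x a,
      M.stageCost h x a + (if h < H then M.risk N h x a V else 0) = φ x a ⬝ᵥ w := by
  obtain ⟨θ, hθ, hθ'⟩ := hM.cost_linear h h1 hH
  have hH1 : (1 : ℝ) ≤ H := by exact_mod_cast h1.trans hH
  have hd : 0 ≤ √(d : ℝ) := Real.sqrt_nonneg _
  by_cases hlt : h < H
  · obtain ⟨ρ, hρ, -, hρ'⟩ := hM.risk_patterns h h1 hlt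
    refine ⟨θ + fun j => ρ j V, ?_, fun x a => ?_⟩
    · rw [dotProduct_self_eq_norm_sq]
      gcongr
      rw [WithLp.toLp_add]
      refine (norm_add_le _ _).trans ?_
      -- Each pattern value `ρ j V` lies in `[0, H]`; adding `‖θ‖ ≤ √d ≤ H√d` gives the radius
      -- `2H√d`.
      have h2 : ‖WithLp.toLp 2 (fun j => ρ j V)‖ ≤ H * √(d : ℝ) := by
        rw [EuclideanSpace.norm_eq]
        apply Real.sqrt_le_iff.mpr
        refine ⟨by positivity, ?_⟩
        rw [mul_pow, Real.sq_sqrt (Nat.cast_nonneg d)]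
        calc _ ≤ ∑ _j : Fin d, (H : ℝ) ^ 2 := by
              refine Finset.sum_le_sum fun j _ => ?_
              have := (hρ j).mem_Icc hV
              simp only [Real.norm_eq_abs, sq_abs]
              exact pow_le_pow_left₀ this.1 this.2 2
          _ = _ := by simp; ring
      nlinarith
    · rw [if_pos hlt, hθ', hρ', ← Finset.sum_add_distrib]
      exact Finset.sum_congr rfl fun j _ => by simp only [Pi.add_apply]; ring
  · refine ⟨θ, ?_, fun x a => ?_⟩
    · rw [dotProduct_self_eq_norm_sq]
      gcongr
      nlinarith
    · rw [if_neg hlt, hθ', add_zero]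
      rfl

end LinearModel

/-- Functions of the parametric form with coefficients at most `m / K`. -/
def HasGridForm {X A : Type*} {d : ℕ} (φ : X → A → Fin d → ℝ) (K m : ℕ) (Q : X → A → ℝ) : Prop :=
  ∃ (w : Fin d → ℝ) (G : Matrix (Fin d) (Fin d) ℝ),
    (∀ i, |w i| * K ≤ m) ∧ (∀ i j, |G i j| * K ≤ m) ∧ Q = qForm φ w G

namespace QLearningRun

variable {X A : Type*} {H d N : ℕ} [NeZero N]
  {M : RiskMDP X A H} {φ : X → A → Fin d → ℝ} {K : ℕ} {lam β : ℝ} {Ω : Type*}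
  [mΩ : MeasurableSpace Ω] {μ : Measure Ω} (R : QLearningRun M N φ K lam β μ)

/-- The function `Q_{H+1-n}^k` of the run. -/
noncomputable def qRun (k : ℕ) (ω : Ω) (n : ℕ) : X → A → ℝ :=
  qHatAux M φ lam β (fun h τ => R.state h τ ω) (fun h τ => R.policy τ ω h (R.state h τ ω))
    (fun h τ => R.est h τ ω) k n

/-- The bonus `[φ(x, a)ᵀ (Λ_h^k)⁻¹ φ(x, a)]^{1/2}`. -/
noncomputable def bonus (k h : ℕ) (ω : Ω) (x : X) (a : A) : ℝ :=
  √(φ x a ⬝ᵥ (ridge lam (fun τ => R.feature h τ ω) k)⁻¹ *ᵥ φ x a)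

/-- The regression target at stage `H - n` of episode `τ`. -/
noncomputable def target (k n τ : ℕ) (ω : Ω) : ℝ :=
  M.stageCost (H - n) (R.state (H - n) τ ω) (R.action (H - n) τ ω) +
    if H - n < H then R.est (H - n) τ ω (R.qRun k ω n) else 0

/-- The regression weights of stage `H - n`. -/
noncomputable def wRun (k n : ℕ) (ω : Ω) : Fin d → ℝ :=
  (ridge lam (fun τ => R.feature (H - n) τ ω) k)⁻¹ *ᵥ
    ∑ τ ∈ Finset.Ico 1 k, R.target k n τ ω • R.feature (H - n) τ ω

theorem qRun_succ (k : ℕ) (ω : Ω) (n : ℕ) (x : X) (a : A) :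
    R.qRun k ω (n + 1) x a =
      max (R.wRun k n ω ⬝ᵥ φ x a - β * R.bonus k (H - n) ω x a) 0 := rfl

theorem qRun_nonneg (k : ℕ) (ω : Ω) (n : ℕ) (x : X) (a : A) :
    0 ≤ R.qRun k ω n x a := by
  cases n with
  | zero => exact le_rfl
  | succ n => exact le_max_right _ _

/-- The factor `β` is absorbed into the matrix, which places the estimates in the class covered by
the grid. -/
theorem qRun_succ_eq_qForm (hβ : 0 ≤ β) (k : ℕ) (ω : Ω) (n : ℕ) :
    R.qRun k ω (n + 1) = qForm φ (R.wRun k n ω)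
      (β ^ 2 • (ridge lam (fun τ => R.feature (H - n) τ ω) k)⁻¹) := by
  funext x a
  rw [qRun_succ, qForm, smul_mulVec, dotProduct_smul, smul_eq_mul, Real.sqrt_mul (sq_nonneg β),
    Real.sqrt_sq hβ]
  rfl

theorem iInf_qRun_eq [Finite A] [Nonempty A] {k : ℕ} {ω : Ω} (hk : 1 ≤ k) (hkK : k ≤ K)
    {n : ℕ} (hn : n < H) (x : X) :
    ⨅ a, R.qRun k ω (n + 1) x a = R.qRun k ω (n + 1) x (R.policy k ω (H - n) x) := by
  refine le_antisymm (ciInf_le (Set.finite_range _).bddBelow _) (le_ciInf fun a => ?_)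
  have := R.greedy k (H - n) hk hkK (by omega) (by omega) ω x a
  rwa [qHat, show H + 1 - (H - n) = n + 1 by omega] at this

variable [Fintype X]

/-- The exact one-step cost-to-go at stage `H - n` from the current estimate of the next stage. -/
noncomputable def bellman (k : ℕ) (ω : Ω) (n : ℕ) (x : X) (a : A) : ℝ :=
  M.stageCost (H - n) x a +
    if H - n < H then M.risk N (H - n) x a (fun y => ⨅ a, R.qRun k ω n y a) else 0

/-- Recursive upper bound for the gap between the value of the policy of episode `k` and its
estimate, `n` transitions before the end. -/
noncomputable def gapBound (k : ℕ) (C : ℝ) (ω : Ω) : ℕ → X → ℝ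
  | 0 => fun x => min H (C * min 1 (R.bonus k H ω x (R.policy k ω H x)))
  | n + 1 => fun x =>
      min H (C * min 1 (R.bonus k (H - (n + 1)) ω x (R.policy k ω (H - (n + 1)) x)) +
        N * pickMean N (M.kernel (H - (n + 1)) x (R.policy k ω (H - (n + 1)) x))
          (gapBound k C ω n))

/-- The truncation at `H` in the recursion keeps the later martingale differences bounded by `H`, in
spite of the factors `N`. -/
theorem gapBound_mem {C : ℝ} (hC : 0 ≤ C) (k : ℕ) (ω : Ω) (n : ℕ) (x : X) :
    R.gapBound k C ω n x ∈ Set.Icc (0 : ℝ) H := by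
  have hbon : ∀ h x a, 0 ≤ R.bonus k h ω x a := fun h x a => Real.sqrt_nonneg _
  induction n generalizing x with
  | zero =>
    refine ⟨le_min (Nat.cast_nonneg H) (mul_nonneg hC (le_min zero_le_one (hbon _ _ _))),
      min_le_left _ _⟩
  | succ n ih =>
    refine ⟨le_min (Nat.cast_nonneg H) (add_nonneg
      (mul_nonneg hC (le_min zero_le_one (hbon _ _ _))) ?_), min_le_left _ _⟩
    exact mul_nonneg (Nat.cast_nonneg N) (pickMean_mem_Icc _ ih).1

variable [Fintype A] [Nonempty A]

theorem bellman_mem {k n : ℕ} {ω : Ω} (hn : n < H)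
    (hq : ∀ x a, R.qRun k ω n x a ∈ Set.Icc (0 : ℝ) n) (x : X) (a : A) :
    R.bellman k ω n x a ∈ Set.Icc (0 : ℝ) (n + 1) := by
  have hc := M.stageCost_mem (by omega : 1 ≤ H - n) (by omega) x a
  unfold bellman
  split_ifs with hlt
  · have hr := (M.risk_coherent (N := N) (by omega : 1 ≤ H - n) hlt x a).mem_Icc
      fun y => ciInf_mem_Icc (hq y)
    constructor <;> linarith [hc.1, hc.2, hr.1, hr.2]
  · have : (0 : ℝ) ≤ n := Nat.cast_nonneg n
    constructor <;> linarith [hc.1, hc.2]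

/-- Uniform control by `ε` of the estimation noise in episode `k`, over all functions of the
parametric form with coefficients at most `m / K`. -/
def NoiseControlled (k m : ℕ) (ε : ℝ) (ω : Ω) : Prop :=
  ∀ h, 1 ≤ h → h < H → ∀ (w : Fin d → ℝ) (G : Matrix (Fin d) (Fin d) ℝ),
    (∀ i, |w i| * K ≤ m) → (∀ i j, |G i j| * K ≤ m) → (∀ x a, qForm φ w G x a ≤ H) →
    √((∑ τ ∈ Finset.Ico 1 k, R.noise h τ ω (qForm φ w G) • R.feature h τ ω) ⬝ᵥ
        (ridge lam (fun τ => R.feature h τ ω) k)⁻¹ *ᵥ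
          ∑ τ ∈ Finset.Ico 1 k, R.noise h τ ω (qForm φ w G) • R.feature h τ ω) ≤ ε

variable {R} {B L ε b : ℝ} {m k : ℕ} {ω : Ω}

/-- The confidence bound: `ε` covers the noise evaluated at the data-dependent next-stage estimate,
and `2H√(Bd)` covers the ridge bias, using `lam ≤ B`. -/
theorem abs_wRun_sub_bellman_le (hM : M.IsMultipattern N φ)
    (hlam : 0 < lam) (hlamB : lam ≤ B) (hε : 0 ≤ ε) (hb : ε + 2 * H * √(B * d) ≤ b)
    (hctl : R.NoiseControlled k m ε ω) {n : ℕ} (hn : n < H)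
    (hq : ∀ x a, R.qRun k ω n x a ∈ Set.Icc (0 : ℝ) n)
    (hform : 0 < n → HasGridForm φ K m (R.qRun k ω n)) (x : X) (a : A) :
    |R.wRun k n ω ⬝ᵥ φ x a - R.bellman k ω n x a| ≤ b * R.bonus k (H - n) ω x a := by
  have hnH : (n : ℝ) ≤ H := by exact_mod_cast hn.le
  have hqH : ∀ x a, R.qRun k ω n x a ∈ Set.Icc (0 : ℝ) H := fun x a =>
    ⟨(hq x a).1, (hq x a).2.trans hnH⟩
  obtain ⟨w, hw, hlin⟩ := hM.exists_linear (by omega : 1 ≤ H - n) (by omega)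
    fun y => ciInf_mem_Icc (hqH y)
  -- For `n = 0` the stage is `H`, with no transition and no noise; this is why the parametric form
  -- is assumed only for `0 < n`.
  set ν : ℕ → ℝ := fun τ => if H - n < H then R.noise (H - n) τ ω (R.qRun k ω n) else 0 with hν
  have htar : ∀ τ, R.target k n τ ω = R.feature (H - n) τ ω ⬝ᵥ w + ν τ := by
    intro τ
    rw [feature, ← hlin]
    simp only [target, hν, noise]
    split_ifs <;> ring
  have hSle : √((∑ τ ∈ Finset.Ico 1 k, ν τ • R.feature (H - n) τ ω) ⬝ᵥ
      (ridge lam (fun τ => R.feature (H - n) τ ω) k)⁻¹ *ᵥ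
        ∑ τ ∈ Finset.Ico 1 k, ν τ • R.feature (H - n) τ ω) ≤ ε := by
    rcases Nat.eq_zero_or_pos n with h0 | h0
    · have : ∀ τ, ν τ = 0 := fun τ => by rw [hν]; simp [h0]
      simpa [this] using hε
    · obtain ⟨w', G', e1, e2, e3⟩ := hform h0
      have := hctl (H - n) (by omega) (by omega) w' G' e1 e2 fun x a => by
        rw [← e3]; exact (hqH x a).2
      rw [← e3] at this
      simpa only [hν, if_pos (by omega : H - n < H)] using this
  have hreg := abs_ridge_regression_error_le hlam (fun τ => R.feature (H - n) τ ω) k w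
    (fun τ _ _ => htar τ) (φ x a)
  rw [bellman, hlin]
  refine hreg.trans ?_
  unfold bonus
  gcongr
  refine le_trans (add_le_add hSle ?_) hb
  apply Real.sqrt_le_iff.mpr
  refine ⟨by positivity, ?_⟩
  have hB : 0 ≤ B := hlam.le.trans hlamB
  calc lam * (w ⬝ᵥ w) ≤ B * (2 * H * √(d : ℝ)) ^ 2 := by
        gcongr
        exact dotProduct_self_nonneg' w
    _ = (2 * H * √(B * d)) ^ 2 := by
        rw [mul_pow _ (√(d : ℝ)), mul_pow _ (√(B * d)), Real.sq_sqrt (Nat.cast_nonneg d),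
          Real.sq_sqrt (mul_nonneg hB (Nat.cast_nonneg d))]
        ring

/-- Optimism and accuracy of the backward pass of an episode with controlled noise. -/
theorem backward_pass (hR : R.UsesUnbiasedEstimator L) (hL : 1 ≤ L) (hM : M.IsMultipattern N φ)
    (hlam : 0 < lam) (hlamB : lam ≤ B) (hε : 0 ≤ ε) (hb : ε + 2 * H * √(B * d) ≤ b)
    (hbβ : b ≤ β) (hkK : k ≤ K) (hctl : R.NoiseControlled k m ε ω)
    (hm : K * (1 + L * H) / lam * K ≤ m) (hm' : β ^ 2 / lam * K ≤ m) {n : ℕ} (hn : n < H) :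
    (∀ x a, R.qRun k ω (n + 1) x a ≤ R.bellman k ω n x a) ∧
    (∀ x a, R.bellman k ω n x a - R.qRun k ω (n + 1) x a ≤ (β + b) * R.bonus k (H - n) ω x a) ∧
    (∀ x a, R.bellman k ω n x a ∈ Set.Icc (0 : ℝ) (n + 1)) ∧
    (HasGridForm φ K m (R.qRun k ω (n + 1))) ∧
    ∀ x, ⨅ a, R.qRun k ω (n + 1) x a ≤ M.optValueAux N n x := by
  have hβ : 0 ≤ β := by
    have : 0 ≤ 2 * (H : ℝ) * √(B * d) := by positivity
    linarith
  -- One regression stage, given the range and parametric form of the next-stage estimate. The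
  -- induction below only has to supply these two facts and propagate the comparison with the
  -- optimal value.
  have step : ∀ n, n < H → (∀ x a, R.qRun k ω n x a ∈ Set.Icc (0 : ℝ) n) →
      (0 < n → HasGridForm φ K m (R.qRun k ω n)) →
      (∀ x a, R.qRun k ω (n + 1) x a ≤ R.bellman k ω n x a) ∧
      (∀ x a, R.bellman k ω n x a - R.qRun k ω (n + 1) x a ≤
        (β + b) * R.bonus k (H - n) ω x a) ∧
      (∀ x a, R.bellman k ω n x a ∈ Set.Icc (0 : ℝ) (n + 1)) ∧
      (HasGridForm φ K m (R.qRun k ω (n + 1))) := by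
    intro n hn hq hform
    have herr := abs_wRun_sub_bellman_le hM hlam hlamB hε hb hctl hn hq hform
    have hbel := R.bellman_mem hn hq
    have hbon : ∀ x a, 0 ≤ R.bonus k (H - n) ω x a := fun x a => Real.sqrt_nonneg _
    refine ⟨fun x a => ?_, fun x a => ?_, hbel, R.wRun k n ω, _, fun i => ?_, fun i j => ?_,
      R.qRun_succ_eq_qForm hβ k ω n⟩
    · rw [qRun_succ]
      refine max_le ?_ (hbel x a).1
      have h1 := (abs_le.mp (herr x a)).2
      have h2 := mul_le_mul_of_nonneg_right hbβ (hbon x a)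
      linarith
    · have h1 := (abs_le.mp (herr x a)).1
      have h2 := le_max_left (R.wRun k n ω ⬝ᵥ φ x a - β * R.bonus k (H - n) ω x a) 0
      rw [qRun_succ]
      linarith
    · refine le_trans ?_ hm
      gcongr
      refine abs_ridge_weights_le hlam _ (fun τ => dotProduct_self_simplex_le (hM.simplex _ _))
        hkK (by positivity) (fun τ hτ hτk => ?_) i
      have hc := M.stageCost_mem (by omega : 1 ≤ H - n) (by omega) (R.state (H - n) τ ω)
        (R.action (H - n) τ ω)
      have hc' : |M.stageCost (H - n) (R.state (H - n) τ ω) (R.action (H - n) τ ω)| ≤ 1 := by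
        rw [abs_of_nonneg hc.1]; exact hc.2
      unfold target
      refine (abs_add_le _ _).trans (add_le_add hc' ?_)
      split_ifs with hlt
      · exact hR.abs_est_le hL hτ (by omega) (by omega) hlt ω fun x a =>
          ⟨(hq x a).1, (hq x a).2.trans (by exact_mod_cast hn.le)⟩
      · rw [abs_zero]; positivity
    · refine le_trans ?_ hm'
      gcongr
      rw [Matrix.smul_apply, smul_eq_mul, abs_mul, abs_of_nonneg (sq_nonneg β)]
      calc _ ≤ β ^ 2 * (1 / lam) := by
            gcongr
            exact abs_ridge_inv_apply_le hlam _ k i j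
        _ = _ := by ring
  induction n with
  | zero =>
    obtain ⟨e1, e2, e3, e4⟩ := step 0 hn (fun x a => by simp [qRun, qHatAux]) (by simp)
    refine ⟨e1, e2, e3, e4, fun x => ?_⟩
    refine (ciInf_le (Set.finite_range _).bddBelow (Classical.arbitrary A)).trans
      ((e1 x _).trans_eq ?_)
    simp [bellman, RiskMDP.stageCost, RiskMDP.optValueAux]
  | succ n ih =>
    obtain ⟨i1, -, i3, i4, i5⟩ := ih (by omega)
    -- The algorithm does not truncate from above: the upper bound on the estimate comes from
    -- optimism, being below a Bellman backup with values in `[0, n + 1]`.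
    obtain ⟨e1, e2, e3, e4⟩ := step (n + 1) hn
      (fun x a => ⟨R.qRun_nonneg k ω _ x a, by
        push_cast; exact (i1 x a).trans (i3 x a).2⟩) fun _ => i4
    refine ⟨e1, e2, e3, e4, fun x => ?_⟩
    refine ciInf_mono (Set.finite_range _).bddBelow fun a => (e1 x a).trans ?_
    have hlt : H - (n + 1) < H := by omega
    rw [bellman, if_pos hlt, M.stageCost_of_lt hlt]
    gcongr
    exact (M.risk_coherent (N := N) (by omega) hlt x a).monotone _ _ i5

/-- At the greedy action the gap splits into the one-step error and a difference of two risks at the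
next stage. Subadditivity and `miniBatch_le_pickMean` bound the latter by `N` times the mean
next-stage gap. -/
theorem policyValueAux_sub_le_gapBound (hR : R.UsesUnbiasedEstimator L) (hL : 1 ≤ L)
    (hM : M.IsMultipattern N φ)
    (hlam : 0 < lam) (hlamB : lam ≤ B) (hε : 0 ≤ ε) (hb : ε + 2 * H * √(B * d) ≤ b)
    (hbβ : b ≤ β) (hHβ : H ≤ β) (hk : 1 ≤ k) (hkK : k ≤ K) (hctl : R.NoiseControlled k m ε ω)
    (hm : K * (1 + L * H) / lam * K ≤ m) (hm' : β ^ 2 / lam * K ≤ m) {n : ℕ} (hn : n < H)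
    (x : X) :
    M.policyValueAux N (R.policy k ω) n x - ⨅ a, R.qRun k ω (n + 1) x a ≤
      R.gapBound k (β + b) ω n x := by
  have hb0 : 0 ≤ b := by
    have : 0 ≤ 2 * (H : ℝ) * √(B * d) := by positivity
    linarith
  have hpass : ∀ n, n < H → _ := fun n hn =>
    backward_pass hR hL hM hlam hlamB hε hb hbβ hkK hctl hm hm' (n := n) hn
  have hHbound : ∀ n, n < H → ∀ x,
      M.policyValueAux N (R.policy k ω) n x - ⨅ a, R.qRun k ω (n + 1) x a ≤ H := by
    intro n hn x
    have h1 := (M.policyValueAux_mem (N := N) (R.policy k ω) hn x).2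
    have h2 : 0 ≤ ⨅ a, R.qRun k ω (n + 1) x a :=
      le_ciInf fun a => R.qRun_nonneg k ω _ x a
    have h3 : (n : ℝ) + 1 ≤ H := by exact_mod_cast hn
    linarith
  -- When the bonus exceeds 1, the trivial bound `H ≤ β` on the backup replaces it.
  have hbon : ∀ n, n < H → ∀ x a, R.bellman k ω n x a - R.qRun k ω (n + 1) x a ≤
      (β + b) * min 1 (R.bonus k (H - n) ω x a) := by
    intro n hn x a
    obtain ⟨-, h2, h3, -, -⟩ := hpass n hn
    rcases min_cases 1 (R.bonus k (H - n) ω x a) with ⟨h, -⟩ | ⟨h, -⟩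
    · rw [h]
      have h4 := R.qRun_nonneg k ω (n + 1) x a
      have h5 : (n : ℝ) + 1 ≤ H := by exact_mod_cast hn
      linarith [(h3 x a).2]
    · rw [h]; exact h2 x a
  induction n generalizing x with
  | zero =>
    refine le_min (hHbound 0 hn x) ?_
    have h1 := hbon 0 hn x (R.policy k ω H x)
    rw [R.iInf_qRun_eq hk hkK hn]
    simpa [bellman, RiskMDP.stageCost, RiskMDP.policyValueAux] using h1
  | succ n ih =>
    refine le_min (hHbound (n + 1) hn x) ?_
    have h1 := hbon (n + 1) hn x (R.policy k ω (H - (n + 1)) x)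
    rw [R.iInf_qRun_eq hk hkK hn]
    have hlt : H - (n + 1) < H := by omega
    have h1H : 1 ≤ H - (n + 1) := by omega
    rw [bellman, if_pos hlt, M.stageCost_of_lt hlt] at h1
    set a := R.policy k ω (H - (n + 1)) x
    have hσ := M.risk_coherent (N := N) h1H hlt x a
    have h2 := hσ.sub_le (M.policyValueAux N (R.policy k ω) n)
      fun y => ⨅ a, R.qRun k ω (n + 1) y a
    have h3 : M.risk N (H - (n + 1)) x a (fun y => M.policyValueAux N (R.policy k ω) n y -
        ⨅ a, R.qRun k ω (n + 1) y a) ≤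
        N * pickMean N (M.kernel (H - (n + 1)) x a) (R.gapBound k (β + b) ω n) := by
      refine ((M.baseRisk_coherent _ h1H hlt).miniBatch_le_pickMean x _ fun y => ?_).trans ?_
      -- Nonnegativity of the next-stage gap, required for the comparison with the batch sum:
      -- estimate ≤ optimal value ≤ policy value.
      · have h4 := (hpass n (by omega)).2.2.2.2 y
        have h5 := (M.optValueAux_mem_and_le (N := N) (R.policy k ω) (by omega : n < H) y).2
        linarith
      · gcongr
        exact pickMean_mono _ fun y => ih (by omega) y
    have h4 : M.policyValueAux N (R.policy k ω) (n + 1) x =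
        M.cost (H - (n + 1)) x a +
          M.risk N (H - (n + 1)) x a (M.policyValueAux N (R.policy k ω) n) := rfl
    rw [h4]
    linarith

/-- Episode regret under controlled noise. -/
theorem episode_regret_le_gapBound (hR : R.UsesUnbiasedEstimator L) (hL : 1 ≤ L)
    (hM : M.IsMultipattern N φ) (hH : 1 ≤ H)
    (hlam : 0 < lam) (hlamB : lam ≤ B) (hε : 0 ≤ ε) (hb : ε + 2 * H * √(B * d) ≤ b)
    (hbβ : b ≤ β) (hHβ : H ≤ β) (hk : 1 ≤ k) (hkK : k ≤ K) (hctl : R.NoiseControlled k m ε ω)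
    (hm : K * (1 + L * H) / lam * K ≤ m) (hm' : β ^ 2 / lam * K ≤ m) (x : X) :
    M.policyValue N (R.policy k ω) 1 x - M.optValue N 1 x ≤
      R.gapBound k (β + b) ω (H - 1) x := by
  refine le_trans ?_ (policyValueAux_sub_le_gapBound hR hL hM hlam hlamB hε hb hbβ hHβ hk hkK
    hctl hm hm' (by omega : H - 1 < H) x)
  exact sub_le_sub_left ((backward_pass hR hL hM hlam hlamB hε hb hbβ hkK hctl hm hm'
    (by omega : H - 1 < H)).2.2.2.2 x) _

end QLearningRun

end RiskQ

end

section

open Matrix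

/-! ### Scalar martingale deviations as the one-dimensional self-normalized bound. -/

section Azuma

open MeasureTheory

variable {Ω : Type*} {mΩ : MeasurableSpace Ω} {μ : Measure Ω} [IsProbabilityMeasure μ]

theorem ridge_one_dim (n : ℕ) :
    ridge 1 (fun _ (_ : Fin 1) => (1 : ℝ)) (n + 1) = ((n : ℝ) + 1) • 1 := by
  ext i j
  rw [Subsingleton.elim i 0, Subsingleton.elim j 0]
  simp only [ridge, Matrix.add_apply, Matrix.sum_apply, vecMulVec_apply]
  simp

theorem one_dim_form (n : ℕ) (v : Fin 1 → ℝ) :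
    v ⬝ᵥ (ridge 1 (fun _ (_ : Fin 1) => (1 : ℝ)) (n + 1))⁻¹ *ᵥ v = v 0 ^ 2 / (n + 1) := by
  have hn : (0 : ℝ) < n + 1 := by positivity
  have hinv : (ridge 1 (fun _ (_ : Fin 1) => (1 : ℝ)) (n + 1))⁻¹ = ((n : ℝ) + 1)⁻¹ • 1 := by
    apply Matrix.inv_eq_right_inv
    rw [ridge_one_dim, smul_mul_smul_comm, mul_inv_cancel₀ hn.ne', one_mul, one_smul]
  rw [hinv, smul_mulVec, one_mulVec, dotProduct_smul, smul_eq_mul]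
  simp [dotProduct]
  field_simp

/-- A deviation bound for sums of bounded martingale differences. -/
theorem measure_sum_gt_le (m : ℕ → MeasurableSpace Ω) {n : ℕ} (hm : ∀ τ, m τ ≤ mΩ)
    (hmono : ∀ τ, 1 ≤ τ → τ ≤ n → m τ ≤ m (τ + 1)) (η : ℕ → Ω → ℝ)
    (hη : ∀ τ, 1 ≤ τ → τ ≤ n → Measurable[m (τ + 1)] (η τ))
    (hb : ∀ τ, 1 ≤ τ → τ ≤ n → ∀ ω, |η τ ω| ≤ 1)
    (hz : ∀ τ, 1 ≤ τ → τ ≤ n → μ[η τ | m τ] =ᵐ[μ] 0) {δ : ℝ} (hδ : 0 < δ) :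
    μ {ω | √((n + 1) * (Real.log (1 + n) + 2 * Real.log (1 / δ))) <
      ∑ τ ∈ Finset.Icc 1 n, η τ ω} ≤ ENNReal.ofReal δ := by
  -- With constant feature 1 and regularization 1 the Gram matrix is `n + 1`, so the form is the
  -- squared sum divided by `n + 1`.
  have hmain := measure_selfNormalized_gt_le (μ := μ) m (by omega : 1 ≤ n + 1) hm
    (fun τ e1 e2 => hmono τ e1 (by omega)) (fun _ _ (_ : Fin 1) => (1 : ℝ)) η
    (fun τ _ _ i => measurable_const) (fun τ e1 e2 => hη τ e1 (by omega))
    (fun τ e1 e2 => hb τ e1 (by omega)) (fun τ e1 e2 => hz τ e1 (by omega)) one_pos hδ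
  refine le_trans (measure_mono fun ω hω => ?_) hmain
  simp only [Set.mem_ofPred_eq] at hω ⊢
  have hn : (0 : ℝ) < n + 1 := by positivity
  have h1 := log_ridge_det_ratio_le one_pos (fun _ (_ : Fin 1) => (1 : ℝ))
    (by simp [dotProduct]) (by omega : 1 ≤ n + 1) le_rfl
  rw [one_dim_form]
  have hS : (∑ τ ∈ Finset.Ico 1 (n + 1), η τ ω • fun _ : Fin 1 => (1 : ℝ)) 0 =
      ∑ τ ∈ Finset.Icc 1 n, η τ ω := by
    rw [Finset.sum_apply, show Finset.Icc 1 n = Finset.Ico 1 (n + 1) from rfl]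
    simp
  rw [hS, lt_div_iff₀ hn, mul_comm]
  refine lt_of_le_of_lt ?_ (Real.lt_sq_of_sqrt_lt hω)
  refine mul_le_mul_of_nonneg_left (add_le_add_left ?_ _) hn.le
  simpa only [Nat.cast_one, one_mul, div_one] using h1

end Azuma

namespace RiskQ

open MeasureTheory

/-! ### Summing the gap bounds over episodes. -/

namespace QLearningRun

variable {X A : Type*} [Fintype X] {H d N : ℕ} [NeZero N]
  {M : RiskMDP X A H} {φ : X → A → Fin d → ℝ} {K : ℕ} {lam β : ℝ} {Ω : Type*}
  [mΩ : MeasurableSpace Ω] {μ : Measure Ω} (R : QLearningRun M N φ K lam β μ)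

/-- The deviation of the gap bound at the next state from its conditional expectation, at stage
`H - (n + 1)` of episode `k`. -/
noncomputable def gapNoise (C : ℝ) (n k : ℕ) (ω : Ω) : ℝ :=
  pickMean N (M.kernel (H - (n + 1)) (R.state (H - (n + 1)) k ω) (R.action (H - (n + 1)) k ω))
    (R.gapBound k C ω n) - R.gapBound k C ω n (R.state (H - (n + 1) + 1) k ω)

/-- The total gap bound, `n` transitions before the end. -/
theorem sum_gapBound_le (hφ : ∀ x a, φ x a ∈ stdSimplex ℝ (Fin d)) (hlam : 0 < lam) {C Z : ℝ}
    (hC : 0 ≤ C) (hZ : 0 ≤ Z) {ω : Ω}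
    (hdev : ∀ n, n + 1 < H → ∑ k ∈ Finset.Icc 1 K, R.gapNoise C n k ω ≤ Z) {n : ℕ} (hn : n < H) :
    ∑ k ∈ Finset.Icc 1 K, R.gapBound k C ω n (R.state (H - n) k ω) ≤
      (n + 1) * (N : ℝ) ^ n *
        (C * √(K * (d * Real.log (1 + K / lam) / Real.log 2)) + Z) := by
  set E := C * √(K * (d * Real.log (1 + K / lam) / Real.log 2)) with hE
  have hE0 : 0 ≤ E := by positivity
  have hN : (1 : ℝ) ≤ N := by exact_mod_cast NeZero.one_le
  have hpot : ∀ h, ∑ k ∈ Finset.Icc 1 K, C * min 1 (R.bonus k h ω (R.state h k ω)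
      (R.action h k ω)) ≤ E := by
    intro h
    rw [← Finset.mul_sum]
    exact mul_le_mul_of_nonneg_left (sum_min_one_sqrt_ridge_inv_form_le hlam
      (fun τ => R.feature h τ ω) (fun τ => dotProduct_self_simplex_le (hφ _ _)) K) hC
  induction n with
  | zero =>
    have : ∑ k ∈ Finset.Icc 1 K, R.gapBound k C ω 0 (R.state (H - 0) k ω) ≤ E :=
      (Finset.sum_le_sum fun k _ => min_le_right _ _).trans (hpot H)
    simp only [Nat.cast_zero, zero_add, pow_zero, one_mul]
    linarith
  | succ n ih =>
    -- The conditional mean is rewritten as the realized next-state gap plus `gapNoise`, and the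
    -- bonuses are summed by the potential bound.
    have hrec : ∑ k ∈ Finset.Icc 1 K, R.gapBound k C ω (n + 1) (R.state (H - (n + 1)) k ω) ≤
        E + N * (∑ k ∈ Finset.Icc 1 K, R.gapNoise C n k ω +
          ∑ k ∈ Finset.Icc 1 K, R.gapBound k C ω n (R.state (H - n) k ω)) := by
      rw [← Finset.sum_add_distrib, Finset.mul_sum]
      refine le_trans ?_ (add_le_add_left (hpot (H - (n + 1))) _)
      rw [← Finset.sum_add_distrib]
      refine Finset.sum_le_sum fun k _ => (min_le_right _ _).trans_eq ?_
      rw [gapNoise, show H - (n + 1) + 1 = H - n by omega, sub_add_cancel]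
      rfl
    have h1 := hdev n hn
    have h2 := ih (by omega)
    have hNn : (1 : ℝ) ≤ (N : ℝ) ^ (n + 1) := one_le_pow₀ hN
    have hNn' : (N : ℝ) ≤ (N : ℝ) ^ (n + 1) := by
      rw [pow_succ]
      exact le_mul_of_one_le_left (by linarith) (one_le_pow₀ hN)
    calc _ ≤ E + N * (Z + (n + 1) * (N : ℝ) ^ n * (E + Z)) := by
          refine hrec.trans ?_
          gcongr
      _ = E + N * Z + (n + 1) * (N : ℝ) ^ (n + 1) * (E + Z) := by ring
      _ ≤ (N : ℝ) ^ (n + 1) * E + (N : ℝ) ^ (n + 1) * Z +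
          (n + 1) * (N : ℝ) ^ (n + 1) * (E + Z) := by
          gcongr
          exact le_mul_of_one_le_left hE0 hNn
      _ = _ := by push_cast; ring

variable [Fintype A]

theorem measurable_bonus {k h : ℕ} (hk : 1 ≤ k) (hkK : k ≤ K) (h1 : 1 ≤ h) (hH : h ≤ H) (x : X) :
    Measurable[R.history k 1] fun ω => R.bonus k h ω x (R.policy k ω h x) := by
  refine measurable_substitute (R.policy_measurable k h hk hkK h1 hH x)
    (F := fun a ω => R.bonus k h ω x a) fun a => ?_
  refine Real.continuous_sqrt.measurable.comp (measurable_ridge_inv_form lam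
    (fun τ e1 e2 i => ?_) (fun _ => measurable_const) fun _ => measurable_const)
  refine (R.measurable_feature e1 (by omega) h1 hH i).mono ?_ le_rfl
  exact (R.history_succ_episode e1 (by omega) h1 hH le_rfl (by omega)).trans
    (R.history_episode_mono (by omega) e2 hkK le_rfl (by omega))

/-- Policy and Gram matrices of an episode are fixed when it starts, so the gap bound is a function
known before any of its transitions. This makes `gapNoise` a martingale difference. -/
theorem measurable_gapBound (C : ℝ) {k n : ℕ} (hk : 1 ≤ k) (hkK : k ≤ K) (hn : n < H) (x : X) :
    Measurable[R.history k 1] fun ω => R.gapBound k C ω n x := by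
  induction n generalizing x with
  | zero =>
    exact measurable_const.min ((measurable_const.min
      (R.measurable_bonus hk hkK (by omega) le_rfl x)).const_mul C)
  | succ n ih =>
    refine measurable_const.min (((measurable_const.min
      (R.measurable_bonus hk hkK (by omega) (by omega) x)).const_mul C).add
        (Measurable.const_mul ?_ _))
    refine measurable_substitute (R.policy_measurable k (H - (n + 1)) hk hkK (by omega)
      (by omega) x) (F := fun a ω => pickMean N (M.kernel (H - (n + 1)) x a)
        (R.gapBound k C ω n)) fun a => ?_
    exact Finset.measurable_sum _ fun y _ => Finset.measurable_sum _ fun j _ =>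
      (ih (by omega) _).const_mul _

variable [IsProbabilityMeasure μ]

theorem measure_sum_gapNoise_gt_le {C : ℝ} (hC : 0 ≤ C) {n : ℕ} (hn : n + 1 < H) {δ : ℝ}
    (hδ : 0 < δ) :
    μ {ω | H * √((K + 1) * (Real.log (1 + K) + 2 * Real.log (1 / δ))) <
      ∑ k ∈ Finset.Icc 1 K, R.gapNoise C n k ω} ≤ ENNReal.ofReal δ := by
  classical
  have hH : (0 : ℝ) < H := by exact_mod_cast (by omega : 0 < H)
  set h := H - (n + 1) with hh
  have h1 : 1 ≤ h := by omega
  have hlt : h < H := by omega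
  -- After episode `K` the run gives no inclusion of histories, yet the last difference must be
  -- measurable at time `K + 1`; the full σ-algebra serves there.
  set m : ℕ → MeasurableSpace Ω := fun τ => if τ ≤ K then R.history τ h else mΩ with hm
  have hmle : ∀ τ, m τ ≤ mΩ := by
    intro τ
    simp only [hm]
    split_ifs
    · exact R.history_le τ h
    · exact le_rfl
  have hmeq : ∀ τ, τ ≤ K → m τ = R.history τ h := fun τ hτ => if_pos hτ
  have hlast : ∀ τ, 1 ≤ τ → τ ≤ K → R.history τ (h + 1) ≤ m (τ + 1) := by
    intro τ e1 e2
    simp only [hm]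
    split_ifs with hc
    · exact R.history_succ_episode e1 (by omega) (by omega) (by omega) h1 hlt.le
    · exact R.history_le τ (h + 1)
  have hgap : ∀ τ, 1 ≤ τ → τ ≤ K → ∀ x,
      Measurable[R.history τ h] fun ω => R.gapBound τ C ω n x := fun τ e1 e2 x =>
    (R.measurable_gapBound C e1 e2 (by omega) x).mono
      (R.history_stage_mono e1 e2 le_rfl h1 hlt.le) le_rfl
  have hmean : ∀ τ, 1 ≤ τ → τ ≤ K → Measurable[R.history τ h] fun ω =>
      pickMean N (M.kernel h (R.state h τ ω) (R.action h τ ω)) (R.gapBound τ C ω n) := by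
    intro τ e1 e2
    refine measurable_substitute (R.state_measurable e1 e2 h1 hlt.le)
      (F := fun x ω => pickMean N (M.kernel h x (R.action h τ ω)) (R.gapBound τ C ω n)) fun x => ?_
    refine measurable_substitute (R.action_measurable e1 e2 h1 hlt.le)
      (F := fun a ω => pickMean N (M.kernel h x a) (R.gapBound τ C ω n)) fun a => ?_
    exact Finset.measurable_sum _ fun y _ => Finset.measurable_sum _ fun j _ =>
      (hgap τ e1 e2 _).const_mul _
  have hnext : ∀ τ, 1 ≤ τ → τ ≤ K → Measurable[R.history τ (h + 1)] fun ω =>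
      R.gapBound τ C ω n (R.state (h + 1) τ ω) := by
    intro τ e1 e2
    exact measurable_substitute (R.state_measurable e1 e2 (by omega) (by omega))
      (F := fun x ω => R.gapBound τ C ω n x) fun x =>
        (hgap τ e1 e2 x).mono (R.history_stage τ h e1 e2 h1 hlt) le_rfl
  have hmem := R.gapBound_mem hC
  have hbnd : ∀ τ ω, |R.gapNoise C n τ ω| ≤ H := by
    intro τ ω
    have e1 := pickMean_mem_Icc (N := N) (M.kernel h (R.state h τ ω) (R.action h τ ω))
      (hmem τ ω n)
    have e2 := hmem τ ω n (R.state (h + 1) τ ω)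
    unfold gapNoise
    rw [abs_le]
    constructor <;> linarith [e1.1, e1.2, e2.1, e2.2]
  have hzero : ∀ τ, 1 ≤ τ → τ ≤ K → μ[R.gapNoise C n τ | R.history τ h] =ᵐ[μ] 0 := by
    intro τ e1 e2
    have hle := R.history_le τ h
    have i1 : Integrable (fun ω => pickMean N (M.kernel h (R.state h τ ω) (R.action h τ ω))
        (R.gapBound τ C ω n)) μ := by
      refine Integrable.of_bound ((hmean τ e1 e2).mono hle le_rfl).aestronglyMeasurable H
        (Filter.Eventually.of_forall fun ω => ?_)
      have e := pickMean_mem_Icc (N := N) (M.kernel h (R.state h τ ω) (R.action h τ ω))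
        (hmem τ ω n)
      rw [Real.norm_of_nonneg e.1]; exact e.2
    have i2 : Integrable (fun ω => R.gapBound τ C ω n (R.state (h + 1) τ ω)) μ := by
      refine Integrable.of_bound ((hnext τ e1 e2).mono (R.history_le _ _)
        le_rfl).aestronglyMeasurable H (Filter.Eventually.of_forall fun ω => ?_)
      have e := hmem τ ω n (R.state (h + 1) τ ω)
      rw [Real.norm_of_nonneg e.1]; exact e.2
    have h3 := condExp_of_stronglyMeasurable (μ := μ) hle (hmean τ e1 e2).stronglyMeasurable i1
    have h4 := R.condExp_state_next e1 e2 h1 hlt (W := fun ω => R.gapBound τ C ω n)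
      (hgap τ e1 e2) (C := H) fun ω x => by
        rw [abs_of_nonneg (hmem τ ω n x).1]; exact (hmem τ ω n x).2
    have e0 : R.gapNoise C n τ = (fun ω => pickMean N (M.kernel h (R.state h τ ω)
        (R.action h τ ω)) (R.gapBound τ C ω n)) - fun ω =>
          R.gapBound τ C ω n (R.state (h + 1) τ ω) := rfl
    filter_upwards [condExp_sub i1 i2 (R.history τ h), h4] with ω a1 a2
    rw [e0, a1, Pi.sub_apply, a2, h3]
    simp
  have hmain := measure_sum_gt_le (μ := μ) m (n := K) hmle
    (fun τ e1 e2 => by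
      rw [hmeq τ e2]
      exact (R.history_stage τ h e1 e2 h1 hlt).trans (hlast τ e1 e2))
    (fun τ ω => (H : ℝ)⁻¹ * R.gapNoise C n τ ω)
    (fun τ e1 e2 => (Measurable.const_mul ((((hmean τ e1 e2).mono
      (R.history_stage τ h e1 e2 h1 hlt) le_rfl).sub (hnext τ e1 e2))) _).mono
        (hlast τ e1 e2) le_rfl)
    (fun τ e1 e2 ω => by
      rw [abs_mul, abs_of_pos (inv_pos.mpr hH), inv_mul_le_iff₀ hH, mul_one]
      exact hbnd τ ω)
    (fun τ e1 e2 => by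
      rw [hmeq τ e2]
      have hs := condExp_smul (μ := μ) (H : ℝ)⁻¹ (R.gapNoise C n τ) (R.history τ h)
      filter_upwards [hzero τ e1 e2, hs] with ω e3 e4
      have e5 : (fun ω => (H : ℝ)⁻¹ * R.gapNoise C n τ ω) = (H : ℝ)⁻¹ • R.gapNoise C n τ := rfl
      rw [e5, e4, Pi.smul_apply, e3]
      simp) hδ
  refine le_trans (measure_mono fun ω hω => ?_) hmain
  simp only [Set.mem_ofPred_eq] at hω ⊢
  rw [← Finset.mul_sum, lt_inv_mul_iff₀ hH]
  exact hω

variable [Nonempty A] {R}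

/-- High-probability regret bound, with all quantities explicit. -/
theorem measure_regret_gt_le {B L b p : ℝ} (hR : R.UsesUnbiasedEstimator L) (hL : 1 ≤ L)
    (hM : M.IsMultipattern N φ) (hH : 1 ≤ H) (hK : 1 ≤ K) (hlam : 0 < lam) (hlamB : lam ≤ B)
    (hp : 0 < p) {m : ℕ}
    (hb : √((2 * L * H) ^ 2 * (d * Real.log (1 + K / lam) +
      2 * Real.log (1 / (p / (2 * H * K * (2 * m + 1) ^ (d + d * d)))))) + 4 * L +
        2 * H * √(B * d) ≤ b)
    (hbβ : b ≤ β) (hHβ : H ≤ β)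
    (hm : K * (1 + L * H) / lam * K ≤ m) (hm' : β ^ 2 / lam * K ≤ m) :
    μ {ω | H * (N : ℝ) ^ H * ((β + b) * √(K * (d * Real.log (1 + K / lam) / Real.log 2)) +
        H * √((K + 1) * (Real.log (1 + K) + 2 * Real.log (1 / (p / (2 * H)))))) < R.regret ω} ≤
      ENNReal.ofReal p := by
  classical
  -- Half of `p` is shared by all stages, episodes and grid points; `δ'` distributes the other half
  -- over the transition stages.
  set δ : ℝ := p / (2 * H * K * (2 * m + 1) ^ (d + d * d)) with hδ
  set δ' : ℝ := p / (2 * H) with hδ'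
  set c : ℝ := (2 * L * H) ^ 2 * (d * Real.log (1 + K / lam) + 2 * Real.log (1 / δ)) with hc
  set Z : ℝ := H * √((K + 1) * (Real.log (1 + K) + 2 * Real.log (1 / δ'))) with hZ
  have hH0 : (0 : ℝ) < H := by exact_mod_cast hH
  have hK0 : (0 : ℝ) < K := by exact_mod_cast hK
  have hδ0 : 0 < δ := by positivity
  have hδ0' : 0 < δ' := by positivity
  have hβ0 : 0 ≤ β := hH0.le.trans hHβ
  have hb0 : 0 ≤ b := le_trans (by positivity) hb
  set C := β + b with hCdef
  have hC : 0 ≤ C := by positivity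
  set badNoise : ℕ → ℕ → GridIndex d m → Set Ω := fun h k q =>
    {ω | (2 * L * H) ^ 2 * (Real.log ((ridge lam (fun τ => R.feature h τ ω) k).det / lam ^ d) +
          2 * Real.log (1 / δ)) <
        (∑ τ ∈ Finset.Ico 1 k, R.noise h τ ω (gridQ φ H K q) • R.feature h τ ω) ⬝ᵥ
          (ridge lam (fun τ => R.feature h τ ω) k)⁻¹ *ᵥ
            ∑ τ ∈ Finset.Ico 1 k, R.noise h τ ω (gridQ φ H K q) • R.feature h τ ω} with hbadN
  set badGap : ℕ → Set Ω := fun n => {ω | Z < ∑ k ∈ Finset.Icc 1 K, R.gapNoise C n k ω} with hbadG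
  set bad : Set Ω := (⋃ h ∈ Finset.Ico 1 H, ⋃ k ∈ Finset.Icc 1 K, ⋃ q ∈ Finset.univ,
    badNoise h k q) ∪ ⋃ n ∈ Finset.range (H - 1), badGap n with hbad
  have hmeas : μ bad ≤ ENNReal.ofReal p := by
    have e1 : μ (⋃ h ∈ Finset.Ico 1 H, ⋃ k ∈ Finset.Icc 1 K, ⋃ q ∈ Finset.univ,
        badNoise h k q) ≤ ∑ h ∈ Finset.Ico 1 H, ∑ k ∈ Finset.Icc 1 K,
          ∑ _q : GridIndex d m, ENNReal.ofReal δ := by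
      refine (measure_biUnion_finset_le _ _).trans (Finset.sum_le_sum fun h hh => ?_)
      refine (measure_biUnion_finset_le _ _).trans (Finset.sum_le_sum fun k hk => ?_)
      refine (measure_biUnion_finset_le _ _).trans (Finset.sum_le_sum fun q _ => ?_)
      rw [Finset.mem_Ico] at hh
      rw [Finset.mem_Icc] at hk
      exact hR.measure_noise_gt_le hL hk.1 hk.2 hh.1 hh.2 hlam hδ0 (gridQ_mem φ H K q)
    have e2 : μ (⋃ n ∈ Finset.range (H - 1), badGap n) ≤
        ∑ n ∈ Finset.range (H - 1), ENNReal.ofReal δ' := by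
      refine (measure_biUnion_finset_le _ _).trans (Finset.sum_le_sum fun n hn => ?_)
      rw [Finset.mem_range] at hn
      exact R.measure_sum_gapNoise_gt_le hC (by omega) hδ0'
    refine (measure_union_le _ _).trans ((add_le_add e1 e2).trans ?_)
    have hcard : Fintype.card (GridIndex d m) = (2 * m + 1) ^ (d + d * d) := by simp
    simp only [Finset.sum_const, Nat.card_Ico, Nat.card_Icc, Finset.card_univ, hcard,
      Finset.card_range, Nat.add_sub_cancel, smul_smul]
    rw [← ENNReal.ofReal_nsmul, ← ENNReal.ofReal_nsmul,
      ← ENNReal.ofReal_add (by positivity) (by positivity)]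
    apply ENNReal.ofReal_le_ofReal
    simp only [nsmul_eq_mul]
    push_cast [Nat.cast_sub hH]
    have e3 : ((H : ℝ) - 1) * (K * (2 * m + 1) ^ (d + d * d)) * δ ≤ p / 2 := by
      calc _ ≤ (H : ℝ) * (K * (2 * m + 1) ^ (d + d * d)) * δ := by gcongr; linarith
        _ = p / 2 := by rw [hδ]; field_simp
    have e4 : ((H : ℝ) - 1) * δ' ≤ p / 2 := by
      calc _ ≤ (H : ℝ) * δ' := by gcongr; linarith
        _ = p / 2 := by rw [hδ']; field_simp
    simp only [mul_assoc] at e3 ⊢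
    linarith
  refine le_trans (measure_mono fun ω hω => ?_) hmeas
  by_contra hgood
  simp only [Set.mem_ofPred_eq] at hω
  refine absurd hω (not_lt.mpr ?_)
  simp only [hbad, Set.mem_union, Set.mem_iUnion, not_or, not_exists, Finset.mem_Ico,
    Finset.mem_Icc, Finset.mem_univ, Finset.mem_range] at hgood
  obtain ⟨hg1, hg2⟩ := hgood
  have hctl : ∀ k, 1 ≤ k → k ≤ K → R.NoiseControlled k m (√c + 4 * L) ω := by
    intro k hk hkK h h1 hlt w G hw hG hQ
    refine hR.sqrt_noise_form_le hL hM.simplex hk hkK h1 hlt hlam (fun q => ?_) hw hG hQ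
    have := hg1 h ⟨h1, hlt⟩ k ⟨hk, hkK⟩ q trivial
    simp only [hbadN, Set.mem_ofPred_eq, not_lt] at this
    refine this.trans ?_
    rw [hc]
    gcongr
    exact log_ridge_det_ratio_le hlam _ (fun τ => dotProduct_self_simplex_le (hM.simplex _ _)) hk
      (by omega)
  have hdev : ∀ n, n + 1 < H → ∑ k ∈ Finset.Icc 1 K, R.gapNoise C n k ω ≤ Z := by
    intro n hn
    have := hg2 n (by omega)
    simpa only [hbadG, Set.mem_ofPred_eq, not_lt] using this
  have hZ0 : 0 ≤ Z := by positivity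
  have hsum := R.sum_gapBound_le hM.simplex hlam hC hZ0 hdev (by omega : H - 1 < H)
  rw [show H - (H - 1) = 1 by omega] at hsum
  calc R.regret ω ≤ ∑ k ∈ Finset.Icc 1 K, R.gapBound k C ω (H - 1) (R.state 1 k ω) := by
        refine Finset.sum_le_sum fun k hk => ?_
        rw [Finset.mem_Icc] at hk
        exact episode_regret_le_gapBound hR hL hM hH hlam hlamB (by positivity) hb hbβ hHβ hk.1 hk.2
          (hctl k hk.1 hk.2) hm hm' _
    _ ≤ _ := hsum
    _ ≤ _ := by
        have hN : (1 : ℝ) ≤ N := by exact_mod_cast NeZero.one_le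
        have e1 : ((H - 1 : ℕ) : ℝ) + 1 = H := by
          rw [Nat.cast_sub hH]; simp
        rw [e1]
        gcongr ?_ * ?_ * _
        exact pow_le_pow_right₀ hN (Nat.sub_le H 1)

end QLearningRun

end RiskQ

end

/-! ### Constants. -/

namespace RiskQ

/-- The ratio of the width of the confidence sets to `d H √Γ`. -/
noncomputable def widthConst (B L c : ℝ) : ℝ :=
  2 * L * √(20 + 5 * B + 8 * Real.log (2 * L + 2 * c ^ 2 + 3)) + 8 * L + 4 * B

/-- The width grows only like the square root of a logarithm of `c`. Bounding it by a multiple of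
`√c` suffices: with `c = t²` the left side is at most `(7F + 20B) t`, and `t` is chosen equal to `7F
+ 20B`. -/
theorem exists_const_dominating_width {B L : ℝ} (hB : 1 ≤ B) (hL : 1 ≤ L) :
    ∃ c : ℝ, 2 ≤ c ∧ 7 * widthConst B L c + 20 * B ≤ c := by
  set D := 5 * B + 16 * L + 76 with hD
  set F := 2 * L * D + 8 * L + 4 * B with hF
  have hLD : 0 ≤ L * D := by positivity
  set t := 7 * F + 20 * B with ht
  have ht2 : 2 ≤ t := by linarith
  refine ⟨t ^ 2, by nlinarith, ?_⟩
  have hc1 : (1 : ℝ) ≤ t ^ 2 := by nlinarith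
  set c := t ^ 2 with hc
  have hlog : Real.log (2 * L + 2 * c ^ 2 + 3) ≤ 2 * L + 5 + 2 * c := by
    have h1 : 2 * L + 2 * c ^ 2 + 3 ≤ (2 * L + 5) * c ^ 2 := by nlinarith
    have h2 := Real.log_le_log (by positivity) h1
    rw [Real.log_mul (by positivity) (by positivity), Real.log_pow] at h2
    have h3 := Real.log_le_self (show 0 ≤ 2 * L + 5 by positivity)
    have h4 := Real.log_le_self (show 0 ≤ c by positivity)
    push_cast at h2
    linarith
  have hD1 : 1 ≤ D := by linarith
  have hsqrt : √(20 + 5 * B + 8 * Real.log (2 * L + 2 * c ^ 2 + 3)) ≤ D * t := by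
    apply Real.sqrt_le_iff.mpr
    refine ⟨by positivity, ?_⟩
    calc _ ≤ D * c := by
          have : (20 + 5 * B + 16 * L + 40) * 1 ≤ (20 + 5 * B + 16 * L + 40) * c := by gcongr
          linarith
      _ ≤ D ^ 2 * c := by gcongr; nlinarith
      _ = (D * t) ^ 2 := by rw [hc]; ring
  have hw : widthConst B L c ≤ F * t := by
    unfold widthConst
    have h1 : 2 * L * √(20 + 5 * B + 8 * Real.log (2 * L + 2 * c ^ 2 + 3)) ≤ 2 * L * (D * t) := by
      gcongr
    have h2 : (8 * L + 4 * B) * 1 ≤ (8 * L + 4 * B) * t := by gcongr; linarith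
    linarith
  have h3 : 20 * B * 1 ≤ 20 * B * t := by gcongr; linarith
  calc _ ≤ 7 * (F * t) + 20 * B * t := by linarith
    _ = c := by rw [hc, ht]; ring

section Constants

variable {B L c p lam Γ : ℝ} {d K H : ℕ}

theorem log_two_le_gamma (hd : 1 ≤ d) (hK : 1 ≤ K) (hH : 1 ≤ H) (hp : 0 < p) (hp1 : p < 1)
    (hΓ : Γ = Real.log (2 * d * K * H / p)) : Real.log 2 ≤ Γ := by
  have hd' : (1 : ℝ) ≤ d := by exact_mod_cast hd
  have hK' : (1 : ℝ) ≤ K := by exact_mod_cast hK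
  have hH' : (1 : ℝ) ≤ H := by exact_mod_cast hH
  rw [hΓ]
  apply Real.log_le_log two_pos
  rw [le_div_iff₀ hp]
  have h1 : (1 : ℝ) ≤ d * K * H := one_le_mul_of_one_le_of_one_le
    (one_le_mul_of_one_le_of_one_le hd' hK') hH'
  nlinarith

theorem log_one_add_div_le (hB : 1 ≤ B) (hd : 1 ≤ d) (hK : 1 ≤ K) (hH : 1 ≤ H) (hp : 0 < p)
    (hp1 : p < 1) (hΓ : Γ = Real.log (2 * d * K * H / p)) (hlam : 0 < lam)
    (hlog : Real.log (1 / lam) ≤ B * Γ) : Real.log (1 + K / lam) ≤ (2 + B) * Γ := by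
  have hd' : (1 : ℝ) ≤ d := by exact_mod_cast hd
  have hK' : (1 : ℝ) ≤ K := by exact_mod_cast hK
  have hH' : (1 : ℝ) ≤ H := by exact_mod_cast hH
  have hΓ2 := log_two_le_gamma hd hK hH hp hp1 hΓ
  have hΓ0 : 0 < Γ := (Real.log_pos one_lt_two).trans_le hΓ2
  have hinv : 1 / lam ≤ Real.exp (B * Γ) := (Real.log_le_iff_le_exp (by positivity)).mp hlog
  have hexp : Real.exp Γ = 2 * d * K * H / p := by rw [hΓ, Real.exp_log (by positivity)]
  have hKz : (K : ℝ) ≤ Real.exp Γ := by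
    rw [hexp, le_div_iff₀ hp]
    have h1 : (1 : ℝ) ≤ d * H := one_le_mul_of_one_le_of_one_le hd' hH'
    nlinarith
  have h1 : 1 + K / lam ≤ Real.exp (Real.log 2 + Γ + B * Γ) := by
    rw [Real.exp_add, Real.exp_add, Real.exp_log two_pos]
    have h2 : (K : ℝ) / lam ≤ Real.exp Γ * Real.exp (B * Γ) := by
      rw [div_eq_mul_one_div]; gcongr
    have h3 : (1 : ℝ) ≤ Real.exp Γ * Real.exp (B * Γ) := by
      rw [← Real.exp_add]; exact Real.one_le_exp (by positivity)
    linarith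
  rw [← Real.log_le_iff_le_exp (by positivity)] at h1
  linarith

/-- With `z = exp Γ`, each of `K`, `dH`, `2KH` and `Γ` is at most `z`, and `1/lam ≤ exp(BΓ)`. The
grid size is therefore at most a constant times `z⁴ exp(BΓ)`. -/
theorem log_grid_le (hB : 1 ≤ B) (hL : 1 ≤ L) (hd : 1 ≤ d) (hK : 1 ≤ K)
    (hH : 1 ≤ H) (hp : 0 < p) (hp1 : p < 1) (hΓ : Γ = Real.log (2 * d * K * H / p))
    (hlam : 0 < lam) (hlog : Real.log (1 / lam) ≤ B * Γ) {m : ℕ}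
    (hm : (m : ℝ) ≤ (K * (1 + L * H) + (c * d * H * √Γ) ^ 2) / lam * K + 1) :
    Real.log (2 * m + 1) ≤ Real.log (2 * L + 2 * c ^ 2 + 3) + (4 + B) * Γ := by
  have hd' : (1 : ℝ) ≤ d := by exact_mod_cast hd
  have hK' : (1 : ℝ) ≤ K := by exact_mod_cast hK
  have hH' : (1 : ℝ) ≤ H := by exact_mod_cast hH
  have hΓ2 := log_two_le_gamma hd hK hH hp hp1 hΓ
  have hΓ0 : 0 < Γ := (Real.log_pos one_lt_two).trans_le hΓ2
  have hinv : 1 / lam ≤ Real.exp (B * Γ) := (Real.log_le_iff_le_exp (by positivity)).mp hlog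
  have hexp : Real.exp Γ = 2 * d * K * H / p := by rw [hΓ, Real.exp_log (by positivity)]
  set z := Real.exp Γ with hz
  set E := Real.exp (B * Γ) with hE
  have hz1 : 1 ≤ z := Real.one_le_exp hΓ0.le
  have hE1 : 1 ≤ E := Real.one_le_exp (by positivity)
  have hprod : 2 * (d * K * H : ℝ) ≤ z := by
    rw [hexp, le_div_iff₀ hp]
    have : (0 : ℝ) ≤ d * K * H := by positivity
    nlinarith
  have hKH : 2 * (K * H : ℝ) ≤ z := by
    refine le_trans ?_ hprod
    have : (0 : ℝ) ≤ K * H := by positivity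
    nlinarith
  have hdH : d * H ≤ z := by
    refine le_trans ?_ hprod
    have : (0 : ℝ) ≤ d * H := by positivity
    nlinarith
  have hKz : (K : ℝ) ≤ z := by nlinarith
  have hΓz : Γ ≤ z := by linarith [Real.add_one_le_exp Γ]
  have h1 : (K : ℝ) * (1 + L * H) ≤ L * z := by
    calc (K : ℝ) * (1 + L * H) ≤ K * (L * H + L * H) := by gcongr; nlinarith
      _ = L * (2 * (K * H)) := by ring
      _ ≤ L * z := by gcongr
  have h2 : (c * d * H * √Γ) ^ 2 ≤ c ^ 2 * z ^ 3 := by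
    calc (c * d * H * √Γ) ^ 2 = c ^ 2 * ((d * H) ^ 2 * Γ) := by
          rw [mul_pow, Real.sq_sqrt hΓ0.le]; ring
      _ ≤ c ^ 2 * (z ^ 2 * z) := by gcongr
      _ = _ := by ring
  have h3 : 2 * (m : ℝ) + 1 ≤ (2 * L + 2 * c ^ 2 + 3) * (z ^ 4 * E) := by
    have hzE : 1 ≤ z ^ 4 * E := one_le_mul_of_one_le_of_one_le (one_le_pow₀ hz1) hE1
    have hz24 : z ^ 2 ≤ z ^ 4 := pow_le_pow_right₀ hz1 (by norm_num)
    calc 2 * (m : ℝ) + 1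
        ≤ 2 * ((K * (1 + L * H) + (c * d * H * √Γ) ^ 2) * K * (1 / lam)) + 3 := by
          rw [div_mul_eq_mul_div, div_eq_mul_one_div] at hm
          linarith
      _ ≤ 2 * ((L * z + c ^ 2 * z ^ 3) * z * E) + 3 := by gcongr
      _ = 2 * (L * z ^ 2 + c ^ 2 * z ^ 4) * E + 3 := by ring
      _ ≤ 2 * (L * z ^ 4 + c ^ 2 * z ^ 4) * E + 3 * (z ^ 4 * E) := by
          gcongr
          linarith
      _ = _ := by ring
  have h4 := Real.log_le_log (by positivity) h3
  rw [Real.log_mul (by positivity) (by positivity), Real.log_mul (by positivity) (by positivity),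
    Real.log_pow, hz, hE, Real.log_exp, Real.log_exp] at h4
  push_cast at h4
  linarith

theorem half_le_gamma (hΓ : Real.log 2 ≤ Γ) : 1 / 2 ≤ Γ := by
  linarith [Real.log_two_gt_d9]

theorem one_le_two_mul_sqrt (hΓ : 1 / 2 ≤ Γ) : 1 ≤ 2 * √Γ := by
  have : 1 / 2 ≤ √Γ := Real.le_sqrt_of_sq_le (by linarith)
  linarith

/-- The width of the confidence sets. -/
theorem width_le (hB : 1 ≤ B) (hL : 1 ≤ L) (hd : 1 ≤ d) (hK : 1 ≤ K)
    (hH : 1 ≤ H) (hp : 0 < p) (hp1 : p < 1) (hΓ : Γ = Real.log (2 * d * K * H / p))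
    (hlam : 0 < lam) (hlog : Real.log (1 / lam) ≤ B * Γ) {m : ℕ}
    (hm : (m : ℝ) ≤ (K * (1 + L * H) + (c * d * H * √Γ) ^ 2) / lam * K + 1) :
    √((2 * L * H) ^ 2 * (d * Real.log (1 + K / lam) +
      2 * Real.log (1 / (p / (2 * H * K * (2 * m + 1) ^ (d + d * d)))))) + 4 * L +
        2 * H * √(B * d) ≤ widthConst B L c * (d * H * √Γ) := by
  have hd' : (1 : ℝ) ≤ d := by exact_mod_cast hd
  have hK' : (1 : ℝ) ≤ K := by exact_mod_cast hK
  have hH' : (1 : ℝ) ≤ H := by exact_mod_cast hH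
  have hΓ2 := log_two_le_gamma hd hK hH hp hp1 hΓ
  have hΓh := half_le_gamma hΓ2
  have hΓ0 : 0 < Γ := by linarith
  have hlam1 := log_one_add_div_le hB hd hK hH hp hp1 hΓ hlam hlog
  have hgrid := log_grid_le (c := c) hB hL hd hK hH hp hp1 hΓ hlam hlog hm
  set ℓ := Real.log (2 * L + 2 * c ^ 2 + 3) with hℓ
  have hℓ0 : 0 ≤ ℓ := Real.log_nonneg (by nlinarith [sq_nonneg c])
  have hdsq : (d : ℝ) ≤ d ^ 2 := by nlinarith
  have hdsq1 : (1 : ℝ) ≤ (d : ℝ) ^ 2 := by nlinarith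
  have hℓΓ : ℓ ≤ 2 * ℓ * Γ := by nlinarith
  have e1 : Real.log (1 / (p / (2 * H * K * (2 * m + 1) ^ (d + d * d)))) ≤
      d ^ 2 * Γ * (9 + 2 * B + 4 * ℓ) := by
    have h1 : 1 / (p / (2 * H * K * (2 * (m : ℝ) + 1) ^ (d + d * d))) =
        2 * H * K / p * (2 * m + 1) ^ (d + d * d) := by field_simp
    have h2 : Real.log (2 * H * K / p) ≤ Γ := by
      rw [hΓ]
      apply Real.log_le_log (by positivity)
      refine div_le_div_of_nonneg_right ?_ hp.le
      calc (2 : ℝ) * H * K = 2 * 1 * K * H := by ring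
        _ ≤ 2 * d * K * H := by gcongr
    rw [h1, Real.log_mul (by positivity) (by positivity), Real.log_pow]
    have hm0 : 0 ≤ ℓ + (4 + B) * Γ := by positivity
    calc _ ≤ Γ + ((d + d * d : ℕ) : ℝ) * (ℓ + (4 + B) * Γ) := by gcongr
      _ ≤ d ^ 2 * Γ + (2 * d ^ 2) * (2 * ℓ * Γ + (4 + B) * Γ) := by
          gcongr
          · exact le_mul_of_one_le_left hΓ0.le hdsq1
          · push_cast; nlinarith
      _ = _ := by ring
  have e2 : d * Real.log (1 + K / lam) ≤ d ^ 2 * Γ * (2 + B) := by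
    calc d * Real.log (1 + K / lam) ≤ d * ((2 + B) * Γ) := by gcongr
      _ ≤ d ^ 2 * ((2 + B) * Γ) := by gcongr
      _ = _ := by ring
  have e3 : √((2 * L * H) ^ 2 * (d * Real.log (1 + K / lam) +
      2 * Real.log (1 / (p / (2 * H * K * (2 * m + 1) ^ (d + d * d)))))) ≤
      2 * L * √(20 + 5 * B + 8 * ℓ) * (d * H * √Γ) := by
    apply Real.sqrt_le_iff.mpr
    refine ⟨by positivity, ?_⟩
    -- The numbers in `widthConst` arise here: `(2 + B) + 2(9 + 2B + 4ℓ) = 20 + 5B + 8ℓ`.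
    calc _ ≤ (2 * L * H) ^ 2 * (d ^ 2 * Γ * (2 + B) + 2 * (d ^ 2 * Γ * (9 + 2 * B + 4 * ℓ))) := by
          gcongr
      _ = (2 * L * H) ^ 2 * (d ^ 2 * (√Γ) ^ 2 * (√(20 + 5 * B + 8 * ℓ)) ^ 2) := by
          rw [Real.sq_sqrt hΓ0.le, Real.sq_sqrt (by positivity)]; ring
      _ = _ := by ring
  have hs := one_le_two_mul_sqrt hΓh
  have e4 : 4 * L ≤ 8 * L * (d * H * √Γ) := by
    have h1 : (1 : ℝ) ≤ d * H := one_le_mul_of_one_le_of_one_le hd' hH'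
    calc 4 * L = 4 * L * (1 * 1) := by ring
      _ ≤ 4 * L * ((d * H) * (2 * √Γ)) := by gcongr
      _ = _ := by ring
  have e5 : 2 * H * √(B * d) ≤ 4 * B * (d * H * √Γ) := by
    have h1 : √(B * d) ≤ B * d := by
      rw [Real.sqrt_le_left (by positivity)]
      have : 1 ≤ B * d := one_le_mul_of_one_le_of_one_le hB hd'
      nlinarith
    calc 2 * H * √(B * d) ≤ 2 * H * (B * d * 1) := by gcongr; linarith
      _ ≤ 2 * H * (B * d * (2 * √Γ)) := by gcongr
      _ = _ := by ring
  unfold widthConst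
  linarith

theorem regret_bound_le {N : ℕ} (hB : 1 ≤ B) (hd : 1 ≤ d) (hK : 1 ≤ K)
    (hH : 1 ≤ H) (hp : 0 < p) (hp1 : p < 1) (hΓ : Γ = Real.log (2 * d * K * H / p))
    (hlam : 0 < lam) (hlamB : lam ≤ B) {c₀ : ℝ} (hc0 : 0 ≤ c₀) (hc : 7 * c₀ + 20 * B ≤ c) :
    H * (N : ℝ) ^ H * ((c * d * H * √Γ + c₀ * (d * H * √Γ)) *
        √(K * (d * Real.log (1 + K / lam) / Real.log 2)) +
        H * √((K + 1) * (Real.log (1 + K) + 2 * Real.log (1 / (p / (2 * H)))))) ≤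
      c * (H : ℝ) ^ 2 * (N : ℝ) ^ H * d * √(K : ℝ) * √(2 * d * Γ * Real.log (1 + K / lam)) := by
  have hd' : (1 : ℝ) ≤ d := by exact_mod_cast hd
  have hK' : (1 : ℝ) ≤ K := by exact_mod_cast hK
  have hH' : (1 : ℝ) ≤ H := by exact_mod_cast hH
  have hΓ2 := log_two_le_gamma hd hK hH hp hp1 hΓ
  have hΓ0 : 0 < Γ := by linarith [half_le_gamma hΓ2]
  set l := Real.log (1 + K / lam) with hl
  -- Since `lam ≤ B ≤ B K`, the logarithm is bounded below by `1/(2B)`, so the martingale term,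
  -- which lacks this factor, can be absorbed.
  have hl0 : 1 ≤ 2 * B * l := by
    have h1 : 1 + 1 / B ≤ 1 + K / lam := by gcongr
    have h2 := Real.log_le_log (by positivity) h1
    have h3 := Real.one_sub_inv_le_log_of_pos (show 0 < 1 + 1 / B by positivity)
    have h4 : 1 - (1 + 1 / B)⁻¹ = 1 / (1 + B) := by field_simp; ring
    have h5 : 1 / (2 * B) ≤ 1 / (1 + B) := one_div_le_one_div_of_le (by linarith) (by linarith)
    have h6 : 1 / (2 * B) ≤ l := by linarith
    rwa [div_le_iff₀ (by positivity), mul_comm] at h6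
  have hlp : 0 ≤ l := by
    by_contra h
    nlinarith
  set E := √(K * d * l) with hE
  -- Numerically `1/√(ln 2) < 1.21` and `1.41 < √2`. The slack `0.2 c` must cover `1.21 c₀ + 4B`,
  -- which explains the condition `7 c₀ + 20 B ≤ c`.
  have f1 : √(K * (d * l / Real.log 2)) ≤ 1.21 * E := by
    rw [hE, show (1.21 : ℝ) = √(1.21 ^ 2) by rw [Real.sqrt_sq (by norm_num)],
      ← Real.sqrt_mul (by positivity)]
    apply Real.sqrt_le_sqrt
    rw [← mul_div_assoc, div_le_iff₀ (Real.log_pos one_lt_two)]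
    have h1 : 1 ≤ 1.21 ^ 2 * Real.log 2 := by nlinarith [Real.log_two_gt_d9]
    calc (K : ℝ) * (d * l) = K * d * l * 1 := by ring
      _ ≤ K * d * l * (1.21 ^ 2 * Real.log 2) := by gcongr
      _ = _ := by ring
  have f2 : √((K + 1) * (Real.log (1 + K) + 2 * Real.log (1 / (p / (2 * H))))) ≤
      4 * B * (√Γ * E) := by
    have g1 : Real.log (1 + K) ≤ Γ := by
      rw [hΓ]
      apply Real.log_le_log (by positivity)
      rw [le_div_iff₀ hp]
      have h1 : (1 : ℝ) ≤ d * H := one_le_mul_of_one_le_of_one_le hd' hH'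
      calc (1 + (K : ℝ)) * p ≤ (1 + K) * 1 := by gcongr
        _ ≤ 2 * K * 1 := by linarith
        _ ≤ 2 * K * (d * H) := by gcongr
        _ = _ := by ring
    have g2 : Real.log (1 / (p / (2 * H))) ≤ Γ := by
      rw [hΓ, one_div_div]
      apply Real.log_le_log (by positivity)
      refine div_le_div_of_nonneg_right ?_ hp.le
      have h1 : (1 : ℝ) ≤ d * K := one_le_mul_of_one_le_of_one_le hd' hK'
      calc (2 : ℝ) * H = 2 * 1 * H := by ring
        _ ≤ 2 * (d * K) * H := by gcongr
        _ = _ := by ring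
    apply Real.sqrt_le_iff.mpr
    refine ⟨by positivity, ?_⟩
    calc _ ≤ (K + 1) * (Γ + 2 * Γ) := by gcongr
      _ ≤ (K + K) * (Γ + 2 * Γ) := by gcongr
      _ = 6 * (K * Γ) * 1 := by ring
      _ ≤ 6 * (K * Γ) * (2 * B * l) := by gcongr
      _ = 12 * B * (K * Γ * l * 1) := by ring
      _ ≤ 16 * B ^ 2 * (K * Γ * l * d) := by gcongr <;> nlinarith
      _ = (4 * B) ^ 2 * ((√Γ) ^ 2 * E ^ 2) := by
          rw [Real.sq_sqrt hΓ0.le, hE, Real.sq_sqrt (by positivity)]; ring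
      _ = _ := by ring
  have f3 : 1.41 * (√Γ * E) ≤ √(K : ℝ) * √(2 * d * Γ * l) := by
    rw [hE, ← Real.sqrt_mul hΓ0.le, ← Real.sqrt_mul (by positivity),
      show (1.41 : ℝ) = √(1.41 ^ 2) by rw [Real.sqrt_sq (by norm_num)],
      ← Real.sqrt_mul (by positivity)]
    apply Real.sqrt_le_sqrt
    calc 1.41 ^ 2 * (Γ * (K * d * l)) ≤ 2 * (Γ * (K * d * l)) := by gcongr; norm_num
      _ = _ := by ring
  have hc' : 0 ≤ c := by linarith
  calc _ ≤ H * (N : ℝ) ^ H * ((c * d * H * √Γ + c₀ * (d * H * √Γ)) * (1.21 * E) +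
        H * (4 * B * (√Γ * E))) := by gcongr
    _ ≤ H * (N : ℝ) ^ H * ((c * d * H * √Γ + c₀ * (d * H * √Γ)) * (1.21 * E) +
        d * H * (4 * B * (√Γ * E))) := by
        gcongr
        exact le_mul_of_one_le_left (by positivity) hd'
    _ = H ^ 2 * (N : ℝ) ^ H * d * ((1.21 * (c + c₀) + 4 * B) * (√Γ * E)) := by ring
    _ ≤ H ^ 2 * (N : ℝ) ^ H * d * (c * (1.41 * (√Γ * E))) := by
        gcongr ?_ * ?_
        have : 1.21 * (c + c₀) + 4 * B ≤ c * 1.41 := by linarith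
        calc _ ≤ c * 1.41 * (√Γ * E) := by gcongr
          _ = _ := by ring
    _ ≤ H ^ 2 * (N : ℝ) ^ H * d * (c * (√(K : ℝ) * √(2 * d * Γ * l))) := by gcongr
    _ = _ := by ring

end Constants

end RiskQ

theorem theorem1 (B L : ℝ) (hB : 1 ≤ B) (hL : 1 ≤ L) :
    ∃ cβ : ℝ, 0 < cβ ∧
      ∀ (X A Ω : Type*) [Fintype X] [Fintype A] [Nonempty A] [MeasurableSpace Ω]
        (μ : MeasureTheory.Measure Ω) [MeasureTheory.IsProbabilityMeasure μ]
        (H N d K : ℕ) [NeZero N] (_ : 1 ≤ H) (_ : 1 ≤ K)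
        (M : RiskQ.RiskMDP X A H) (φ : X → A → Fin d → ℝ) (_ : M.IsMultipattern N φ)
        (p : ℝ) (_ : 0 < p) (_ : p < 1)
        (Γ : ℝ) (_ : Γ = Real.log (2 * d * K * H / p))
        (lam : ℝ) (_ : 0 < lam) (_ : lam ≤ B) (_ : Real.log (1 / lam) ≤ B * Γ)
        (β : ℝ) (_ : β = cβ * d * H * √Γ)
        (R : RiskQ.QLearningRun M N φ K lam β μ)
        (_ : R.UsesAggregator ∨ R.UsesUnbiasedEstimator L),
        μ {ω | cβ * (H : ℝ) ^ 2 * (N : ℝ) ^ H * d * √(K : ℝ) *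
              √(2 * d * Γ * Real.log (1 + K / lam)) < R.regret ω} ≤ ENNReal.ofReal p := by
  obtain ⟨c, hc2, hc⟩ := RiskQ.exists_const_dominating_width hB hL
  refine ⟨c, by linarith, ?_⟩
  intro X A Ω _ _ _ _ μ _ H N d K _ hH hK M φ hM p hp hp1 Γ hΓ lam hlam hlamB hlog β hβ R hR
  have hR' : R.UsesUnbiasedEstimator L := hR.elim (fun h => h.usesUnbiasedEstimator hL) id
  -- A sample point gives a state and hence a feature vector with coordinate sum 1, which forces `d
  -- ≥ 1`.
  obtain ⟨ω₀⟩ : Nonempty Ω := μ.nonempty_of_neZero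
  have hd : 1 ≤ d := by
    rcases Nat.eq_zero_or_pos d with rfl | h
    · have := (hM.simplex (R.state 1 1 ω₀) (Classical.arbitrary A)).2
      simp at this
    · exact h
  have hΓh := RiskQ.half_le_gamma (RiskQ.log_two_le_gamma hd hK hH hp hp1 hΓ)
  have hs := RiskQ.one_le_two_mul_sqrt hΓh
  have hd' : (1 : ℝ) ≤ d := by exact_mod_cast hd
  have hH' : (1 : ℝ) ≤ H := by exact_mod_cast hH
  have hw0 : 0 ≤ RiskQ.widthConst B L c := by unfold RiskQ.widthConst; positivity
  have hS0 : 0 ≤ d * H * √Γ := by positivity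
  -- One box size that contains both the regression weights and the entries of `β² Λ⁻¹`.
  set m : ℕ := ⌈(K * (1 + L * H) + (c * d * H * √Γ) ^ 2) / lam * K⌉₊ with hmdef
  have hmle : (m : ℝ) ≤ (K * (1 + L * H) + (c * d * H * √Γ) ^ 2) / lam * K + 1 :=
    (Nat.ceil_lt_add_one (by positivity)).le
  have hmge : (K * (1 + L * H) + (c * d * H * √Γ) ^ 2) / lam * K ≤ m := Nat.le_ceil _
  have hmain := RiskQ.QLearningRun.measure_regret_gt_le (p := p) (m := m)
    (b := RiskQ.widthConst B L c * (d * H * √Γ)) hR' hL hM hH hK hlam hlamB hp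
    (RiskQ.width_le hB hL hd hK hH hp hp1 hΓ hlam hlog hmle)
    (by
      rw [hβ, show c * d * H * √Γ = c * (d * H * √Γ) by ring]
      gcongr
      linarith)
    (by
      rw [hβ]
      calc (H : ℝ) = 1 * H * 1 := by ring
        _ ≤ d * H * (2 * √Γ) := by gcongr
        _ = 2 * d * H * √Γ := by ring
        _ ≤ c * d * H * √Γ := by gcongr)
    (by
      refine le_trans ?_ hmge
      gcongr
      exact le_add_of_nonneg_right (sq_nonneg _))
    (by
      rw [hβ]
      refine le_trans ?_ hmge
      gcongr
      exact le_add_of_nonneg_left (by positivity))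
  refine le_trans (MeasureTheory.measure_mono fun ω hω => ?_) hmain
  simp only [Set.mem_ofPred_eq] at hω ⊢
  refine lt_of_le_of_lt ?_ hω
  rw [hβ]
  exact RiskQ.regret_bound_le hB hd hK hH hp hp1 hΓ hlam hlamB hw0 hc
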